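/- **Conventions.** $\mathbb K$ is $\mathbb R$ or $\mathbb C$; $p,q,n\ge 0$ are integers; vector spaces, linear maps and Lie groups are real. $M(p,q;R)$ is the space of $p\times q$ matrices over a finite-dimensional associative real algebra $R$, $X^t$ is the transpose, and $\overline X$ is obtained by conjugating every entry. $\mathbb K[i]=\mathbb K[x]/(x^2+1)$, with conjugation $a+ib\mapsto a-ib$ ($a,b\in\mathbb K$). On $\mathbb H$ let $\overline x$ be the usual conjugation, $\theta(x)=jxj^{-1}$ and $\widetilde x=j\overline xj^{-1}$; for matrices, $\theta(X)$ and $\widetilde X$ are taken entry by entry. For an involution (anti-automorphism of order at most 2) $\delta$ of $R$ put $X^*=\delta(X)^t$, $\mathrm{Herm}(n;R,\delta)=\{X: X^*=X\}$ and $\mathrm{Aherm}(n;R,\delta)=\{X: X^*=-X\}$. If $R$ is $\mathbb C$, $\mathbb H$ or $\mathbb K[i]$ and nothing else is said, $\delta$ is the conjugation; $\widetilde{\mathbb H}$ stands for $\mathbb H$ with $\delta(x)=\widetilde x$. For commutative $R$ and $\delta=\mathrm{id}$ one writes $\mathrm{Sym}(n,R)$ and $\mathrm{Asym}(n,R)$.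 *Groups.* For $A\in M(q,p;R)$, $\mathrm{Gl}_{p,q}(A;R)=\{X\in M(p,q;R): 1-AX \text{ invertible}\}$ is a Lie group with product $X+Y-XAY$ and neutral element $0$; $\mathrm{Gl}_n=\mathrm{Gl}_{n,n}$. For $A\in\mathrm{Herm}(n;R,\delta)$ let $U_n(A;R,\delta)=\{X\in\mathrm{Gl}_n(A;R): X^*+X=X^*AX\}$; for $A\in\mathrm{Aherm}(n;R,\delta)$ let $\mathrm{Sp}_{n/2}(A;R,\delta)=\{X\in\mathrm{Gl}_n(A;R): X^*-X=X^*AX\}$. For $\delta=\mathrm{id}$ write $O_n(A;R)$ and $\mathrm{Sp}_{n/2}(A;R)$. *Lie triple systems (LTS).* An LTS is a vector space with a trilinear bracket such that $[X,Y,Z]=-[Y,X,Z]$, $[X,Y,Z]+[Y,Z,X]+[Z,X,Y]=0$, and every $[U,W,\cdot\,]$ is a derivation of the triple bracket. The LTS of a symmetric space $G/H$ ($G$ a Lie group with an involution $\sigma$, $H$ an open subgroup of $G^\sigma$) is the $-1$-eigenspace of $d\sigma$ in $\mathrm{Lie}(G)$ with $[[X,Y],Z]$; the LTS of a Lie group $G$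 ("group case") is $\mathrm{Lie}(G)$ with $[[X,Y],Z]$. *Realizations.* $\rho(a+ib)=\begin{pmatrix}a&b\\-b&a\end{pmatrix}$ and $\rho'(a+ib)=\begin{pmatrix}a&b\\b&-a\end{pmatrix}$ for real matrices $a,b$; $\kappa(a+bj)=\begin{pmatrix}a&b\\-\overline b&\overline a\end{pmatrix}$ for complex matrices $a,b$; $J=\begin{pmatrix}0&1\\-1&0\end{pmatrix}$. $\mathrm{diag}(A,B)$ is the block diagonal matrix. **Theorem.** Let $V^+$ be one of the spaces below. Put $V^-=M(q,p;R)$ if $V^+=M(p,q;R)$, and $V^-=V^+$ otherwise; let $T(X,W,Z)=XWZ+ZWX$ for $X,Z\in V^+$, $W\in V^-$. For every line below, and every parameter as stated there, $\alpha$ is a real linear map $V^+\to V^-$, the bracket $$[X,Y,Z]_\alpha=T(X,\alpha Y,Z)-T(Y,\alpha X,Z)$$ makes $V^+$ an LTS, and this LTS is isomorphic to the LTS of the given symmetric space $G/H$ or group $G$. Here $G$ is a closed subgroup of the Lie group $\mathrm{Gl}(\cdot)$ containing it; $H$ is embedded in $G$ by inclusion of the coefficients (by $x\mapsto\mathrm{diag}(x_1,x_2)$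 for products, and by $\rho$ or $\kappa$ when the parameter of $G$ is $\rho(\cdot)$ or $\kappa(\cdot)$), unless an embedding is given. Consequently the spaces belonging to the same $V^+$ are homotopes of one another: they arise from the same $(V^+,V^-,T)$ by changing $\alpha$. **$V^+=M(p,q;\mathbb K)$.** In 1.a, 1.a$'$: $A\in M(q,p;\mathbb K)$. - 1.a: group $\mathrm{Gl}_{p,q}(A;\mathbb K)$; $\alpha(X)=AXA$. - 1.a$'$: $\mathrm{Gl}_{p,q}(A;\mathbb K[i])/\mathrm{Gl}_{p,q}(A;\mathbb K)$; $\alpha(X)=-AXA$. - 1.b: $O_{p+q}(\mathrm{diag}(A,B);\mathbb K)/(O_p(A;\mathbb K)\times O_q(B;\mathbb K))$; $\alpha(X)=-BX^tA$; $A\in\mathrm{Sym}(p,\mathbb K)$, $B\in\mathrm{Sym}(q,\mathbb K)$. - 1.c: $\mathrm{Sp}_{(p+q)/2}(\mathrm{diag}(A,B);\mathbb K)/(\mathrm{Sp}_{p/2}(A;\mathbb K)\times\mathrm{Sp}_{q/2}(B;\mathbb K))$; $\alpha(X)=BX^tA$; $A\in\mathrm{Asym}(p,\mathbb K)$, $B\in\mathrm{Asym}(q,\mathbb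 K)$. **$V^+=M(p,q;\mathbb C)$, antilinear $\alpha$.** In 1.A, 1.A$'$: $A\in M(q,p;\mathbb C)$; in 1.A, $\mathbb C\subset M(2,2;\mathbb R)$ by $\rho$. - 1.A: $\mathrm{Gl}_{p,q}(A;M(2,2;\mathbb R))/\mathrm{Gl}_{p,q}(A;\mathbb C)$; $\alpha(X)=A\,\overline{XA}$. - 1.A$'$: $\mathrm{Gl}_{p,q}(A;\mathbb H)/\mathrm{Gl}_{p,q}(A;\mathbb C)$; $\alpha(X)=-A\,\overline{XA}$. - 1.B: $U_{p+q}(\mathrm{diag}(A,B);\mathbb C)/(U_p(A;\mathbb C)\times U_q(B;\mathbb C))$; $\alpha(X)=-B\overline X^tA$; $A\in\mathrm{Herm}(p,\mathbb C)$, $B\in\mathrm{Herm}(q,\mathbb C)$. **$V^+=M(p,q;\mathbb H)$.** In 1.3.a, 1.3.a$'$: $A\in M(q,p;\mathbb H)$; in 1.3.a$'$, $\mathbb H\subset M(2,2;\mathbb C)$ by $\kappa$. - 1.3.a: group $\mathrm{Gl}_{p,q}(A;\mathbb H)$; $\alpha(X)=AXA$. - 1.3.a$'$: $\mathrm{Gl}_{p,q}(A;M(2,2;\mathbb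 C))/\mathrm{Gl}_{p,q}(A;\mathbb H)$; $\alpha(X)=-AXA$. - 1.3.b: $U_{p+q}(\mathrm{diag}(A,B);\mathbb H)/(U_p(A;\mathbb H)\times U_q(B;\mathbb H))$; $\alpha(X)=-B\overline X^tA$; $A\in\mathrm{Herm}(p,\mathbb H)$, $B\in\mathrm{Herm}(q,\mathbb H)$. - 1.3.c: $U_{p+q}(\mathrm{diag}(A,B);\widetilde{\mathbb H})/(U_p(A;\widetilde{\mathbb H})\times U_q(B;\widetilde{\mathbb H}))$; $\alpha(X)=-B\widetilde X^tA$; $A\in\mathrm{Herm}(p,\widetilde{\mathbb H})$, $B\in\mathrm{Herm}(q,\widetilde{\mathbb H})$. **$V^+=\mathrm{Sym}(n,\mathbb K)$.** $A\in\mathrm{Sym}(n,\mathbb K)$ in 2.a, 2.a$'$; $A\in\mathrm{Asym}(n,\mathbb K)$ in 2.b, 2.b$'$. - 2.a: $\mathrm{Gl}_n(A;\mathbb K)/O_n(A;\mathbb K)$; $\alpha(X)=AXA$. - 2.a$'$: $U_n(A;\mathbb K[i])/O_n(A;\mathbb K)$; $\alpha(X)=-AXA$. - 2.b: group $\mathrm{Sp}_{n/2}(A;\mathbb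 K)$; $\alpha(X)=AXA$. - 2.b$'$: $\mathrm{Sp}_{n/2}(A;\mathbb K[i],\mathrm{id})/\mathrm{Sp}_{n/2}(A;\mathbb K)$; $\alpha(X)=-AXA$. **$V^+=\mathrm{Sym}(n,\mathbb C)$, antilinear $\alpha$.** $A\in\mathrm{Herm}(n,\mathbb C)$. - 2.A: $U_n(A;\mathbb H)/U_n(A;\mathbb C)$; $\alpha(X)=-A\,\overline{XA}$. - 2.A$'$: $\mathrm{Sp}_n(\rho(i\overline A);\mathbb R)/\mathrm{Sp}_{n/2}(i\overline A;\mathbb C,\text{conjugation})$, the latter group being isomorphic to $U_n(\overline A;\mathbb C)$; for $A=a+ib$, $\rho(i\overline A)=\begin{pmatrix}b&a\\-a&b\end{pmatrix}$; $\alpha(X)=A\,\overline{XA}$. **$V^+=\mathrm{Asym}(n,\mathbb K)$.** $A\in\mathrm{Asym}(n,\mathbb K)$ in 3.a, 3.a$'$; $A\in\mathrm{Sym}(n,\mathbb K)$ in 3.b, 3.b$'$. - 3.a: $\mathrm{Gl}_n(A;\mathbb K)/\mathrm{Sp}_{n/2}(A;\mathbb K)$; $\alpha(X)=AXA$. - 3.a$'$: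 $\mathrm{Sp}_{n/2}(A;\mathbb K[i],\text{conjugation})/\mathrm{Sp}_{n/2}(A;\mathbb K)$, the numerator being isomorphic to $U_n(iA;\mathbb K[i])$; $\alpha(X)=-AXA$. - 3.b: group $O_n(A;\mathbb K)$; $\alpha(X)=AXA$. - 3.b$'$: $O_n(A;\mathbb K[i])/O_n(A;\mathbb K)$; $\alpha(X)=-AXA$. **$V^+=\mathrm{Asym}(n,\mathbb C)$, antilinear $\alpha$.** $A\in\mathrm{Herm}(n,\mathbb C)$. - 3.A: $U_n(A;\widetilde{\mathbb H})/U_n(A;\mathbb C)$, where $\mathbb C$ is embedded in $\mathbb H$ by $x+iy\mapsto x+jy$; $\alpha(X)=-A\,\overline{XA}$. - 3.A$'$: $O_{2n}(\rho(A);\mathbb R)/U_n(A;\mathbb C)$; $\alpha(X)=A\,\overline{XA}$. **$V^+=\mathrm{Herm}(n,\mathbb C)$.** $A\in\mathrm{Herm}(n,\mathbb C)$ in 1.1.a, 1.1.a$'$; $A\in\mathrm{Sym}(n,\mathbb C)$ in 1.1.b, 1.1.b$'$; $A\in\mathrm{Asym}(n,\mathbb C)$ in 1.1.c, 1.1.c$'$.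 - 1.1.a: $\mathrm{Gl}_n(A;\mathbb C)/U_n(A;\mathbb C)$; $\alpha(X)=AXA$. - 1.1.a$'$: group $U_n(A;\mathbb C)$; $\alpha(X)=-AXA$. - 1.1.b: $U_n(A;\widetilde{\mathbb H})/O_n(A;\mathbb C)$; $\alpha(X)=-A\,\overline{XA}$. - 1.1.b$'$: $O_{2n}(\rho'(A);\mathbb R)/O_n(A;\mathbb C)$, embedding $x\mapsto\rho'(\overline x)$; $\alpha(X)=A\,\overline{XA}$. - 1.1.c: $\mathrm{Sp}_n(\rho'(A);\mathbb R)/\mathrm{Sp}_{n/2}(A;\mathbb C)$, embedding $x\mapsto\rho'(\overline x)$; $\alpha(X)=A\,\overline{XA}$. - 1.1.c$'$: $U_n(jA;\mathbb H)/\mathrm{Sp}_{n/2}(A;\mathbb C)$, embedding $x\mapsto-xj$; $\alpha(X)=-A\,\overline{XA}$. **$V^+=\mathrm{Herm}(n,\mathbb H)$.** $A\in\mathrm{Herm}(n,\mathbb H)$ in 3.1.a, 3.1.a$'$; $A\in\mathrm{Herm}(n,\widetilde{\mathbb H})$ in 3.1.b, 3.1.b$'$. - 3.1.a: $\mathrm{Gl}_n(A;\mathbb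 H)/U_n(A;\mathbb H)$; $\alpha(X)=AXA$. - 3.1.a$'$: $U_{2n}(\kappa(A);\mathbb C)/U_n(A;\mathbb H)$; $\alpha(X)=-AXA$. - 3.1.b: group $U_n(A;\widetilde{\mathbb H})$; $\alpha(X)=-A\,\theta(XA)$. - 3.1.b$'$: $O_{2n}(\kappa(A);\mathbb C)/U_n(A;\widetilde{\mathbb H})$; $\alpha(X)=A\,\theta(XA)$. **$V^+=\mathrm{Herm}(n,\widetilde{\mathbb H})$.** $A\in\mathrm{Herm}(n,\widetilde{\mathbb H})$ in 2.2.a, 2.2.a$'$; $A\in\mathrm{Herm}(n,\mathbb H)$ in 2.2.b, 2.2.b$'$. - 2.2.a: $\mathrm{Gl}_n(A;\mathbb H)/U_n(A;\widetilde{\mathbb H})$; $\alpha(X)=AXA$. - 2.2.a$'$: $U_{2n}(iJ\kappa(A);\mathbb C)/U_n(A;\widetilde{\mathbb H})$, embedding $x\mapsto\kappa(x)\,iJ$; $\alpha(X)=-AXA$. - 2.2.b: group $U_n(A;\mathbb H)$; $\alpha(X)=-A\,\theta(XA)$. - 2.2.b$'$: $\mathrm{Sp}_n(J\kappa(A);\mathbb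 C)/U_n(A;\mathbb H)$, embedding $x\mapsto-\kappa(x)J$; $\alpha(X)=A\,\theta(XA)$. -/

import Mathlib

open scoped Manifold ContDiff Quaternion Matrix

attribute [local instance] Matrix.linftyOpNormedRing Matrix.linftyOpNormedAlgebra

noncomputable section

namespace Homotope

/-! ### The groups `Gl_{p,q}(A; R)` -/

section Gl

variable {m n R : Type*} [Fintype m] [Fintype n] [DecidableEq n]

/-- The underlying set of the group `Gl_{p,q}(A; R)`, for a `q × p` matrix `A`: all `p × q` matrices
`X` such that `1 - A X` is invertible. -/
@[ext]
structure Gl [Ring R] (A : Matrix n m R) where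
  val : Matrix m n R
  isUnit : IsUnit (1 - A * val)

namespace Gl

section Group

variable [Ring R] {A : Matrix n m R}

/-- The group structure of `Gl_{p,q}(A; R)`: the product is `X + Y - X A Y`, the neutral element
is `0`, and the inverse of `X` is `- X (1 - A X)⁻¹`. -/
instance : Group (Gl A) where
  mul X Y := ⟨X.val + Y.val - X.val * A * Y.val, by
    have h : 1 - A * (X.val + Y.val - X.val * A * Y.val) =
        (1 - A * X.val) * (1 - A * Y.val) := by
      simp only [Matrix.mul_add, Matrix.mul_sub, Matrix.sub_mul, Matrix.mul_assoc, Matrix.one_mul,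
        Matrix.mul_one]
      abel
    rw [h]
    exact X.isUnit.mul Y.isUnit⟩
  one := ⟨0, by simp⟩
  inv X := ⟨-(X.val * Ring.inverse (1 - A * X.val)), by
    have h : 1 - A * -(X.val * Ring.inverse (1 - A * X.val)) =
        Ring.inverse (1 - A * X.val) := by
      have h1 := Ring.mul_inverse_cancel _ X.isUnit
      rw [Matrix.mul_neg, sub_neg_eq_add, ← Matrix.mul_assoc]
      rw [Matrix.sub_mul, Matrix.one_mul] at h1
      nth_rewrite 1 [← h1]
      abel
    rw [h]
    exact X.isUnit.ringInverse⟩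
  mul_assoc X Y Z := by
    apply Gl.ext
    change X.val + Y.val - X.val * A * Y.val + Z.val - (X.val + Y.val - X.val * A * Y.val) * A * Z.val
      = X.val + (Y.val + Z.val - Y.val * A * Z.val) - X.val * A * (Y.val + Z.val - Y.val * A * Z.val)
    simp only [Matrix.mul_add, Matrix.mul_sub, Matrix.sub_mul, Matrix.add_mul, Matrix.mul_assoc]
    abel
  one_mul X := by
    apply Gl.ext
    change 0 + X.val - 0 * A * X.val = X.val
    simp
  mul_one X := by
    apply Gl.ext
    change X.val + 0 - X.val * A * 0 = X.val
    simp
  inv_mul_cancel X := by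
    apply Gl.ext
    have h1 := Ring.inverse_mul_cancel _ X.isUnit
    change -(X.val * Ring.inverse (1 - A * X.val)) + X.val
      - -(X.val * Ring.inverse (1 - A * X.val)) * A * X.val = 0
    rw [Matrix.mul_sub, Matrix.mul_one] at h1
    have h2 : X.val = X.val * (Ring.inverse (1 - A * X.val)
        - Ring.inverse (1 - A * X.val) * (A * X.val)) := by rw [h1, Matrix.mul_one]
    rw [Matrix.mul_sub, ← Matrix.mul_assoc] at h2
    rw [Matrix.neg_mul, Matrix.neg_mul, sub_neg_eq_add, Matrix.mul_assoc _ A]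
    generalize X.val * Ring.inverse (1 - A * X.val) = J at h2 ⊢
    rw [neg_add_eq_sub, sub_add, ← h2, sub_self]

theorem val_mul (X Y : Gl A) : (X * Y).val = X.val + Y.val - X.val * A * Y.val := rfl

theorem val_one : (1 : Gl A).val = 0 := rfl

theorem val_inv (X : Gl A) : (X⁻¹).val = -(X.val * Ring.inverse (1 - A * X.val)) := rfl

end Group

section Manifold

/-- The coefficients of an element of `Gl_{p,q}(A; R)`. -/
def coord [Ring R] {A : Matrix n m R} (X : Gl A) : m → n → R := Matrix.of.symm X.val

/-- `Gl_{p,q}(A; R)` is topologized as a subset of the space of matrices. -/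
instance [NormedRing R] {A : Matrix n m R} : TopologicalSpace (Gl A) :=
  TopologicalSpace.induced coord inferInstance

variable [NormedRing R] [NormedAlgebra ℝ R] [FiniteDimensional ℝ R] {A : Matrix n m R}

theorem isOpenEmbedding_coord : Topology.IsOpenEmbedding (coord : Gl A → m → n → R) := by
  refine ⟨⟨⟨rfl⟩, fun X Y h => Gl.ext h⟩, ?_⟩
  have h : Set.range (coord : Gl A → m → n → R) =
      (fun X : m → n → R => 1 - A * Matrix.of X) ⁻¹' {u | IsUnit u} := by
    ext X
    exact ⟨fun ⟨Y, hY⟩ => hY ▸ Y.isUnit, fun hX => ⟨⟨Matrix.of X, hX⟩, rfl⟩⟩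
  have : CompleteSpace (Matrix n n R) := FiniteDimensional.complete ℝ _
  rw [h]
  refine (Units.isOpen (R := Matrix n n R)).preimage ?_
  have h2 : Continuous fun X : Matrix m n R => (1 - A * X : Matrix n n R) := by fun_prop
  exact h2

/-- `Gl_{p,q}(A; R)` is an open subset of the space of matrices, hence a manifold with one chart. -/
instance : ChartedSpace (m → n → R) (Gl A) := isOpenEmbedding_coord.singletonChartedSpace

instance {k : ℕ∞ω} : IsManifold 𝓘(ℝ, m → n → R) k (Gl A) :=
  isOpenEmbedding_coord.isManifold_singleton

theorem contMDiff_coord {k : ℕ∞ω} :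
    ContMDiff 𝓘(ℝ, m → n → R) 𝓘(ℝ, m → n → R) k (coord : Gl A → m → n → R) :=
  contMDiff_isOpenEmbedding isOpenEmbedding_coord

instance {k : ℕ∞ω} : LieGroup 𝓘(ℝ, m → n → R) k (Gl A) where
  contMDiff_mul := by
    apply ContMDiff.of_comp_isOpenEmbedding isOpenEmbedding_coord
    have h : (coord : Gl A → m → n → R) ∘ (fun x : Gl A × Gl A => x.1 * x.2) =
      (fun x : (m → n → R) × (m → n → R) =>
        Matrix.of.symm (Matrix.of x.1 + Matrix.of x.2 - Matrix.of x.1 * A * Matrix.of x.2)) ∘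
        (fun x : Gl A × Gl A => (x.1.coord, x.2.coord)) := rfl
    rw [h]
    have h1 : ContMDiff (𝓘(ℝ, m → n → R).prod 𝓘(ℝ, m → n → R)) 𝓘(ℝ, (m → n → R) × (m → n → R)) k
      (fun x : Gl A × Gl A => (x.1.coord, x.2.coord)) :=
      (contMDiff_coord.comp contMDiff_fst).prodMk_space (contMDiff_coord.comp contMDiff_snd)
    refine ContMDiff.comp ?_ h1
    rw [contMDiff_iff_contDiff, contDiff_pi]
    intro i
    rw [contDiff_pi]
    intro j
    simp only [Matrix.of_symm_apply, Matrix.sub_apply, Matrix.add_apply, Matrix.of_apply,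
      Matrix.mul_apply]
    fun_prop
  contMDiff_inv := by
    apply ContMDiff.of_comp_isOpenEmbedding isOpenEmbedding_coord
    have : CompleteSpace (Matrix n n R) := FiniteDimensional.complete ℝ _
    intro X
    have h1 : ContDiff ℝ k fun x : m → n → R => 1 - A * Matrix.of x := by
      have : IsBoundedLinearMap ℝ fun x : m → n → R => A * Matrix.of x := by
        exact (LinearMap.toContinuousLinearMap
          { toFun := fun x : m → n → R => A * Matrix.of x
            map_add' := fun x y => Matrix.mul_add A (Matrix.of x) (Matrix.of y)
            map_smul' := fun c x => Matrix.mul_smul A c (Matrix.of x) }).isBoundedLinearMap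
      exact contDiff_const.sub this.contDiff
    have h2 : ContDiffAt ℝ k (fun x : m → n → R => Ring.inverse (1 - A * Matrix.of x)) X.coord := by
      obtain ⟨u, hu⟩ := X.isUnit
      have h3 := contDiffAt_ringInverse (n := k) ℝ u
      rw [hu] at h3
      exact ContDiffAt.comp X.coord h3 h1.contDiffAt
    have h4 : ∀ i j, ContDiffAt ℝ k
        (fun x : m → n → R => (Ring.inverse (1 - A * Matrix.of x) : Matrix n n R) i j) X.coord := by
      intro i j
      have : IsBoundedLinearMap ℝ fun M : Matrix n n R => M i j :=
        (LinearMap.toContinuousLinearMap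
          (Matrix.entryLinearMap ℝ R i j)).isBoundedLinearMap
      exact this.contDiff.contDiffAt.comp X.coord h2
    have h : (coord : Gl A → m → n → R) ∘ (fun x : Gl A => x⁻¹) =
      (fun x : m → n → R =>
        Matrix.of.symm (-(Matrix.of x * Ring.inverse (1 - A * Matrix.of x)))) ∘ coord := rfl
    rw [h]
    refine ContMDiffAt.comp X ?_ (contMDiff_coord X)
    rw [contMDiffAt_iff_contDiffAt, contDiffAt_pi]
    intro i
    rw [contDiffAt_pi]
    intro j
    simp only [Matrix.of_symm_apply, Matrix.neg_apply, Matrix.of_apply, Matrix.mul_apply]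
    refine ContDiffAt.neg (ContDiffAt.sum fun l _ => ContDiffAt.mul ?_ (h4 l j))
    fun_prop

end Manifold

end Gl

end Gl

/-! ### Lie triple systems and symmetric spaces -/

/-- A Lie triple system: a trilinear bracket `R X Y Z = [X, Y, Z]` that is skew-symmetric in `X, Y`,
satisfies the cyclic identity, and for which all the endomorphisms `R U W` are derivations. -/
structure IsLieTripleSystem {k V : Type*} [CommRing k] [AddCommGroup V] [Module k V]
    (R : V →ₗ[k] V →ₗ[k] V →ₗ[k] V) : Prop where
  skew : ∀ X Y Z, R X Y Z = -R Y X Z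
  cyclic : ∀ X Y Z, R X Y Z + R Y Z X + R Z X Y = 0
  derivation : ∀ U W X Y Z,
    R U W (R X Y Z) = R (R U W X) Y Z + R X (R U W Y) Z + R X Y (R U W Z)

section Lie

variable {E M Γ V : Type*} [NormedAddCommGroup E] [NormedSpace ℝ E] [TopologicalSpace M]
  (I : ModelWithCorners ℝ E M) [TopologicalSpace Γ] [ChartedSpace M Γ] [Group Γ]
  [AddCommGroup V] [Module ℝ V]

/-- `γ` is a one-parameter subgroup of the Lie group `Γ`, with initial velocity `v`. -/
def IsOneParameterSubgroup (γ : ℝ → Γ) (v : GroupLieAlgebra I Γ) : Prop :=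
  (∀ s t, γ (s + t) = γ s * γ t) ∧
    HasMFDerivAt 𝓘(ℝ, ℝ) I γ 0 (ContinuousLinearMap.toSpanSingleton ℝ (show E from v))

/-- The Lie algebra of a closed subgroup `G` of the Lie group `Γ`: the initial velocities of the
one-parameter subgroups of `Γ` that stay in `G`. -/
def lieAlgebraOf (G : Subgroup Γ) : Set (GroupLieAlgebra I Γ) :=
  {v | ∃ γ : ℝ → Γ, IsOneParameterSubgroup I γ v ∧ ∀ t, γ t ∈ G}

/-- The `-1`-eigenspace, in the Lie algebra of the closed subgroup `G`, of the differential of an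
automorphism `σ` of `G`: the differential of `σ` maps the velocity `v` of a one-parameter subgroup
`γ` to the velocity of `σ ∘ γ`, and so maps it to `-v` if and only if `σ (γ t) = γ (-t)`. -/
def antiFixed {G : Subgroup Γ} (σ : G →* G) : Set (GroupLieAlgebra I Γ) :=
  {v | ∃ γ : ℝ → G, IsOneParameterSubgroup I (fun t => (γ t : Γ)) v ∧ ∀ t, σ (γ t) = (γ t)⁻¹}

/-- The bracket `br` on `V` identifies with the Lie triple product `[[X, Y], Z]` on the subspace
`q` of the Lie algebra of the Lie group `Γ`. -/
def IsTripleBracketOn (br : V →ₗ[ℝ] V →ₗ[ℝ] V →ₗ[ℝ] V) (q : Set (GroupLieAlgebra I Γ)) : Prop :=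
  ∃ φ : V →ₗ[ℝ] GroupLieAlgebra I Γ, Function.Injective φ ∧ Set.range φ = q ∧
    ∀ X Y Z, φ (br X Y Z) = ⁅⁅φ X, φ Y⁆, φ Z⁆

/-- Group case: `G` is a closed subgroup of a Lie group, and `V` with the bracket `br` is the Lie
algebra of `G`, considered as a Lie triple system. -/
def IsLTSOfGroup [LieGroup I ∞ Γ] (br : V →ₗ[ℝ] V →ₗ[ℝ] V →ₗ[ℝ] V) (G : Subgroup Γ) : Prop :=
  IsClosed (G : Set Γ) ∧ IsTripleBracketOn I br (lieAlgebraOf I G)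

/-- `G` is a closed subgroup of a Lie group, `H` is an open subgroup of the group of fixed points of
a (continuous) involution `σ` of `G`, and `V` with the bracket `br` is the Lie triple system of the
symmetric space `G / H`, that is, the `-1`-eigenspace of `σ` in the Lie algebra of `G`, with triple
product `[[X, Y], Z]`. -/
def IsLTSOfSymmetricSpace [LieGroup I ∞ Γ] (br : V →ₗ[ℝ] V →ₗ[ℝ] V →ₗ[ℝ] V) (G : Subgroup Γ)
    (H : Subgroup G) : Prop :=
  IsClosed (G : Set Γ) ∧ ∃ σ : G →* G, Continuous σ ∧ (∀ g, σ (σ g) = g) ∧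
    (∀ h ∈ H, σ h = h) ∧ IsOpen {g : {g : G // σ g = g} | (g : G) ∈ H} ∧
    IsTripleBracketOn I br (antiFixed I σ)

end Lie

/-! ### Homotopes -/

section Homotope

variable {m n S : Type*} [Fintype m] [Fintype n] [Ring S] [Algebra ℝ S]

/-- `T(X, W, Z) = X W Z + Z W X`. -/
def T (X : Matrix m n S) (W : Matrix n m S) (Z : Matrix m n S) : Matrix m n S :=
  X * W * Z + Z * W * X

/-- `α` restricts to a linear map `V⁺ → V⁻`, and `V⁺` with the bracket
`br X Y Z = T(X, α Y, Z) - T(Y, α X, Z)` is a Lie triple system. -/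
structure IsHomotope (Vp : Submodule ℝ (Matrix m n S)) (Vm : Submodule ℝ (Matrix n m S))
    (α : Matrix m n S → Matrix n m S) (br : Vp →ₗ[ℝ] Vp →ₗ[ℝ] Vp →ₗ[ℝ] Vp) : Prop where
  linear : ∃ a : Vp →ₗ[ℝ] Vm, ∀ X : Vp, (a X : Matrix n m S) = α X
  bracket : ∀ X Y Z : Vp, (br X Y Z : Matrix m n S) = T ↑X (α Y) ↑Z - T ↑Y (α X) ↑Z
  isLieTripleSystem : IsLieTripleSystem br

variable {m' n' R : Type*} [Fintype m'] [Fintype n'] [DecidableEq n'] [NormedRing R]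
  [NormedAlgebra ℝ R] [FiniteDimensional ℝ R] {A : Matrix n' m' R}

/-- `V⁺` with the bracket defined by `α` is a Lie triple system, and it is the one of the group `G`. -/
def GroupCase (Vp : Submodule ℝ (Matrix m n S)) (Vm : Submodule ℝ (Matrix n m S))
    (α : Matrix m n S → Matrix n m S) (G : Subgroup (Gl A)) : Prop :=
  ∃ br : Vp →ₗ[ℝ] Vp →ₗ[ℝ] Vp →ₗ[ℝ] Vp, IsHomotope Vp Vm α br ∧
    IsLTSOfGroup 𝓘(ℝ, m' → n' → R) br G

/-- `V⁺` with the bracket defined by `α` is a Lie triple system, and it is the one of the symmetric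
space `G / H`, where the group `H` is embedded into `G` by the map `emb` of matrices. -/
def SymmetricCase (Vp : Submodule ℝ (Matrix m n S)) (Vm : Submodule ℝ (Matrix n m S))
    (α : Matrix m n S → Matrix n m S) (G : Subgroup (Gl A)) {H : Type*} [Group H]
    [TopologicalSpace H] (emb : H → Matrix m' n' R) : Prop :=
  ∃ br : Vp →ₗ[ℝ] Vp →ₗ[ℝ] Vp →ₗ[ℝ] Vp, IsHomotope Vp Vm α br ∧
    ∃ ι : H →* G, Topology.IsEmbedding ι ∧ (∀ h, (ι h : Gl A).val = emb h) ∧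
      IsLTSOfSymmetricSpace 𝓘(ℝ, m' → n' → R) br G ι.range

end Homotope

/-! ### Involutions, Hermitian matrices, unitary and symplectic groups -/

/-- An involution of a real algebra: an `ℝ`-linear antiautomorphism that is its own inverse. -/
structure RealInvolution (R : Type*) [Ring R] [Algebra ℝ R] extends R →ₗ[ℝ] R where
  map_mul' : ∀ x y, toFun (x * y) = toFun y * toFun x
  involutive' : ∀ x, toFun (toFun x) = x

namespace RealInvolution

section Adjoint

variable {m n l R : Type*} [Ring R] [Algebra ℝ R] (δ : RealInvolution R)

/-- The matrix `δ(X)ᵗ`. -/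
def adj (X : Matrix m n R) : Matrix n m R := (X.map δ.toLinearMap)ᵀ

theorem adj_apply (X : Matrix m n R) (i : n) (j : m) : δ.adj X i j = δ.toLinearMap (X j i) := rfl

theorem adj_add (X Y : Matrix m n R) : δ.adj (X + Y) = δ.adj X + δ.adj Y := by
  ext; simp [adj_apply]

theorem adj_sub (X Y : Matrix m n R) : δ.adj (X - Y) = δ.adj X - δ.adj Y := by
  ext; simp [adj_apply]

theorem adj_neg (X : Matrix m n R) : δ.adj (-X) = -δ.adj X := by
  ext; simp [adj_apply]

theorem adj_zero : δ.adj (0 : Matrix m n R) = 0 := by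
  ext; simp [adj_apply]

theorem adj_smul (c : ℝ) (X : Matrix m n R) : δ.adj (c • X) = c • δ.adj X := by
  ext; simp [adj_apply]

theorem adj_adj (X : Matrix m n R) : δ.adj (δ.adj X) = X := by
  ext; exact δ.involutive' _

theorem adj_mul [Fintype n] (X : Matrix m n R) (Y : Matrix n l R) :
    δ.adj (X * Y) = δ.adj Y * δ.adj X := by
  ext i j
  simp only [adj_apply, Matrix.mul_apply, map_sum]
  exact Finset.sum_congr rfl fun k _ => δ.map_mul' _ _

/-- `Herm(n; R, δ)`: the square matrices with `δ(X)ᵗ = X`. -/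
def Herm (m : Type*) : Submodule ℝ (Matrix m m R) where
  carrier := {X | δ.adj X = X}
  add_mem' {X Y} hX hY := by
    change δ.adj (X + Y) = X + Y
    rw [adj_add, hX, hY]
  zero_mem' := δ.adj_zero
  smul_mem' c X hX := by
    change δ.adj (c • X) = c • X
    rw [adj_smul, hX]

/-- `Aherm(n; R, δ)`: the square matrices with `δ(X)ᵗ = -X`. -/
def Aherm (m : Type*) : Submodule ℝ (Matrix m m R) where
  carrier := {X | δ.adj X = -X}
  add_mem' {X Y} hX hY := by
    change δ.adj (X + Y) = -(X + Y)
    rw [adj_add, hX, hY, neg_add]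
  zero_mem' := by
    change δ.adj 0 = -0
    rw [adj_zero, neg_zero]
  smul_mem' c X hX := by
    change δ.adj (c • X) = -(c • X)
    rw [adj_smul, hX, smul_neg]

end Adjoint

section GroupsAux

variable {m R : Type*} [Fintype m] [DecidableEq m] [Ring R] {A : Matrix m m R}

/-- If `P` and `Q` are left quasi-inverses of `X` and `Y`, then `P`, `Q` combine to one of `X Y`. -/
theorem mul_aux {P Q X Y : Matrix m m R} (hX : P + X = P * A * X) (hY : Q + Y = Q * A * Y) :
    (P + Q - Q * A * P) + (X + Y - X * A * Y) =
      (P + Q - Q * A * P) * A * (X + Y - X * A * Y) := by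
  have h : (P + Q - Q * A * P) * A * (X + Y - X * A * Y) -
      ((P + Q - Q * A * P) + (X + Y - X * A * Y)) =
      (1 - Q * A) * (P * A * X - (P + X)) * (1 - A * Y) + (Q * A * Y - (Q + Y)) := by
    noncomm_ring
  rw [← hX, ← hY, sub_self, sub_self, mul_zero, zero_mul, add_zero] at h
  exact (sub_eq_zero.mp h).symm

/-- A left quasi-inverse is the inverse in `Gl_n(A; R)`. -/
theorem inv_aux {P : Matrix m m R} {X : Gl A} (hX : P + X.val = P * A * X.val) :
    (X⁻¹).val = P := by
  have h1 : (X⁻¹).val + X.val = (X⁻¹).val * A * X.val :=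
    sub_eq_zero.mp (congrArg Gl.val (inv_mul_cancel X))
  have h2 : (X⁻¹).val * (1 - A * X.val) = P * (1 - A * X.val) := by
    rw [mul_sub, mul_sub, ← mul_assoc, ← mul_assoc, ← h1, ← hX]
    noncomm_ring
  exact X.isUnit.mul_right_cancel h2

theorem sp_aux {m R : Type*} [Fintype m] [Ring R] {A P X : Matrix m m R} : P - X = P * A * X ↔ -P + X = -P * A * X := by
  rw [neg_mul, neg_mul, neg_add_eq_sub, ← neg_sub, neg_eq_iff_eq_neg]

theorem mul_inv_aux (X : Gl A) : X.val + (X⁻¹).val = X.val * A * (X⁻¹).val :=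
  sub_eq_zero.mp (congrArg Gl.val (mul_inv_cancel X))

end GroupsAux

section Groups

variable {m R : Type*} [Fintype m] [DecidableEq m] [Ring R] [Algebra ℝ R] (δ : RealInvolution R)
  {A : Matrix m m R}

/-- The unitary group `U_n(A; R, δ)` of a Hermitian matrix `A`: the subgroup of `Gl_n(A; R)` of all
`X` with `X* + X = X* A X`, where `X* = δ(X)ᵗ`. -/
def U (hA : A ∈ δ.Herm m) : Subgroup (Gl A) where
  carrier := {X | δ.adj X.val + X.val = δ.adj X.val * A * X.val}
  mul_mem' {X Y} hX hY := by
    change δ.adj (X * Y).val + (X * Y).val = δ.adj (X * Y).val * A * (X * Y).val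
    have h : δ.adj (X * Y).val = δ.adj X.val + δ.adj Y.val - δ.adj Y.val * A * δ.adj X.val := by
      rw [Gl.val_mul, adj_sub, adj_add, adj_mul, adj_mul, show δ.adj A = A from hA, mul_assoc]
    rw [h]
    exact mul_aux hX hY
  one_mem' := by
    change δ.adj (0 : Matrix m m R) + 0 = δ.adj (0 : Matrix m m R) * A * 0
    simp [adj_zero]
  inv_mem' {X} hX := by
    change δ.adj (X⁻¹).val + (X⁻¹).val = δ.adj (X⁻¹).val * A * (X⁻¹).val
    have h : δ.adj (X⁻¹).val = X.val := by rw [inv_aux hX, adj_adj]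
    rw [h]
    exact mul_inv_aux X

/-- The (half-)symplectic group `Sp_{n/2}(A; R, δ)` of a skew-Hermitian matrix `A`: the subgroup of
`Gl_n(A; R)` of all `X` with `X* - X = X* A X`, where `X* = δ(X)ᵗ`. -/
def Sp (hA : A ∈ δ.Aherm m) : Subgroup (Gl A) where
  carrier := {X | δ.adj X.val - X.val = δ.adj X.val * A * X.val}
  mul_mem' {X Y} hX hY := by
    change δ.adj (X * Y).val - (X * Y).val = δ.adj (X * Y).val * A * (X * Y).val
    have h : -δ.adj (X * Y).val =
        -δ.adj X.val + -δ.adj Y.val - -δ.adj Y.val * A * -δ.adj X.val := by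
      rw [Gl.val_mul, adj_sub, adj_add, adj_mul, adj_mul, show δ.adj A = -A from hA]
      noncomm_ring
    have h2 := mul_aux (sp_aux.mp hX) (sp_aux.mp hY)
    rw [← h] at h2
    exact sp_aux.mpr h2
  one_mem' := by
    change δ.adj (0 : Matrix m m R) - 0 = δ.adj (0 : Matrix m m R) * A * 0
    simp [adj_zero]
  inv_mem' {X} hX := by
    change δ.adj (X⁻¹).val - (X⁻¹).val = δ.adj (X⁻¹).val * A * (X⁻¹).val
    have h : -δ.adj (X⁻¹).val = X.val := by
      rw [inv_aux (sp_aux.mp hX), adj_neg, adj_adj, neg_neg]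
    rw [sp_aux, h]
    exact mul_inv_aux X

end Groups

end RealInvolution

/-! ### Coefficient algebras and their involutions -/

section Coefficients

/-- The trivial involution of a commutative algebra: `adj` is the transposition of matrices,
`Herm` and `Aherm` are the spaces of symmetric and of skew-symmetric matrices, and `U` and `Sp` are
the orthogonal and the (half-)symplectic groups. -/
def idInv (R : Type*) [CommRing R] [Algebra ℝ R] : RealInvolution R where
  toLinearMap := LinearMap.id
  map_mul' x y := mul_comm x y
  involutive' _ := rfl

/-- The conjugation of a star algebra, such as the usual conjugation of `ℂ` or of `ℍ`. -/
def starInv (R : Type*) [Ring R] [Algebra ℝ R] [StarRing R] [StarModule ℝ R] :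
    RealInvolution R where
  toFun := star
  map_add' := star_add
  map_smul' c x := by simp
  map_mul' := star_mul
  involutive' := star_star

/-- The quaternion `j`. -/
def qj : ℍ[ℝ] := ⟨0, 0, 1, 0⟩

/-- The automorphism `x ↦ j x j⁻¹` of `ℍ`. -/
def conjJ (x : ℍ[ℝ]) : ℍ[ℝ] := qj * x * qj⁻¹

instance : StarModule ℝ ℍ[ℝ] where
  star_smul c x := by ext <;> simp

theorem re_qj : qj.re = 0 := rfl
theorem imI_qj : qj.imI = 0 := rfl
theorem imJ_qj : qj.imJ = 1 := rfl
theorem imK_qj : qj.imK = 0 := rfl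

theorem qj_inv : qj⁻¹ = -qj := by
  refine inv_eq_of_mul_eq_one_right ?_
  ext <;> simp [re_qj, imI_qj, imJ_qj, imK_qj]

theorem re_conjJ (x : ℍ[ℝ]) : (conjJ x).re = x.re := by
  simp [conjJ, qj_inv, re_qj, imI_qj, imJ_qj, imK_qj]

theorem imI_conjJ (x : ℍ[ℝ]) : (conjJ x).imI = -x.imI := by
  simp [conjJ, qj_inv, re_qj, imI_qj, imJ_qj, imK_qj]

theorem imJ_conjJ (x : ℍ[ℝ]) : (conjJ x).imJ = x.imJ := by
  simp [conjJ, qj_inv, re_qj, imI_qj, imJ_qj, imK_qj]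

theorem imK_conjJ (x : ℍ[ℝ]) : (conjJ x).imK = -x.imK := by
  simp [conjJ, qj_inv, re_qj, imI_qj, imJ_qj, imK_qj]

/-- The split involution `x ↦ j x̄ j⁻¹` of `ℍ`. -/
def tildeInv : RealInvolution ℍ[ℝ] where
  toFun x := conjJ (star x)
  map_add' x y := by simp [conjJ, mul_add, add_mul]
  map_smul' c x := by simp [conjJ]
  map_mul' x y := by
    have h : qj ≠ 0 := fun h => by simpa [qj] using congrArg QuaternionAlgebra.imJ h
    simp only [conjJ, star_mul]
    rw [mul_assoc (qj * star y), ← mul_assoc qj⁻¹, ← mul_assoc qj⁻¹, inv_mul_cancel₀ h, one_mul]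
    simp only [mul_assoc]
  involutive' x := by
    ext <;> simp [re_conjJ, imI_conjJ, imJ_conjJ, imK_conjJ]

theorem tildeInv_apply (x : ℍ[ℝ]) :
    tildeInv.toLinearMap x = ⟨x.re, x.imI, -x.imJ, x.imK⟩ := by
  change conjJ (star x) = _
  ext
  · simpa using re_conjJ (star x)
  · simpa using imI_conjJ (star x)
  · simpa using imJ_conjJ (star x)
  · simpa using imK_conjJ (star x)

variable (𝕜 : Type*) [RCLike 𝕜]

/-- The algebra `𝕜[i] = 𝕜[X] / (X² + 1)`, with elements `a + b i`. -/
abbrev AdjI := QuadraticAlgebra 𝕜 (-1) 0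

namespace AdjI

/-- The embedding of `𝕜[i]` into the `2 × 2`-matrices, used to define a norm on `𝕜[i]`. -/
def toMatrix : AdjI 𝕜 →+* Matrix (Fin 2) (Fin 2) 𝕜 where
  toFun z := !![z.re, -z.im; z.im, z.re]
  map_one' := by
    ext i j
    fin_cases i <;> fin_cases j <;> simp [QuadraticAlgebra.re_one, QuadraticAlgebra.im_one]
  map_zero' := by ext i j; fin_cases i <;> fin_cases j <;> simp
  map_add' x y := by ext i j; fin_cases i <;> fin_cases j <;> simp [add_comm]
  map_mul' x y := by ext i j; fin_cases i <;> fin_cases j <;> simp [Matrix.mul_apply] <;> ring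

theorem toMatrix_injective : Function.Injective (toMatrix 𝕜) := fun x y h => by
  ext
  · simpa [toMatrix] using congrFun (congrFun h 0) 0
  · simpa [toMatrix] using congrFun (congrFun h 1) 0

instance : NormedRing (AdjI 𝕜) := NormedRing.induced _ _ (toMatrix 𝕜) (toMatrix_injective 𝕜)

instance : NormedAlgebra ℝ (AdjI 𝕜) where
  norm_smul_le c x := by
    have h : toMatrix 𝕜 (c • x) = c • toMatrix 𝕜 x := by
      ext i j; fin_cases i <;> fin_cases j <;> simp [toMatrix]
    change ‖toMatrix 𝕜 (c • x)‖ ≤ ‖c‖ * ‖toMatrix 𝕜 x‖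
    rw [h]
    exact norm_smul_le c _

instance : FiniteDimensional ℝ (AdjI 𝕜) :=
  FiniteDimensional.of_injective
    ({ toFun := fun z => (z.re, z.im)
       map_add' := fun _ _ => rfl
       map_smul' := fun _ _ => rfl } : AdjI 𝕜 →ₗ[ℝ] 𝕜 × 𝕜)
    fun _ _ h => QuadraticAlgebra.ext (congrArg Prod.fst h) (congrArg Prod.snd h)

instance : StarModule ℝ (AdjI 𝕜) where
  star_smul c x := by ext <;> simp

end AdjI

/-- The embedding of `ℂ = ℝ[j]` into `ℍ`. -/
def complexJ (z : ℂ) : ℍ[ℝ] := ⟨z.re, 0, z.im, 0⟩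

/-- The embedding of `ℂ` into the algebra `M(2, 2; ℝ)`. -/
def complexToMatrix (z : ℂ) : Matrix (Fin 2) (Fin 2) ℝ := !![z.re, z.im; -z.im, z.re]

/-- The embedding `a + b j ↦ (a, b; -b̄, ā)` of `ℍ` into the algebra `M(2, 2; ℂ)`. -/
def quaternionToMatrix (x : ℍ[ℝ]) : Matrix (Fin 2) (Fin 2) ℂ :=
  !![⟨x.re, x.imI⟩, ⟨x.imJ, x.imK⟩; -star ⟨x.imJ, x.imK⟩, star ⟨x.re, x.imI⟩]

end Coefficients

/-! ### Realizations by larger matrices -/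

section Realization

variable {m n : Type*}

/-- The real matrix `(a, b; -b, a)` of the complex matrix `a + i b`. -/
def realMat (X : Matrix m n ℂ) : Matrix (m ⊕ m) (n ⊕ n) ℝ :=
  Matrix.fromBlocks (X.map Complex.re) (X.map Complex.im) (-X.map Complex.im) (X.map Complex.re)

/-- The real matrix `(a, b; b, -a)` attached to the complex matrix `a + i b`. -/
def realMat' (X : Matrix m n ℂ) : Matrix (m ⊕ m) (n ⊕ n) ℝ :=
  Matrix.fromBlocks (X.map Complex.re) (X.map Complex.im) (X.map Complex.im) (-X.map Complex.re)

/-- The complex matrix `(a, b; -b̄, ā)` of the quaternionic matrix `a + b j`. -/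
def complexMat (X : Matrix m n ℍ[ℝ]) : Matrix (m ⊕ m) (n ⊕ n) ℂ :=
  Matrix.fromBlocks (X.map fun x => ⟨x.re, x.imI⟩) (X.map fun x => ⟨x.imJ, x.imK⟩)
    (-X.map fun x => star ⟨x.imJ, x.imK⟩) (X.map fun x => star ⟨x.re, x.imI⟩)

/-- The matrix `J = (0, 1; -1, 0)`. -/
def matJ (m : Type*) [DecidableEq m] : Matrix (m ⊕ m) (m ⊕ m) ℂ :=
  Matrix.fromBlocks 0 1 (-1) 0

end Realization

/-! ### The parameters of the unitary and symplectic groups are Hermitian or skew-Hermitian -/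

section Parameters

open RealInvolution

variable {m n R S : Type*} [Ring R] [Algebra ℝ R] [Ring S] [Algebra ℝ S]
  {δ : RealInvolution R} {ε : RealInvolution S}

theorem fromBlocks_mem_Herm {A : Matrix m m R} {B : Matrix n n R} (hA : A ∈ δ.Herm m)
    (hB : B ∈ δ.Herm n) : Matrix.fromBlocks A 0 0 B ∈ δ.Herm (m ⊕ n) := by
  change δ.adj _ = _
  rw [adj, Matrix.fromBlocks_map, Matrix.fromBlocks_transpose]
  exact congrArg₂ (fun a b => Matrix.fromBlocks a _ _ b) hA hB |>.trans (by simp)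

theorem fromBlocks_mem_Aherm {A : Matrix m m R} {B : Matrix n n R} (hA : A ∈ δ.Aherm m)
    (hB : B ∈ δ.Aherm n) : Matrix.fromBlocks A 0 0 B ∈ δ.Aherm (m ⊕ n) := by
  change δ.adj _ = _
  rw [adj, Matrix.fromBlocks_map, Matrix.fromBlocks_transpose]
  exact congrArg₂ (fun a b => Matrix.fromBlocks a _ _ b) hA hB |>.trans (by
    simp [Matrix.fromBlocks_neg])

theorem map_mem_Herm {f : S → R} (hf : ∀ x, δ.toLinearMap (f x) = f (ε.toLinearMap x))
    {A : Matrix m m S} (hA : A ∈ ε.Herm m) : A.map f ∈ δ.Herm m := by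
  ext i j
  exact (hf _).trans (congrArg f (congrFun (congrFun hA i) j))

theorem map_mem_Aherm {f : S → R} (hf : ∀ x, δ.toLinearMap (f x) = f (ε.toLinearMap x))
    (hf' : ∀ x, f (-x) = -f x) {A : Matrix m m S} (hA : A ∈ ε.Aherm m) : A.map f ∈ δ.Aherm m := by
  ext i j
  exact ((hf _).trans (congrArg f (congrFun (congrFun hA i) j))).trans (hf' _)

section Coefficients

variable {𝕜 : Type*} [RCLike 𝕜]

theorem idInv_algebraMap (x : 𝕜) : (idInv (AdjI 𝕜)).toLinearMap (algebraMap 𝕜 (AdjI 𝕜) x) =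
    algebraMap 𝕜 (AdjI 𝕜) ((idInv 𝕜).toLinearMap x) := rfl

theorem starInv_algebraMap (x : 𝕜) : (starInv (AdjI 𝕜)).toLinearMap (algebraMap 𝕜 (AdjI 𝕜) x) =
    algebraMap 𝕜 (AdjI 𝕜) ((idInv 𝕜).toLinearMap x) := by
  change star (algebraMap 𝕜 (AdjI 𝕜) x) = algebraMap 𝕜 (AdjI 𝕜) x
  ext <;> simp

theorem starInv_coeComplex (x : ℂ) : (starInv ℍ[ℝ]).toLinearMap (x : ℍ[ℝ]) =
    (((starInv ℂ).toLinearMap x : ℂ) : ℍ[ℝ]) := by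
  change star (x : ℍ[ℝ]) = ((star x : ℂ) : ℍ[ℝ])
  ext <;> simp

theorem tildeInv_coeComplex (x : ℂ) : tildeInv.toLinearMap (x : ℍ[ℝ]) =
    (((idInv ℂ).toLinearMap x : ℂ) : ℍ[ℝ]) := by
  rw [tildeInv_apply]
  change _ = (x : ℍ[ℝ])
  ext <;> simp

theorem tildeInv_complexJ (x : ℂ) : tildeInv.toLinearMap (complexJ x) =
    complexJ ((starInv ℂ).toLinearMap x) := by
  rw [tildeInv_apply]
  change _ = complexJ (star x)
  simp only [complexJ]
  ext <;> simp

end Coefficients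

section Realization

variable {m : Type*}

theorem I_smul_conj_mem_Aherm {A : Matrix m m ℂ} (hA : A ∈ (starInv ℂ).Herm m) :
    Complex.I • A.map star ∈ (starInv ℂ).Aherm m := by
  ext i j
  have h : star (A j i) = A i j := congrFun (congrFun hA i) j
  change star (Complex.I * star (A j i)) = -(Complex.I * star (A i j))
  rw [h, ← h]
  simp [mul_comm]

theorem realMat_mem_Herm {A : Matrix m m ℂ} (hA : A ∈ (starInv ℂ).Herm m) :
    realMat A ∈ (idInv ℝ).Herm (m ⊕ m) := by
  have h : ∀ i j, star (A j i) = A i j := fun i j => congrFun (congrFun hA i) j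
  ext i j
  change realMat A j i = realMat A i j
  rcases i with i | i <;> rcases j with j | j <;> simp [realMat, ← h i j]

theorem realMat_mem_Aherm {A : Matrix m m ℂ} (hA : A ∈ (starInv ℂ).Aherm m) :
    realMat A ∈ (idInv ℝ).Aherm (m ⊕ m) := by
  have h : ∀ i j, star (A j i) = -A i j := fun i j => congrFun (congrFun hA i) j
  ext i j
  change realMat A j i = -realMat A i j
  have h' : ∀ i j, A i j = -star (A j i) := fun i j => by rw [h, neg_neg]
  rcases i with i | i <;> rcases j with j | j <;> simp [realMat, h' i j]

theorem realMat'_mem_Herm {A : Matrix m m ℂ} (hA : A ∈ (idInv ℂ).Herm m) :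
    realMat' A ∈ (idInv ℝ).Herm (m ⊕ m) := by
  have h : ∀ i j, A j i = A i j := fun i j => congrFun (congrFun hA i) j
  ext i j
  change realMat' A j i = realMat' A i j
  rcases i with i | i <;> rcases j with j | j <;> simp [realMat', ← h i j]

theorem realMat'_mem_Aherm {A : Matrix m m ℂ} (hA : A ∈ (idInv ℂ).Aherm m) :
    realMat' A ∈ (idInv ℝ).Aherm (m ⊕ m) := by
  have h : ∀ i j, A j i = -A i j := fun i j => congrFun (congrFun hA i) j
  ext i j
  change realMat' A j i = -realMat' A i j
  rcases i with i | i <;> rcases j with j | j <;> simp [realMat', h i j]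

theorem qj_smul_mem_Herm {A : Matrix m m ℂ} (hA : A ∈ (idInv ℂ).Aherm m) :
    A.map (fun z => qj * (z : ℍ[ℝ])) ∈ (starInv ℍ[ℝ]).Herm m := by
  ext1 i j
  have h : A j i = -A i j := congrFun (congrFun hA i) j
  change star (qj * (A j i : ℍ[ℝ])) = qj * (A i j : ℍ[ℝ])
  rw [h]
  ext <;> simp only [Quaternion.re_star, Quaternion.imI_star, Quaternion.imJ_star,
      Quaternion.imK_star, Quaternion.re_mul, Quaternion.imI_mul, Quaternion.imJ_mul,
      Quaternion.imK_mul, Quaternion.re_coeComplex, Quaternion.imI_coeComplex,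
      Quaternion.imJ_coeComplex, Quaternion.imK_coeComplex, re_qj, imI_qj, imJ_qj, imK_qj,
      Complex.neg_re, Complex.neg_im] <;>
    ring

section Quaternionic

variable {A : Matrix m m ℍ[ℝ]}

theorem complexMat_mem_Herm_star (hA : A ∈ (starInv ℍ[ℝ]).Herm m) :
    complexMat A ∈ (starInv ℂ).Herm (m ⊕ m) := by
  have h : ∀ i j, star (A j i) = A i j := fun i j => congrFun (congrFun hA i) j
  ext1 i j
  change star (complexMat A j i) = complexMat A i j
  rcases i with i | i <;> rcases j with j | j <;> simp [complexMat, ← h i j, Complex.ext_iff]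

theorem complexMat_mem_Herm_id (hA : A ∈ tildeInv.Herm m) :
    complexMat A ∈ (idInv ℂ).Herm (m ⊕ m) := by
  have h : ∀ i j, A i j = ⟨(A j i).re, (A j i).imI, -(A j i).imJ, (A j i).imK⟩ := fun i j => by
    rw [← tildeInv_apply]
    exact (congrFun (congrFun hA i) j).symm
  ext1 i j
  change complexMat A j i = complexMat A i j
  rcases i with i | i <;> rcases j with j | j <;> simp [complexMat, h i j, Complex.ext_iff]

variable [Fintype m] [DecidableEq m]

theorem I_smul_J_mul_mem_Herm (hA : A ∈ tildeInv.Herm m) :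
    Complex.I • (matJ m * complexMat A) ∈ (starInv ℂ).Herm (m ⊕ m) := by
  have h : ∀ i j, A i j = ⟨(A j i).re, (A j i).imI, -(A j i).imJ, (A j i).imK⟩ := fun i j => by
    rw [← tildeInv_apply]
    exact (congrFun (congrFun hA i) j).symm
  ext1 i j
  change star (Complex.I * (matJ m * complexMat A) j i) = Complex.I * (matJ m * complexMat A) i j
  rw [matJ, complexMat, Matrix.fromBlocks_multiply]
  rcases i with i | i <;> rcases j with j | j <;> simp [h i j, Complex.ext_iff]

theorem J_mul_mem_Aherm (hA : A ∈ (starInv ℍ[ℝ]).Herm m) :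
    matJ m * complexMat A ∈ (idInv ℂ).Aherm (m ⊕ m) := by
  have h : ∀ i j, star (A j i) = A i j := fun i j => congrFun (congrFun hA i) j
  ext1 i j
  change (matJ m * complexMat A) j i = -(matJ m * complexMat A) i j
  rw [matJ, complexMat, Matrix.fromBlocks_multiply]
  rcases i with i | i <;> rcases j with j | j <;> simp [← h i j, Complex.ext_iff]

end Quaternionic

end Realization

end Parameters

end Homotope
end

open Homotope

noncomputable section

namespace Homotope

set_option linter.unusedSectionVars false

/-! ### The Lie algebra and the one-parameter subgroups of `Gl A`. -/

section LieAlgebra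

variable {m n R : Type*} [Fintype m] [Fintype n] [DecidableEq n] [NormedRing R]
  [NormedAlgebra ℝ R] [FiniteDimensional ℝ R] {A : Matrix n m R}

namespace Gl

/-! For the product `X + Y - X A Y` the left-invariant vector fields are the affine fields `x ↦ V -
x A V`. So the Lie algebra of `Gl A` is the space of all matrices with `[V, W] = W A V - V A W`, and
`[[V, W], Z] = T(V, A W A, Z) - T(W, A V A, Z)`: for the full group, the Lie triple product already
is the bracket defined by `α(X) = A X A` (`Gl.lie_toLie`, `lie_lie_toLie`).

Every other group `G` is the fixed group, inside some `Gl D`, of a map `X ↦ t(X⁻¹)`, where the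
linear involution `t` reverses the products `X D Y`: `t(X) = X*` for unitary groups and `t(X) = -X*`
for symplectic ones. The involution `σ` of the symmetric space is either of this kind or a linear
involution `s` that preserves the products `X D Y`. The differentials at `0` are `-t` and `s`. A
one-parameter subgroup exists for every velocity and is determined by it, so the condition that it
be fixed, or inverted, is a linear condition on the velocity (`Gl.lieAlgebraOf_eq`,
`Gl.antiFixed_eq`). For unitary `G` and linear `s` the Lie triple system is `Q = {V | t V = -V, s V
= -V}`; the other types are similar.

It remains to give an injective linear map `Φ` that identifies `V⁺` with `Q` and carries `T(X, α Y,
Z)` to `Φ X D Φ Y D Φ Z + Φ Z D Φ Y D Φ X` (`IsRealization`). The axioms of a Lie triple system then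
come from the Jacobi identity, and stability of `V⁺` under the bracket comes from that of `Q`.

For Grassmannians, `Φ X = (0, X; -t(X), 0)` (`symmetricCase_grassmannian`). In all other cases `Φ`
acts entry by entry, through a linear map `f` with values in a larger algebra, possibly realized by
blocks. If this algebra is the sum of the eigenspaces `e(S)` and `f(S)` of `s`, and `α(X) = A c(X
A)`, then everything reduces to identities between scalars, the main one being `f(x a c(y b) z) =
f(x) d(a) f(y) d(b) f(z)` (`symmetricCase_unitary_entrywise`). Typically `f` is multiplication by an
element `u` with `u² = ±1`: the sign of `u²` gives the sign of `α`, and conjugation by `u` gives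
`c`. The central `i` yields `-A X A`; the element `j` of `ℍ`, which conjugates `ℂ`, yields the
negative antilinear `α`; the reflection `diag(1, -1)` yields the positive one. The sign or
conjugation that `t` induces on `f(S)` decides which of the spaces of symmetric, skew or Hermitian
matrices is `V⁺`. -/

/-- The Lie algebra of `Gl_{p,q}(A; R)` is the space of matrices. -/
def toLie (A : Matrix n m R) :
    Matrix m n R ≃ₗ[ℝ] GroupLieAlgebra 𝓘(ℝ, m → n → R) (Gl A) where
  toFun X := (Matrix.of.symm X : m → n → R)
  map_add' _ _ := rfl
  map_smul' _ _ := rfl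
  invFun v := Matrix.of (show m → n → R from v)
  left_inv _ := rfl
  right_inv _ := rfl

theorem coord_injective : Function.Injective (coord : Gl A → m → n → R) :=
  isOpenEmbedding_coord.injective

theorem hasMFDerivAt_coord (X : Gl A) :
    HasMFDerivAt 𝓘(ℝ, m → n → R) 𝓘(ℝ, m → n → R) (coord : Gl A → m → n → R) X
      (ContinuousLinearMap.id ℝ (m → n → R)) := by
  refine ⟨isOpenEmbedding_coord.continuous.continuousAt, ?_⟩
  have h : ∀ᶠ y in nhds X.coord,
      (coord ∘ ((isOpenEmbedding_coord (A := A)).toOpenPartialHomeomorph coord).symm) y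
      = (y : m → n → R) := by
    have h1 : Set.range (coord : Gl A → m → n → R) ∈ nhds X.coord :=
      isOpenEmbedding_coord.isOpen_range.mem_nhds ⟨X, rfl⟩
    filter_upwards [h1] with y hy
    exact ((isOpenEmbedding_coord (A := A)).toOpenPartialHomeomorph coord).right_inv
      (by simpa using hy)
  exact ((hasFDerivAt_id X.coord).congr_of_eventuallyEq h).hasFDerivWithinAt

theorem mfderiv_coord (X : Gl A) :
    mfderiv 𝓘(ℝ, m → n → R) 𝓘(ℝ, m → n → R) (coord : Gl A → m → n → R) X =
      ContinuousLinearMap.id ℝ (m → n → R) :=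
  (hasMFDerivAt_coord X).mfderiv

variable (A) in
/-- The map `x ↦ x A v`, as a continuous linear map. -/
def rightTranslation (v : Matrix m n R) : (m → n → R) →L[ℝ] (m → n → R) :=
  LinearMap.toContinuousLinearMap
    { toFun := fun x => Matrix.of.symm (Matrix.of x * A * v)
      map_add' := fun x y => by
        change Matrix.of.symm ((Matrix.of x + Matrix.of y) * A * v) = _
        rw [Matrix.add_mul, Matrix.add_mul]; rfl
      map_smul' := fun c x => by
        change Matrix.of.symm ((c • Matrix.of x) * A * v) = _
        rw [Matrix.smul_mul, Matrix.smul_mul]; rfl }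

variable (A) in
/-- The map `v ↦ x A v`, as a continuous linear map. -/
def leftTranslation (x : Matrix m n R) : (m → n → R) →L[ℝ] (m → n → R) :=
  LinearMap.toContinuousLinearMap
    { toFun := fun v => Matrix.of.symm (x * A * Matrix.of v)
      map_add' := fun v w => by
        change Matrix.of.symm (x * A * (Matrix.of v + Matrix.of w)) = _
        rw [Matrix.mul_add]; rfl
      map_smul' := fun c w => by
        change Matrix.of.symm (x * A * (c • Matrix.of w)) = _
        rw [Matrix.mul_smul]; rfl }

/-- In coordinates, left translation is the affine map `Y ↦ X + Y - X A Y`, with linear part `V ↦ V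
- X A V`. -/
theorem mulInvariantVectorField_toLie (V : Matrix m n R) (X : Gl A) :
    mulInvariantVectorField (toLie A V) X =
      (Matrix.of.symm (V - X.val * A * V) : m → n → R) := by
  have h1 : (coord : Gl A → m → n → R) ∘ (X * ·) =
      (fun y => X.coord + y - leftTranslation A X.val y) ∘ coord := by
    ext Y i j; rfl
  have h2 : MDifferentiableAt 𝓘(ℝ, m → n → R) 𝓘(ℝ, m → n → R) (X * · : Gl A → Gl A) 1 :=
    (contMDiff_mul_left (n := ∞)).contMDiffAt.mdifferentiableAt (by simp)
  have h3 := (hasMFDerivAt_coord (X * 1)).comp (1 : Gl A) h2.hasMFDerivAt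
  have h4 : HasFDerivAt (fun y : m → n → R => X.coord + y - leftTranslation A X.val y)
      (ContinuousLinearMap.id ℝ (m → n → R) - leftTranslation A X.val) (coord (1 : Gl A)) :=
    ((hasFDerivAt_id _).const_add _).sub (leftTranslation A X.val).hasFDerivAt
  have h5 := h4.hasMFDerivAt.comp (1 : Gl A) (hasMFDerivAt_coord (1 : Gl A))
  rw [h1] at h3
  -- Two computations of the derivative at `1` of the same map: through the group multiplication,
  -- and through its affine expression in coordinates.
  have h6 := hasMFDerivAt_unique h3 h5
  exact congrArg (fun f : (m → n → R) →L[ℝ] (m → n → R) => f (Matrix.of.symm V)) h6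

theorem inverse_mfderiv_coord_apply (X : Gl A) (w : m → n → R) :
    (mfderiv 𝓘(ℝ, m → n → R) 𝓘(ℝ, m → n → R) (coord : Gl A → m → n → R) X).inverse w = w := by
  -- Generalizing over `L` removes the tangent space types, so that the value of `mfderiv` can be
  -- substituted.
  have h : ∀ L : (m → n → R) →L[ℝ] (m → n → R), L = ContinuousLinearMap.id ℝ _ →
      L.inverse w = w := by
    rintro L rfl
    rw [ContinuousLinearMap.inverse_id]
    rfl
  exact h _ (mfderiv_coord X)

/-- The left-invariant fields are the pullbacks along `coord` of the affine fields `F V : x ↦ V - x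
A V`. Pullback commutes with Lie brackets, so the bracket can be computed in the vector space of
matrices. -/
theorem lie_toLie (V W : Matrix m n R) :
    ⁅toLie A V, toLie A W⁆ = toLie A (W * A * V - V * A * W) := by
  let F : Matrix m n R → (x : m → n → R) → TangentSpace 𝓘(ℝ, m → n → R) x :=
    fun V x => (Matrix.of.symm V - rightTranslation A V x : m → n → R)
  have hF : ∀ (V : Matrix m n R) (x : m → n → R),
      HasFDerivAt (F V : (m → n → R) → (m → n → R)) (-rightTranslation A V) x := fun V x =>
    (rightTranslation A V).hasFDerivAt.const_sub _
  have hpull : ∀ V : Matrix m n R, VectorField.mpullback 𝓘(ℝ, m → n → R) 𝓘(ℝ, m → n → R)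
      (coord : Gl A → m → n → R) (F V) = mulInvariantVectorField (toLie A V) := by
    intro V
    ext1 X
    exact (inverse_mfderiv_coord_apply X _).trans (mulInvariantVectorField_toLie V X).symm
  have hdiff : ∀ V : Matrix m n R, MDifferentiableAt 𝓘(ℝ, m → n → R)
      (𝓘(ℝ, m → n → R).prod 𝓘(ℝ, m → n → R))
      (fun x => (⟨x, F V x⟩ : TangentBundle 𝓘(ℝ, m → n → R) (m → n → R)))
      (coord (1 : Gl A)) := by
    intro V
    have h : ContDiff ℝ 1 (F V : (m → n → R) → (m → n → R)) :=
      contDiff_const.sub (rightTranslation A V).contDiff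
    exact (contMDiff_vectorSpace_iff_contDiff.2 h).contMDiffAt.mdifferentiableAt one_ne_zero
  have h1 := VectorField.mpullback_mlieBracket (n := 2) (hdiff V) (hdiff W)
    contMDiff_coord.contMDiffAt (by simp [minSmoothness_of_isRCLikeNormedField])
  rw [hpull, hpull] at h1
  refine h1.symm.trans ((inverse_mfderiv_coord_apply _ _).trans ?_)
  rw [← VectorField.mlieBracketWithin_univ,
    VectorField.mlieBracketWithin_eq_lieBracketWithin]
  -- The neutral element has coordinates `0`, where `F V` takes the value `V` and has derivative `x
  -- ↦ -x A V`.
  have h2 : VectorField.lieBracketWithin ℝ (F V : (m → n → R) → (m → n → R)) (F W) Set.univ 0 =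
      (Matrix.of.symm (W * A * V - V * A * W) : m → n → R) := by
    have h3 : ∀ V W : Matrix m n R, rightTranslation A W (F V 0) =
        (Matrix.of.symm (V * A * W) : m → n → R) := by
      intro V W
      change rightTranslation A W (Matrix.of.symm V - rightTranslation A V 0) = _
      rw [map_zero, sub_zero]
      rfl
    rw [VectorField.lieBracketWithin_univ]
    change fderiv ℝ (F W : (m → n → R) → (m → n → R)) 0 (F V 0) -
      fderiv ℝ (F V : (m → n → R) → (m → n → R)) 0 (F W 0) = _
    rw [(hF V _).fderiv, (hF W _).fderiv]
    change -(rightTranslation A W (F V 0)) - -(rightTranslation A V (F W 0)) = _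
    rw [h3, h3, neg_sub_neg]
    rfl
  exact h2

/-! ### One-parameter subgroups -/

theorem isOneParameterSubgroup_iff {γ : ℝ → Gl A} {V : Matrix m n R} :
    IsOneParameterSubgroup 𝓘(ℝ, m → n → R) γ (toLie A V) ↔
      (∀ s t, γ (s + t) = γ s * γ t) ∧
        HasDerivAt (fun t => (γ t).coord) (Matrix.of.symm V) 0 := by
  refine and_congr_right fun hγ => ⟨fun h => ?_, fun h => ?_⟩
  · have h1 : HasMFDerivAt 𝓘(ℝ, ℝ) 𝓘(ℝ, m → n → R) (fun t => (γ t).coord) 0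
        (ContinuousLinearMap.toSpanSingleton ℝ (Matrix.of.symm V : m → n → R)) :=
      (hasMFDerivAt_coord (γ 0)).comp (0 : ℝ) h
    have h2 : HasFDerivAt (fun t => (γ t).coord)
        (ContinuousLinearMap.toSpanSingleton ℝ (Matrix.of.symm V : m → n → R)) 0 :=
      h1.hasFDerivAt
    exact h2.hasDerivAt.congr_deriv (one_smul ℝ (Matrix.of.symm V : m → n → R))
  · refine ⟨?_, h.hasFDerivAt.hasFDerivWithinAt⟩
    exact isOpenEmbedding_coord.isInducing.continuousAt_iff.2 h.continuousAt

theorem hasDerivAt_unique_velocity {γ : ℝ → Gl A} {V W : Matrix m n R}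
    (hV : HasDerivAt (fun t => (γ t).coord) (Matrix.of.symm V) 0)
    (hW : HasDerivAt (fun t => (γ t).coord) (Matrix.of.symm W) 0) : V = W :=
  Matrix.of.symm.injective (hV.unique hW)

/-- The block matrix whose exponential contains the one-parameter subgroup with velocity `V`. -/
def expGenerator (A : Matrix n m R) (V : Matrix m n R) : Matrix (m ⊕ n) (m ⊕ n) R :=
  Matrix.fromBlocks 0 V 0 (-(A * V))

/-- The hypotheses say that `E` fixes the first block column of the identity and the block row `(A,
1)`. The matrices `(1, X; 0, 1 - A X)` are the only ones that do so. -/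
theorem fromBlocks_eq_of_stable [DecidableEq m] (E : Matrix (m ⊕ n) (m ⊕ n) R)
    (h1 : E * Matrix.fromBlocks 1 0 0 0 = Matrix.fromBlocks 1 0 0 0)
    (h2 : Matrix.fromBlocks 0 0 A 1 * E = Matrix.fromBlocks 0 0 A 1) :
    E = Matrix.fromBlocks 1 E.toBlocks₁₂ 0 (1 - A * E.toBlocks₁₂) := by
  rw [← Matrix.fromBlocks_toBlocks E, Matrix.fromBlocks_multiply, Matrix.fromBlocks_inj] at h1 h2
  obtain ⟨a, -, b, -⟩ := h1
  obtain ⟨-, -, -, d⟩ := h2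
  rw [← Matrix.fromBlocks_toBlocks E]
  simp only [Matrix.mul_one, Matrix.mul_zero, add_zero, Matrix.one_mul] at a b d
  rw [a, b, Matrix.toBlocks_fromBlocks₁₂, ← d, add_sub_cancel_left]

-- The map `X ↦ (1, X; 0, 1 - A X)` turns the product `X + Y - X A Y` into the product of block
-- matrices, and its derivative at `0` sends `V` to `expGenerator A V`. The one-parameter subgroup
-- is therefore the upper right block of the exponential.
open NormedSpace in
theorem exists_isOneParameterSubgroup (A : Matrix n m R) (V : Matrix m n R) :
    ∃ γ : ℝ → Gl A, IsOneParameterSubgroup 𝓘(ℝ, m → n → R) γ (toLie A V) := by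
  classical
  have : CompleteSpace (Matrix (m ⊕ n) (m ⊕ n) R) := FiniteDimensional.complete ℝ _
  let Q := expGenerator A V
  let E : ℝ → Matrix (m ⊕ n) (m ⊕ n) R := fun t => exp (t • Q)
  let : NormedAlgebra ℚ (Matrix (m ⊕ n) (m ⊕ n) R) := NormedAlgebra.restrictScalars ℚ ℝ _
  have hadd : ∀ s t, E (s + t) = E s * E t := fun s t => by
    simp only [E, add_smul]
    exact exp_add_of_commute ((Commute.refl Q).smul_left s |>.smul_right t)
  have hderiv : ∀ t, HasDerivAt E (E t * Q) t := fun t => hasDerivAt_exp_smul_const Q t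
  have hderiv' : ∀ t, HasDerivAt E (Q * E t) t := fun t => hasDerivAt_exp_smul_const' Q t
  have hzero : E 0 = 1 := by simp [E]
  have hconst : ∀ F : ℝ → Matrix (m ⊕ n) (m ⊕ n) R, (∀ t, HasDerivAt F 0 t) → ∀ t, F t = F 0 :=
    fun F hF t => is_const_of_deriv_eq_zero (fun t => (hF t).differentiableAt)
      (fun t => (hF t).deriv) t 0
  -- Both stability conditions hold at `t = 0` and propagate: the generator `Q` is annihilated from
  -- the right by the first fixed matrix and from the left by the second, so the products have
  -- derivative `0`.
  have h1 : ∀ t, E t * Matrix.fromBlocks 1 0 0 0 = Matrix.fromBlocks 1 0 0 0 := fun t => by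
    have h := hconst (fun t => E t * Matrix.fromBlocks 1 0 0 0) (fun t => by
      have h := (hderiv t).mul_const (Matrix.fromBlocks 1 0 0 0 : Matrix (m ⊕ n) (m ⊕ n) R)
      rwa [mul_assoc, show Q * Matrix.fromBlocks 1 0 0 0 = 0 by
        simp [Q, expGenerator, Matrix.fromBlocks_multiply], mul_zero] at h) t
    simpa [hzero] using h
  have h2 : ∀ t, Matrix.fromBlocks 0 0 A 1 * E t = Matrix.fromBlocks 0 0 A 1 := fun t => by
    have h := hconst (fun t => Matrix.fromBlocks 0 0 A 1 * E t) (fun t => by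
      have h := (hderiv' t).const_mul (Matrix.fromBlocks 0 0 A 1 : Matrix (m ⊕ n) (m ⊕ n) R)
      rwa [← mul_assoc, show Matrix.fromBlocks 0 0 A 1 * Q = 0 by
        simp [Q, expGenerator, Matrix.fromBlocks_multiply], zero_mul] at h) t
    simpa [hzero] using h
  have h3 := fun t => fromBlocks_eq_of_stable (E t) (h1 t) (h2 t)
  have h4 : ∀ s t, (E (s + t)).toBlocks₁₂ = (E s).toBlocks₁₂ + (E t).toBlocks₁₂ -
      (E s).toBlocks₁₂ * A * (E t).toBlocks₁₂ ∧ 1 - A * (E (s + t)).toBlocks₁₂ =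
      (1 - A * (E s).toBlocks₁₂) * (1 - A * (E t).toBlocks₁₂) := fun s t => by
    have h := hadd s t
    rw [h3 (s + t), h3 s, h3 t, Matrix.fromBlocks_multiply, Matrix.fromBlocks_inj] at h
    obtain ⟨-, h5, -, h6⟩ := h
    simp only [Matrix.zero_mul, zero_add, Matrix.one_mul] at h5 h6
    refine ⟨h5.trans ?_, h6⟩
    rw [Matrix.mul_sub, Matrix.mul_one, Matrix.mul_assoc]
    abel
  have h5 : (E 0).toBlocks₁₂ = 0 := by rw [hzero, ← Matrix.fromBlocks_one,
      Matrix.toBlocks_fromBlocks₁₂]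
  -- The lower right blocks multiply like the exponentials, so the block at `-t` is the inverse of
  -- the block at `t`.
  have h6 : ∀ t, IsUnit (1 - A * (E t).toBlocks₁₂) := fun t => by
    refine ⟨⟨_, 1 - A * (E (-t)).toBlocks₁₂, ?_, ?_⟩, rfl⟩
    · rw [← (h4 _ _).2, add_neg_cancel, h5]; simp
    · rw [← (h4 _ _).2, neg_add_cancel, h5]; simp
  refine ⟨fun t => ⟨(E t).toBlocks₁₂, h6 t⟩, isOneParameterSubgroup_iff.2
    ⟨fun s t => Gl.ext (h4 s t).1, ?_⟩⟩
  let L : Matrix (m ⊕ n) (m ⊕ n) R →L[ℝ] (m → n → R) := LinearMap.toContinuousLinearMap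
    { toFun := fun X => Matrix.of.symm X.toBlocks₁₂
      map_add' := fun X Y => rfl
      map_smul' := fun c X => rfl }
  have h7 := L.hasFDerivAt.comp_hasDerivAt 0 (hderiv 0)
  rw [hzero, one_mul] at h7
  exact h7

theorem map_zero_of_map_add {γ : ℝ → Gl A} (hγ : ∀ s t, γ (s + t) = γ s * γ t) : γ 0 = 1 := by
  have h := hγ 0 0
  rw [add_zero] at h
  exact left_eq_mul.1 h

theorem map_neg_of_map_add {γ : ℝ → Gl A} (hγ : ∀ s t, γ (s + t) = γ s * γ t) (t : ℝ) :
    γ (-t) = (γ t)⁻¹ := by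
  rw [eq_inv_iff_mul_eq_one, ← hγ, neg_add_cancel, map_zero_of_map_add hγ]

/-- Since `γ s = γ t * γ (s - t)`, differentiability at `0` spreads to every `t` by left
translation. -/
theorem hasDerivAt_left {γ : ℝ → Gl A} {V : Matrix m n R} (hγ : ∀ s t, γ (s + t) = γ s * γ t)
    (h : HasDerivAt (fun t => (γ t).coord) (Matrix.of.symm V) 0) (t : ℝ) :
    HasDerivAt (fun t => (γ t).coord) (Matrix.of.symm (V - (γ t).val * A * V)) t := by
  have h1 : (fun s => (γ s).coord) =
      fun s => (γ t).coord + (γ (s - t)).coord - leftTranslation A (γ t).val (γ (s - t)).coord := by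
    ext1 s
    conv_lhs => rw [← add_sub_cancel t s, hγ]
    rfl
  rw [h1]
  have h2 : HasDerivAt (fun s => (γ (s - t)).coord) (Matrix.of.symm V) t := by
    rw [← sub_self t] at h
    exact h.comp_sub_const t t
  exact (h2.const_add _).sub ((leftTranslation A (γ t).val).hasFDerivAt.comp_hasDerivAt t h2)

/-- Both curves solve the affine equation `x' = V - x A V`, whose right-hand side is Lipschitz, and
both start at `0`. -/
theorem isOneParameterSubgroup_unique {γ γ' : ℝ → Gl A} {V : Matrix m n R}
    (h : IsOneParameterSubgroup 𝓘(ℝ, m → n → R) γ (toLie A V))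
    (h' : IsOneParameterSubgroup 𝓘(ℝ, m → n → R) γ' (toLie A V)) : γ = γ' := by
  rw [isOneParameterSubgroup_iff] at h h'
  have h1 : (fun t => (γ t).coord) = fun t => (γ' t).coord := by
    refine ODE_solution_unique_univ (v := fun _ x => Matrix.of.symm V - rightTranslation A V x)
      (s := fun _ => Set.univ) (t₀ := 0) (K := ‖rightTranslation A V‖₊) (fun t => ?_)
      (fun t => ⟨hasDerivAt_left h.1 h.2 t, trivial⟩)
      (fun t => ⟨hasDerivAt_left h'.1 h'.2 t, trivial⟩) ?_
    · have h3 := (LipschitzWith.const (Matrix.of.symm V : m → n → R)).sub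
        (rightTranslation A V).lipschitz
      rw [zero_add] at h3
      exact h3.lipschitzOnWith
    · rw [map_zero_of_map_add h.1, map_zero_of_map_add h'.1]
  ext1 t
  exact coord_injective (congrFun h1 t)

end Gl
end LieAlgebra
end Homotope
end

noncomputable section

namespace Homotope

set_option linter.unusedSectionVars false

/-! ### Homomorphisms between the groups `Gl_{p,q}(A; R)` -/

namespace Gl

section Hom

variable {m n R m' n' R' : Type*} [Fintype m] [Fintype n] [DecidableEq n] [Ring R] [Algebra ℝ R]
  [Fintype m'] [Fintype n'] [DecidableEq n'] [Ring R'] [Algebra ℝ R']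
  {A : Matrix n m R} {A' : Matrix n' m' R'}

theorem val_add_val_inv (X : Gl A) : X.val + (X⁻¹).val - X.val * A * (X⁻¹).val = 0 :=
  congrArg Gl.val (mul_inv_cancel X)

theorem val_inv_add_val (X : Gl A) : (X⁻¹).val + X.val - (X⁻¹).val * A * X.val = 0 :=
  congrArg Gl.val (inv_mul_cancel X)

/-- The quasi-inverse equations involve only sums and products `X A Y`. So a linear map compatible
with these products acts on the groups even if it is not induced by a homomorphism of rings with
unit. -/
theorem isUnit_of_quasiInverse {X Y : Matrix m n R} (h : X + Y - X * A * Y = 0)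
    (h' : Y + X - Y * A * X = 0) : IsUnit (1 - A * X) := by
  have key : ∀ X Y : Matrix m n R, X + Y - X * A * Y = 0 → (1 - A * X) * (1 - A * Y) = 1 := by
    intro X Y h
    have h1 : (1 - A * X) * (1 - A * Y) = 1 - A * (X + Y - X * A * Y) := by
      simp only [Matrix.mul_add, Matrix.mul_sub, Matrix.sub_mul, Matrix.mul_assoc, Matrix.one_mul,
        Matrix.mul_one]
      abel
    rw [h1, h, Matrix.mul_zero, sub_zero]
  exact ⟨⟨_, _, key X Y h, key Y X h'⟩, rfl⟩

/-- The homomorphism induced by a linear map compatible with the products `X A Y`. -/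
def map (f : Matrix m n R →ₗ[ℝ] Matrix m' n' R')
    (hf : ∀ X Y, f (X * A * Y) = f X * A' * f Y) : Gl A →* Gl A' where
  toFun X := ⟨f X.val, isUnit_of_quasiInverse (Y := f (X⁻¹).val)
    (by rw [← hf, ← map_add, ← map_sub, val_add_val_inv, map_zero])
    (by rw [← hf, ← map_add, ← map_sub, val_inv_add_val, map_zero])⟩
  map_one' := Gl.ext (map_zero f)
  map_mul' X Y := Gl.ext (by
    change f (X.val + Y.val - X.val * A * Y.val) = f X.val + f Y.val - f X.val * A' * f Y.val
    rw [map_sub, map_add, hf])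

/-- The homomorphism `X ↦ f(X⁻¹)` for a linear map `f` that reverses the products `X A Y`. -/
def antiInv (f : Matrix m n R →ₗ[ℝ] Matrix m' n' R')
    (hf : ∀ X Y, f (X * A * Y) = f Y * A' * f X) : Gl A →* Gl A' where
  toFun X := ⟨f (X⁻¹).val, isUnit_of_quasiInverse (Y := f X.val)
    (by rw [← hf, ← map_add, ← map_sub, add_comm, val_add_val_inv, map_zero])
    (by rw [← hf, ← map_add, ← map_sub, add_comm, val_inv_add_val, map_zero])⟩
  map_one' := Gl.ext ((congrArg (fun X : Gl A => f X.val) inv_one).trans (map_zero f))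
  map_mul' X Y := Gl.ext (by
    change f ((X * Y)⁻¹).val = f (X⁻¹).val + f (Y⁻¹).val - f (X⁻¹).val * A' * f (Y⁻¹).val
    rw [mul_inv_rev, val_mul, map_sub, map_add, hf, add_comm])

theorem val_map (f : Matrix m n R →ₗ[ℝ] Matrix m' n' R')
    (hf : ∀ X Y, f (X * A * Y) = f X * A' * f Y) (X : Gl A) : (map f hf X).val = f X.val := rfl

theorem val_antiInv (f : Matrix m n R →ₗ[ℝ] Matrix m' n' R')
    (hf : ∀ X Y, f (X * A * Y) = f Y * A' * f X) (X : Gl A) :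
    (antiInv f hf X).val = f (X⁻¹).val := rfl

/-- An element of `Gl(A')` lies in the image of `Gl(A)` if its matrix and the matrix of its inverse
are images of matrices. -/
theorem exists_map_eq (f : Matrix m n R →ₗ[ℝ] Matrix m' n' R')
    (hf : ∀ X Y, f (X * A * Y) = f X * A' * f Y) (hinj : Function.Injective f) {X : Gl A'}
    (h : ∃ Y, f Y = X.val) (h' : ∃ Y, f Y = (X⁻¹).val) : ∃ Y : Gl A, map f hf Y = X := by
  obtain ⟨Y, hY⟩ := h
  obtain ⟨Z, hZ⟩ := h'
  refine ⟨⟨Y, isUnit_of_quasiInverse (Y := Z) (hinj ?_) (hinj ?_)⟩, Gl.ext hY⟩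
  · rw [map_sub, map_add, hf, hY, hZ, val_add_val_inv, map_zero]
  · rw [map_sub, map_add, hf, hY, hZ, val_inv_add_val, map_zero]

end Hom

/-! ### Continuity of the induced homomorphisms. -/

section Topology

variable {m n R m' n' R' : Type*} [Fintype m] [Fintype n] [DecidableEq n] [NormedRing R]
  [NormedAlgebra ℝ R] [FiniteDimensional ℝ R]
  [Fintype m'] [Fintype n'] [DecidableEq n'] [NormedRing R']
  [NormedAlgebra ℝ R'] [FiniteDimensional ℝ R']
  {A : Matrix n m R} {A' : Matrix n' m' R'}

instance : T2Space (Gl A) := isOpenEmbedding_coord.isEmbedding.t2Space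

instance : IsTopologicalGroup (Gl A) :=
  topologicalGroup_of_lieGroup 𝓘(ℝ, m → n → R) ∞

/-- A linear map of matrices as a continuous linear map of the underlying families. -/
def toCLM (f : Matrix m n R →ₗ[ℝ] Matrix m' n' R') : (m → n → R) →L[ℝ] (m' → n' → R') :=
  LinearMap.toContinuousLinearMap
    ((Matrix.ofLinearEquiv ℝ).symm.toLinearMap ∘ₗ f ∘ₗ (Matrix.ofLinearEquiv ℝ).toLinearMap)

theorem continuous_map (f : Matrix m n R →ₗ[ℝ] Matrix m' n' R')
    (hf : ∀ X Y, f (X * A * Y) = f X * A' * f Y) : Continuous (map f hf) :=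
  isOpenEmbedding_coord.isInducing.continuous_iff.2
    ((toCLM f).continuous.comp isOpenEmbedding_coord.continuous)

theorem continuous_antiInv (f : Matrix m n R →ₗ[ℝ] Matrix m' n' R')
    (hf : ∀ X Y, f (X * A * Y) = f Y * A' * f X) : Continuous (antiInv f hf) :=
  isOpenEmbedding_coord.isInducing.continuous_iff.2
    ((toCLM f).continuous.comp (isOpenEmbedding_coord.continuous.comp continuous_inv))

theorem isEmbedding_map (f : Matrix m n R →ₗ[ℝ] Matrix m' n' R')
    (hf : ∀ X Y, f (X * A * Y) = f X * A' * f Y) (hinj : Function.Injective f) :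
    Topology.IsEmbedding (map f hf) := by
  have h1 : Topology.IsEmbedding (toCLM f) :=
    (LinearMap.isClosedEmbedding_of_injective (f := (toCLM f).toLinearMap)
      (LinearMap.ker_eq_bot.2 hinj)).isEmbedding
  exact Topology.IsEmbedding.of_comp (continuous_map f hf) isOpenEmbedding_coord.continuous
    (h1.comp isOpenEmbedding_coord.isEmbedding)

end Topology

/-! ### Differentials of endomorphisms, and the Lie algebras of fixed groups. -/

section Differential

variable {m n R : Type*} [Fintype m] [Fintype n] [DecidableEq n] [NormedRing R]
  [NormedAlgebra ℝ R] [FiniteDimensional ℝ R] {A : Matrix n m R}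

/-- `D` is the differential at `0` of the continuous endomorphism `σ` of `Gl(A)`. -/
structure HasDifferential (σ : Gl A →* Gl A) (D : Matrix m n R →ₗ[ℝ] Matrix m n R) : Prop where
  continuous : Continuous σ
  velocity : ∀ γ V, IsOneParameterSubgroup 𝓘(ℝ, m → n → R) γ (toLie A V) →
    IsOneParameterSubgroup 𝓘(ℝ, m → n → R) (fun t => σ (γ t)) (toLie A (D V))
  map_lie : ∀ V W, D (W * A * V - V * A * W) = D W * A * D V - D V * A * D W

theorem hasDifferential_id : HasDifferential (MonoidHom.id (Gl A)) LinearMap.id where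
  continuous := continuous_id
  velocity _ _ h := h
  map_lie _ _ := rfl

theorem hasDifferential_map (f : Matrix m n R →ₗ[ℝ] Matrix m n R)
    (hf : ∀ X Y, f (X * A * Y) = f X * A * f Y) : HasDifferential (map f hf) f where
  continuous := continuous_map f hf
  velocity γ V h := by
    rw [isOneParameterSubgroup_iff] at h ⊢
    refine ⟨fun s t => by rw [h.1, map_mul], ?_⟩
    exact (toCLM f).hasFDerivAt.comp_hasDerivAt 0 h.2
  map_lie V W := by rw [map_sub, hf, hf]

theorem isOneParameterSubgroup_inv {γ : ℝ → Gl A} {V : Matrix m n R}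
    (h : IsOneParameterSubgroup 𝓘(ℝ, m → n → R) γ (toLie A V)) :
    IsOneParameterSubgroup 𝓘(ℝ, m → n → R) (fun t => (γ t)⁻¹) (toLie A (-V)) := by
  rw [isOneParameterSubgroup_iff] at h ⊢
  refine ⟨fun s t => by rw [add_comm, h.1, mul_inv_rev], ?_⟩
  have h1 : (fun t => ((γ t)⁻¹).coord) = fun t => (γ (-t)).coord := by
    ext1 t
    rw [map_neg_of_map_add h.1]
  rw [h1]
  have h3 := h.2
  rw [← neg_zero] at h3
  exact (h3.scomp 0 (hasDerivAt_neg 0)).congr_deriv (neg_one_smul ℝ (Matrix.of.symm V))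

/-- Inversion reverses the velocity, hence the sign. The map `-f` need not respect the products `X A
Y`, but it respects their commutators, because `f` reverses the products. -/
theorem hasDifferential_antiInv (f : Matrix m n R →ₗ[ℝ] Matrix m n R)
    (hf : ∀ X Y, f (X * A * Y) = f Y * A * f X) : HasDifferential (antiInv f hf) (-f) where
  continuous := continuous_antiInv f hf
  velocity γ V h := by
    have h2 := isOneParameterSubgroup_inv h
    rw [isOneParameterSubgroup_iff] at h h2 ⊢
    refine ⟨fun s t => by rw [h.1, map_mul], ?_⟩
    have h4 := (toCLM f).hasFDerivAt.comp_hasDerivAt 0 h2.2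
    exact h4.congr_deriv (map_neg (toCLM f) (Matrix.of.symm V))
  map_lie V W := by
    simp only [LinearMap.neg_apply, map_sub, hf, Matrix.neg_mul, Matrix.mul_neg, neg_neg,
      neg_sub_neg]

theorem HasDifferential.eq_of_forall_map_eq {σ : Gl A →* Gl A} {D : Matrix m n R →ₗ[ℝ] Matrix m n R}
    (h : HasDifferential σ D) {γ : ℝ → Gl A} {V W : Matrix m n R}
    (hγ : IsOneParameterSubgroup 𝓘(ℝ, m → n → R) γ (toLie A V))
    (hW : IsOneParameterSubgroup 𝓘(ℝ, m → n → R) (fun t => σ (γ t)) (toLie A W)) : D V = W :=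
  hasDerivAt_unique_velocity (isOneParameterSubgroup_iff.1 (h.velocity γ V hγ)).2
    (isOneParameterSubgroup_iff.1 hW).2

variable {τ σ : Gl A →* Gl A} {Dτ Dσ : Matrix m n R →ₗ[ℝ] Matrix m n R} {G : Subgroup (Gl A)}

/-- A one-parameter subgroup stays in `G` if and only if `τ ∘ γ = γ`. As velocities determine
one-parameter subgroups, this means that `Dτ` fixes the velocity. -/
theorem lieAlgebraOf_eq (hτ : HasDifferential τ Dτ) (hG : ∀ X, X ∈ G ↔ τ X = X) :
    lieAlgebraOf 𝓘(ℝ, m → n → R) G = toLie A '' {V | Dτ V = V} := by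
  ext v
  constructor
  · rintro ⟨γ, hγ, hγG⟩
    obtain ⟨V, rfl⟩ := (toLie A).surjective v
    refine ⟨V, hτ.eq_of_forall_map_eq hγ ?_, rfl⟩
    simpa only [(hG _).1 (hγG _)] using hγ
  · rintro ⟨V, hV, rfl⟩
    obtain ⟨γ, hγ⟩ := exists_isOneParameterSubgroup A V
    refine ⟨γ, hγ, fun t => (hG _).2 ?_⟩
    have h := hτ.velocity γ V hγ
    rw [show Dτ V = V from hV] at h
    exact congrFun (isOneParameterSubgroup_unique h hγ) t

/-- As for `lieAlgebraOf_eq`, with the additional comparison of `σ ∘ γ` and `t ↦ (γ t)⁻¹`, which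
have velocities `Dσ V` and `-V`. -/
theorem antiFixed_eq (hτ : HasDifferential τ Dτ) (hG : ∀ X, X ∈ G ↔ τ X = X)
    (hσ : HasDifferential σ Dσ) {σ' : G →* G} (hσ' : ∀ X, (σ' X : Gl A) = σ X) :
    antiFixed 𝓘(ℝ, m → n → R) σ' = toLie A '' {V | Dτ V = V ∧ Dσ V = -V} := by
  ext v
  constructor
  · rintro ⟨γ, hγ, hγσ⟩
    obtain ⟨V, rfl⟩ := (toLie A).surjective v
    refine ⟨V, ⟨hτ.eq_of_forall_map_eq hγ ?_, hσ.eq_of_forall_map_eq hγ ?_⟩, rfl⟩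
    · simpa only [(hG _).1 (γ _).2] using hγ
    · have h : ∀ t, σ (γ t : Gl A) = (γ t : Gl A)⁻¹ := fun t => by
        rw [← hσ', hγσ, Subgroup.coe_inv]
      simpa only [h] using isOneParameterSubgroup_inv hγ
  · rintro ⟨V, ⟨hV, hV'⟩, rfl⟩
    obtain ⟨γ, hγ⟩ := exists_isOneParameterSubgroup A V
    have h := hτ.velocity γ V hγ
    rw [hV] at h
    have h' := hσ.velocity γ V hγ
    rw [hV'] at h'
    refine ⟨fun t => ⟨γ t, (hG _).2 (congrFun (isOneParameterSubgroup_unique h hγ) t)⟩, hγ,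
      fun t => Subtype.ext ?_⟩
    rw [hσ', Subgroup.coe_inv]
    exact congrFun (isOneParameterSubgroup_unique h' (isOneParameterSubgroup_inv hγ)) t

theorem isClosed_of_mem_iff (hτ : HasDifferential τ Dτ) (hG : ∀ X, X ∈ G ↔ τ X = X) :
    IsClosed (G : Set (Gl A)) := by
  have h : (G : Set (Gl A)) = {X | τ X = X} := Set.ext hG
  rw [h]
  exact isClosed_eq hτ.continuous continuous_id

end Differential

end Gl
end Homotope
end

noncomputable section

namespace Homotope

set_option linter.unusedSectionVars false

/-! ### Homotopes realized in a Lie algebra of matrices -/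

section Bracket

variable {m n S : Type*} [Fintype m] [Fintype n] [Ring S] [Algebra ℝ S]

/-- The bracket `T(X, α Y, Z) - T(Y, α X, Z)` on a subspace that is closed under it. -/
def homotopeBracket (Vp : Submodule ℝ (Matrix m n S)) (α : Matrix m n S →ₗ[ℝ] Matrix n m S)
    (h : ∀ X ∈ Vp, ∀ Y ∈ Vp, ∀ Z ∈ Vp, T X (α Y) Z - T Y (α X) Z ∈ Vp) :
    Vp →ₗ[ℝ] Vp →ₗ[ℝ] Vp →ₗ[ℝ] Vp :=
  LinearMap.mk₂ ℝ
    (fun X Y =>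
      { toFun := fun Z => ⟨_, h X X.2 Y Y.2 Z Z.2⟩
        map_add' := fun Z Z' => Subtype.ext (by
          simp only [T, Submodule.coe_add, Matrix.mul_add, Matrix.add_mul]
          abel)
        map_smul' := fun c Z => Subtype.ext (by
          simp only [T, Submodule.coe_smul, Matrix.mul_smul, Matrix.smul_mul, smul_add, smul_sub,
            RingHom.id_apply]) })
    (fun X X' Y => LinearMap.ext fun Z => Subtype.ext (by
      simp only [T, Submodule.coe_add, LinearMap.add_apply, LinearMap.coe_mk, AddHom.coe_mk,
        map_add, Matrix.mul_add, Matrix.add_mul]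
      abel))
    (fun c X Y => LinearMap.ext fun Z => Subtype.ext (by
      simp only [T, Submodule.coe_smul, LinearMap.smul_apply, LinearMap.coe_mk, AddHom.coe_mk,
        map_smul, Matrix.mul_smul, Matrix.smul_mul, smul_add, smul_sub]))
    (fun X Y Y' => LinearMap.ext fun Z => Subtype.ext (by
      simp only [T, Submodule.coe_add, LinearMap.add_apply, LinearMap.coe_mk, AddHom.coe_mk,
        map_add, Matrix.mul_add, Matrix.add_mul]
      abel))
    (fun c X Y => LinearMap.ext fun Z => Subtype.ext (by
      simp only [T, Submodule.coe_smul, LinearMap.smul_apply, LinearMap.coe_mk, AddHom.coe_mk,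
        map_smul, Matrix.mul_smul, Matrix.smul_mul, smul_add, smul_sub]))

/-- A bracket that an injective linear map identifies with `[[X, Y], Z]` in a Lie algebra makes
its domain a Lie triple system. -/
theorem isLieTripleSystem_of_injective {V L : Type*} [AddCommGroup V] [Module ℝ V] [LieRing L]
    [Module ℝ L] (br : V →ₗ[ℝ] V →ₗ[ℝ] V →ₗ[ℝ] V) (φ : V →ₗ[ℝ] L) (hφ : Function.Injective φ)
    (h : ∀ X Y Z, φ (br X Y Z) = ⁅⁅φ X, φ Y⁆, φ Z⁆) : IsLieTripleSystem br where
  skew X Y Z := hφ (by rw [map_neg, h, h, ← neg_lie, lie_skew])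
  cyclic X Y Z := hφ (by
    rw [map_add, map_add, h, h, h, map_zero, ← lie_skew ⁅φ X, φ Y⁆,
      ← lie_skew ⁅φ Y, φ Z⁆, ← lie_skew ⁅φ Z, φ X⁆]
    have h1 := lie_jacobi (φ X) (φ Y) (φ Z)
    rw [← neg_eq_zero] at h1
    rw [← h1]
    abel)
  derivation U W X Y Z := hφ (by
    simp only [map_add, h]
    -- The inner derivation of `⁅φ U, φ W⁆` is applied to the outer bracket, then to the inner one.
    rw [leibniz_lie, leibniz_lie ⁅φ U, φ W⁆ (φ X) (φ Y), add_lie])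

variable {m' n' R : Type*} [Fintype m'] [Fintype n'] [DecidableEq n'] [NormedRing R]
  [NormedAlgebra ℝ R] [FiniteDimensional ℝ R] {A : Matrix n' m' R}

/-- The right-hand side is `T(V, A W A, Z) - T(W, A V A, Z)`. This is the point where Lie triple
products meet the bracket defined by `α`. -/
theorem lie_lie_toLie (V W Z : Matrix m' n' R) :
    ⁅⁅Gl.toLie A V, Gl.toLie A W⁆, Gl.toLie A Z⁆ =
      Gl.toLie A ((V * A * W * A * Z + Z * A * W * A * V) -
        (W * A * V * A * Z + Z * A * V * A * W)) := by
  rw [Gl.lie_toLie, Gl.lie_toLie]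
  congr 1
  simp only [Matrix.mul_sub, Matrix.sub_mul, Matrix.mul_assoc]
  abel

/-- `Φ` identifies the subspace `V⁺` with the subspace `Q` of the Lie algebra of `Gl(A)`, and
carries the triple product `T(X, α Y, Z)` to the triple product of the Lie algebra. -/
structure IsRealization (Vp : Submodule ℝ (Matrix m n S)) (Vm : Submodule ℝ (Matrix n m S))
    (α : Matrix m n S →ₗ[ℝ] Matrix n m S) (A : Matrix n' m' R)
    (Φ : Matrix m n S →ₗ[ℝ] Matrix m' n' R) (Q : Set (Matrix m' n' R)) : Prop where
  map_mem : ∀ X ∈ Vp, α X ∈ Vm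
  injective : Function.Injective Φ
  mem_iff : ∀ X, X ∈ Vp ↔ Φ X ∈ Q
  subset_range : ∀ V ∈ Q, ∃ X, Φ X = V
  map_T : ∀ X ∈ Vp, ∀ Y ∈ Vp, ∀ Z ∈ Vp,
    Φ (T X (α Y) Z) = Φ X * A * Φ Y * A * Φ Z + Φ Z * A * Φ Y * A * Φ X

/-- Stability of `V⁺` under the bracket is never checked inside `V⁺`: it is pulled back along `Φ`
from the stability of `Q` under double commutators. -/
theorem IsRealization.exists_bracket {Vp : Submodule ℝ (Matrix m n S)}
    {Vm : Submodule ℝ (Matrix n m S)} {α : Matrix m n S →ₗ[ℝ] Matrix n m S}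
    {Φ : Matrix m n S →ₗ[ℝ] Matrix m' n' R} {Q : Set (Matrix m' n' R)}
    (h : IsRealization Vp Vm α A Φ Q)
    (hQ : ∀ V ∈ Q, ∀ W ∈ Q, ∀ Z ∈ Q, (V * A * W * A * Z + Z * A * W * A * V) -
        (W * A * V * A * Z + Z * A * V * A * W) ∈ Q) :
    ∃ br : Vp →ₗ[ℝ] Vp →ₗ[ℝ] Vp →ₗ[ℝ] Vp, IsHomotope Vp Vm α br ∧
      IsTripleBracketOn 𝓘(ℝ, m' → n' → R) br (Gl.toLie A '' Q) := by
  have h1 : ∀ X ∈ Vp, ∀ Y ∈ Vp, ∀ Z ∈ Vp, Φ (T X (α Y) Z - T Y (α X) Z) =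
      (Φ X * A * Φ Y * A * Φ Z + Φ Z * A * Φ Y * A * Φ X) -
        (Φ Y * A * Φ X * A * Φ Z + Φ Z * A * Φ X * A * Φ Y) := by
    intro X hX Y hY Z hZ
    rw [map_sub, h.map_T X hX Y hY Z hZ, h.map_T Y hY X hX Z hZ]
  have h2 : ∀ X ∈ Vp, ∀ Y ∈ Vp, ∀ Z ∈ Vp, T X (α Y) Z - T Y (α X) Z ∈ Vp := by
    intro X hX Y hY Z hZ
    rw [h.mem_iff, h1 X hX Y hY Z hZ]
    exact hQ _ ((h.mem_iff X).1 hX) _ ((h.mem_iff Y).1 hY) _ ((h.mem_iff Z).1 hZ)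
  let φ : Vp →ₗ[ℝ] GroupLieAlgebra 𝓘(ℝ, m' → n' → R) (Gl A) :=
    (Gl.toLie A).toLinearMap ∘ₗ Φ ∘ₗ Vp.subtype
  have hφ : Function.Injective φ :=
    (Gl.toLie A).injective.comp (h.injective.comp Subtype.val_injective)
  have h3 : ∀ X Y Z, φ (homotopeBracket Vp α h2 X Y Z) = ⁅⁅φ X, φ Y⁆, φ Z⁆ := by
    intro X Y Z
    refine Eq.trans ?_ (lie_lie_toLie _ _ _).symm
    exact congrArg (Gl.toLie A) (h1 X X.2 Y Y.2 Z Z.2)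
  refine ⟨homotopeBracket Vp α h2, ⟨⟨α.restrict h.map_mem, fun _ => rfl⟩, fun _ _ _ => rfl,
    isLieTripleSystem_of_injective _ φ hφ h3⟩, φ, hφ, ?_, h3⟩
  ext v
  constructor
  · rintro ⟨X, rfl⟩
    exact ⟨Φ X, (h.mem_iff X).1 X.2, rfl⟩
  · rintro ⟨V, hV, rfl⟩
    obtain ⟨X, rfl⟩ := h.subset_range V hV
    exact ⟨⟨X, (h.mem_iff X).2 hV⟩, rfl⟩

variable {Vp : Submodule ℝ (Matrix m n S)} {Vm : Submodule ℝ (Matrix n m S)}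
  {α : Matrix m n S →ₗ[ℝ] Matrix n m S} {Φ : Matrix m n S →ₗ[ℝ] Matrix m' n' R}
  {G : Subgroup (Gl A)} {τ σ : Gl A →* Gl A} {Dτ Dσ : Matrix m' n' R →ₗ[ℝ] Matrix m' n' R}

theorem triple_eq (V W Z : Matrix m' n' R) :
    (V * A * W * A * Z + Z * A * W * A * V) - (W * A * V * A * Z + Z * A * V * A * W) =
      Z * A * (W * A * V - V * A * W) - (W * A * V - V * A * W) * A * Z := by
  simp only [Matrix.mul_sub, Matrix.sub_mul, Matrix.mul_assoc]
  abel

/-- A differential preserves commutators but perhaps no single product. Hence the detour through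
`triple_eq`, which writes the triple product as a double commutator. -/
theorem Gl.HasDifferential.map_triple (hτ : Gl.HasDifferential τ Dτ) (V W Z : Matrix m' n' R) :
    Dτ ((V * A * W * A * Z + Z * A * W * A * V) - (W * A * V * A * Z + Z * A * V * A * W)) =
      (Dτ V * A * Dτ W * A * Dτ Z + Dτ Z * A * Dτ W * A * Dτ V) -
        (Dτ W * A * Dτ V * A * Dτ Z + Dτ Z * A * Dτ V * A * Dτ W) := by
  rw [triple_eq, triple_eq, hτ.map_lie, hτ.map_lie]

theorem groupCase_of_isRealization (hτ : Gl.HasDifferential τ Dτ) (hG : ∀ X, X ∈ G ↔ τ X = X)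
    (h : IsRealization Vp Vm α A Φ {V | Dτ V = V}) : GroupCase Vp Vm α G := by
  obtain ⟨br, h1, h2⟩ := h.exists_bracket (by
    intro V (hV : Dτ V = V) W (hW : Dτ W = W) Z (hZ : Dτ Z = Z)
    change Dτ _ = _
    rw [hτ.map_triple, hV, hW, hZ])
  refine ⟨br, h1, Gl.isClosed_of_mem_iff hτ hG, ?_⟩
  rwa [Gl.lieAlgebraOf_eq hτ hG]

/-- Here `H` is required to be the whole fixed group of `σ` in `G`, not merely an open subgroup of
it. -/
theorem symmetricCase_of_isRealization {H : Type*} [Group H] [TopologicalSpace H]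
    {emb : H → Matrix m' n' R}
    (hτ : Gl.HasDifferential τ Dτ) (hG : ∀ X, X ∈ G ↔ τ X = X)
    (hσ : Gl.HasDifferential σ Dσ) (hσσ : ∀ X, σ (σ X) = X) (hσG : ∀ X ∈ G, σ X ∈ G)
    (ι : H →* Gl A) (hι : Topology.IsEmbedding ι) (hemb : ∀ x, (ι x).val = emb x)
    (hιG : ∀ x, ι x ∈ G) (hισ : ∀ x, σ (ι x) = ι x)
    (hrange : ∀ X ∈ G, σ X = X → ∃ x, ι x = X)
    (h : IsRealization Vp Vm α A Φ {V | Dτ V = V ∧ Dσ V = -V}) :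
    SymmetricCase Vp Vm α G emb := by
  obtain ⟨br, h1, h2⟩ := h.exists_bracket (by
    rintro V ⟨hV, hV'⟩ W ⟨hW, hW'⟩ Z ⟨hZ, hZ'⟩
    refine ⟨by rw [hτ.map_triple, hV, hW, hZ], ?_⟩
    -- Three sign changes give one: the `-1`-eigenspace is stable under triple products, though not
    -- under brackets in general.
    rw [hσ.map_triple, hV', hW', hZ']
    simp only [Matrix.neg_mul, Matrix.mul_neg, neg_neg]
    abel)
  let σ' : G →* G := (σ.comp G.subtype).codRestrict G fun X => hσG X X.2
  let ι' : H →* G := ι.codRestrict G hιG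
  refine ⟨br, h1, ι', hι.codRestrict (G : Set (Gl A)) hιG, hemb, Gl.isClosed_of_mem_iff hτ hG,
    σ', ?_, fun X => Subtype.ext (hσσ X), ?_, ?_, ?_⟩
  · exact (hσ.continuous.comp continuous_subtype_val).subtype_mk _
  · rintro _ ⟨x, rfl⟩
    exact Subtype.ext (hισ x)
  · convert! isOpen_univ
    rw [Set.eq_univ_iff_forall]
    rintro ⟨X, hX⟩
    obtain ⟨x, hx⟩ := hrange X X.2 (congrArg Subtype.val hX)
    exact ⟨x, Subtype.ext hx⟩
  · rwa [Gl.antiFixed_eq hτ hG hσ (σ' := σ') fun _ => rfl]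

end Bracket

end Homotope
end

noncomputable section

namespace Homotope

set_option linter.unusedSectionVars false

/-! ### Symmetric spaces of general linear and of unitary groups -/

section Unitary

variable {m n S : Type*} [Fintype m] [Fintype n] [Ring S] [Algebra ℝ S]
  {Vp : Submodule ℝ (Matrix m n S)} {Vm : Submodule ℝ (Matrix n m S)}
  {α : Matrix m n S →ₗ[ℝ] Matrix n m S}
  {m' n' R : Type*} [Fintype m'] [Fintype n'] [DecidableEq n'] [NormedRing R]
  [NormedAlgebra ℝ R] [FiniteDimensional ℝ R] {D : Matrix n' m' R}
  {k l Q : Type*} [Fintype k] [Fintype l] [DecidableEq l] [NormedRing Q]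
  [NormedAlgebra ℝ Q] [FiniteDimensional ℝ Q] {A : Matrix l k Q}
  {Φ : Matrix m n S →ₗ[ℝ] Matrix m' n' R}

/-- The subgroup `K` of `Gl(A)` consists of all `X` with `X⁻¹ = t(X)`, where `t` is an involutive
linear map that reverses the products `X A Y`. -/
structure IsUnitaryGroup (t : Matrix k l Q →ₗ[ℝ] Matrix k l Q) (K : Subgroup (Gl A)) : Prop where
  map_mul : ∀ X Y, t (X * A * Y) = t Y * A * t X
  involutive : ∀ X, t (t X) = X
  mem_iff : ∀ X, X ∈ K ↔ (X⁻¹).val = t X.val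

/-- As `t` is an involution, `X⁻¹ = t(X)` is equivalent to `t(X⁻¹) = X`, which exhibits `K` as a
fixed group. -/
theorem IsUnitaryGroup.mem_iff_antiInv {t : Matrix k l Q →ₗ[ℝ] Matrix k l Q} {K : Subgroup (Gl A)}
    (h : IsUnitaryGroup t K) (X : Gl A) : X ∈ K ↔ Gl.antiInv t h.map_mul X = X := by
  rw [h.mem_iff]
  constructor
  · intro hX
    apply Gl.ext
    rw [Gl.val_antiInv, hX, h.involutive]
  · intro hX
    rw [← h.involutive (X⁻¹).val]
    exact congrArg t (congrArg Gl.val hX)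

theorem groupCase_top (h : IsRealization Vp Vm α D Φ Set.univ) :
    GroupCase Vp Vm α (⊤ : Subgroup (Gl D)) := by
  refine groupCase_of_isRealization (Φ := Φ) Gl.hasDifferential_id (fun X => by simp) ?_
  convert! h
  simp

theorem groupCase_unitary {t : Matrix m' n' R →ₗ[ℝ] Matrix m' n' R} {G : Subgroup (Gl D)}
    (hG : IsUnitaryGroup t G) (h : IsRealization Vp Vm α D Φ {V | t V = -V}) :
    GroupCase Vp Vm α G := by
  refine groupCase_of_isRealization (Φ := Φ) (Gl.hasDifferential_antiInv t hG.map_mul)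
    hG.mem_iff_antiInv ?_
  convert! h using 3
  rw [LinearMap.neg_apply, neg_eq_iff_eq_neg]

theorem symmetricCase_top {s : Matrix m' n' R →ₗ[ℝ] Matrix m' n' R}
    (hs : ∀ X Y, s (X * D * Y) = s X * D * s Y) (hss : ∀ X, s (s X) = X)
    {e : Matrix k l Q →ₗ[ℝ] Matrix m' n' R} (he : ∀ X Y, e (X * A * Y) = e X * D * e Y)
    (hinj : Function.Injective e) (hse : ∀ X, s (e X) = e X)
    (hes : ∀ Y, s Y = Y → ∃ X, e X = Y)
    (h : IsRealization Vp Vm α D Φ {V | s V = -V}) :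
    SymmetricCase Vp Vm α (⊤ : Subgroup (Gl D)) (fun x : Gl A => e x.val) := by
  refine symmetricCase_of_isRealization (Φ := Φ) (τ := MonoidHom.id _) (σ := Gl.map s hs)
    (ι := Gl.map e he) Gl.hasDifferential_id (fun X => by simp) (Gl.hasDifferential_map s hs)
    (fun X => Gl.ext (hss _)) (fun _ _ => trivial) (Gl.isEmbedding_map e he hinj) (fun _ => rfl)
    (fun _ => trivial) (fun x => Gl.ext (hse _)) (fun X _ hX => ?_) ?_
  · refine Gl.exists_map_eq e he hinj (hes _ (congrArg Gl.val hX)) (hes _ ?_)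
    have h1 : Gl.map s hs X⁻¹ = X⁻¹ := by rw [map_inv, hX]
    exact congrArg Gl.val h1
  · convert! h using 3
    simp

/-- The involution is `X ↦ t(X⁻¹)`, with differential `-t`, so the anti-fixed vectors are the fixed
vectors of `t`. -/
theorem symmetricCase_top_of_unitary {t : Matrix m' n' R →ₗ[ℝ] Matrix m' n' R}
    {K : Subgroup (Gl D)} (hK : IsUnitaryGroup t K)
    (h : IsRealization Vp Vm α D Φ {V | t V = V}) :
    SymmetricCase Vp Vm α (⊤ : Subgroup (Gl D)) (fun x : K => x.1.val) := by
  refine symmetricCase_of_isRealization (Φ := Φ) (τ := MonoidHom.id _)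
    (σ := Gl.antiInv t hK.map_mul)
    (ι := K.subtype) Gl.hasDifferential_id (fun X => by simp)
    (Gl.hasDifferential_antiInv t hK.map_mul)
    (fun X => Gl.ext ?_) (fun _ _ => trivial) Topology.IsEmbedding.subtypeVal (fun _ => rfl)
    (fun _ => trivial) (fun x => (hK.mem_iff_antiInv _).1 x.2)
    (fun X _ hX => ⟨⟨X, (hK.mem_iff_antiInv _).2 hX⟩, rfl⟩) ?_
  · rw [Gl.val_antiInv, ← map_inv, Gl.val_antiInv, inv_inv, hK.involutive]
  · convert! h using 3
    simp

/-- Because `s` and `t` commute, the involution of `Gl D` defined by `s` preserves `G`. Because `e`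
intertwines `tK` and `t`, an element of `Gl A` lands in `G` exactly when it lies in `K`. -/
theorem symmetricCase_unitary {t s : Matrix m' n' R →ₗ[ℝ] Matrix m' n' R} {G : Subgroup (Gl D)}
    (hG : IsUnitaryGroup t G)
    (hs : ∀ X Y, s (X * D * Y) = s X * D * s Y) (hss : ∀ X, s (s X) = X)
    (hst : ∀ X, s (t X) = t (s X))
    {tK : Matrix k l Q →ₗ[ℝ] Matrix k l Q} {K : Subgroup (Gl A)} (hK : IsUnitaryGroup tK K)
    {e : Matrix k l Q →ₗ[ℝ] Matrix m' n' R} (he : ∀ X Y, e (X * A * Y) = e X * D * e Y)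
    (hinj : Function.Injective e) (hte : ∀ X, t (e X) = e (tK X)) (hse : ∀ X, s (e X) = e X)
    (hes : ∀ Y, s Y = Y → ∃ X, e X = Y)
    (h : IsRealization Vp Vm α D Φ {V | t V = -V ∧ s V = -V}) :
    SymmetricCase Vp Vm α G (fun x : K => e x.1.val) := by
  have hmem : ∀ x : Gl A, Gl.map e he x ∈ G ↔ x ∈ K := fun x => by
    rw [hG.mem_iff, hK.mem_iff, ← map_inv, Gl.val_map, Gl.val_map, hte]
    exact hinj.eq_iff
  refine symmetricCase_of_isRealization (Φ := Φ) (σ := Gl.map s hs)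
    (ι := (Gl.map e he).comp K.subtype) (Gl.hasDifferential_antiInv t hG.map_mul)
    hG.mem_iff_antiInv (Gl.hasDifferential_map s hs)
    (fun X => Gl.ext (hss _)) (fun X hX => ?_)
    ((Gl.isEmbedding_map e he hinj).comp Topology.IsEmbedding.subtypeVal) (fun _ => rfl)
    (fun x => (hmem _).2 x.2) (fun x => Gl.ext (hse _)) (fun X hX hX' => ?_) ?_
  · rw [hG.mem_iff] at hX ⊢
    rw [← map_inv, Gl.val_map, Gl.val_map, hX, hst]
  · have h1 : Gl.map s hs X⁻¹ = X⁻¹ := by rw [map_inv, hX']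
    obtain ⟨x, rfl⟩ := Gl.exists_map_eq e he hinj (hes _ (congrArg Gl.val hX'))
      (hes _ (congrArg Gl.val h1))
    exact ⟨⟨x, (hmem x).1 hX⟩, rfl⟩
  · convert! h using 4
    rw [LinearMap.neg_apply, neg_eq_iff_eq_neg]

end Unitary

/-! ### Matrices over larger algebras, entry by entry -/

section Entrywise

variable {m n R S : Type*} [Ring R] [Algebra ℝ R] [Ring S] [Algebra ℝ S]

/-- The linear map `X ↦ t(X)ᵗ`. -/
def adjMap (t : S →ₗ[ℝ] R) : Matrix m n S →ₗ[ℝ] Matrix n m R :=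
  (Matrix.transposeLinearEquiv m n ℝ R).toLinearMap ∘ₗ t.mapMatrix

theorem adjMap_apply (t : S →ₗ[ℝ] R) (X : Matrix m n S) : adjMap t X = (X.map t)ᵀ := rfl

variable [Fintype m] [Fintype n]

/-- The map `X ↦ A c(X A)`. -/
def sandwich (c : S →ₗ[ℝ] S) (A : Matrix n m S) : Matrix m n S →ₗ[ℝ] Matrix n m S where
  toFun X := A * (X * A).map c
  map_add' X Y := by rw [Matrix.add_mul, Matrix.map_add _ (map_add c), Matrix.mul_add]
  map_smul' r X := by
    rw [Matrix.smul_mul, Matrix.map_smul _ r fun x => map_smul c r x, Matrix.mul_smul,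
      RingHom.id_apply]

theorem sandwich_apply (c : S →ₗ[ℝ] S) (A : Matrix n m S) (X : Matrix m n S) :
    sandwich c A X = A * (X * A).map c := rfl

/-- Each entry of a product of three matrices is a sum of products of three entries. Thus `f` needs
no multiplicativity beyond the given identity, and `d`, `h` need not be linear. -/
theorem map_mul_mul {p q Q : Type*} [Ring Q] [Algebra ℝ Q] {f : Q →ₗ[ℝ] R} {d : S → R} {h : S → Q}
    (hf : ∀ x a y, f (x * h a * y) = f x * d a * f y)
    (X : Matrix p m Q) (A : Matrix m n S) (Y : Matrix n q Q) :
    (X * A.map h * Y).map f = X.map f * A.map d * Y.map f := by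
  ext i j
  simp only [Matrix.map_apply, Matrix.mul_apply, Finset.sum_mul, map_sum, hf]

theorem map_mul_sandwich_mul {c : S →ₗ[ℝ] S} {g : S →ₗ[ℝ] R} {d : S → R}
    (hg : ∀ x a y b z, g (x * a * c (y * b) * z) = g x * d a * (g y * d b) * g z)
    (X Y Z : Matrix m n S) (A : Matrix n m S) :
    (X * sandwich c A Y * Z).map g = X.map g * A.map d * Y.map g * A.map d * Z.map g := by
  rw [sandwich_apply, ← Matrix.mul_assoc, Matrix.mul_assoc (X.map g * A.map d)]
  ext i j
  simp only [Matrix.map_apply, Matrix.mul_apply, Finset.sum_mul, Finset.mul_sum, map_sum, hg]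

/-- This yields `α(V⁺) ⊆ V⁺`. The maps `tV` and `tA` describe the symmetry types of `X` and of the
parameter, which may differ. -/
theorem adjMap_sandwich {c tV tA : S →ₗ[ℝ] S}
    (h : ∀ a x b, tV (a * c (x * b)) = tA b * c (tV x * tA a)) {X A : Matrix n n S}
    (hX : adjMap tV X = X) (hA : adjMap tA A = A) :
    adjMap tV (sandwich c A X) = sandwich c A X := by
  have hX' : ∀ i j, tV (X j i) = X i j := fun i j => congrFun (congrFun hX i) j
  have hA' : ∀ i j, tA (A j i) = A i j := fun i j => congrFun (congrFun hA i) j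
  ext i j
  rw [adjMap_apply]
  simp only [sandwich_apply, Matrix.transpose_apply, Matrix.map_apply, Matrix.mul_apply,
    Finset.mul_sum, map_sum, h, hX', hA']
  exact Finset.sum_comm

end Entrywise

/-! ### Entrywise maps followed by a block realization, and eigenspace decompositions. -/

section EntrywiseRealization

variable {m n M N R' R S : Type*} [Fintype m] [Fintype n] [Fintype M] [Fintype N] [Ring R']
  [Algebra ℝ R'] [Ring R] [Algebra ℝ R] [Ring S] [Algebra ℝ S]
  {B : Matrix m n R' ≃ₗ[ℝ] Matrix M N R} {A : Matrix n m S} {D : Matrix N M R}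

/-- The map of matrices given by a linear map of their entries, followed by a realization `B` of
the matrices over `R'` by larger matrices. -/
def entrywise (B : Matrix m n R' ≃ₗ[ℝ] Matrix M N R) (f : S →ₗ[ℝ] R') :
    Matrix m n S →ₗ[ℝ] Matrix M N R :=
  B.toLinearMap ∘ₗ f.mapMatrix

theorem entrywise_apply (f : S →ₗ[ℝ] R') (X : Matrix m n S) :
    entrywise B f X = B (X.map f) := rfl

/-- The linear endomorphism induced by a linear map of the entries. -/
def entrywiseEnd (B : Matrix m n R' ≃ₗ[ℝ] Matrix M N R) (f : R' →ₗ[ℝ] R') :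
    Matrix M N R →ₗ[ℝ] Matrix M N R :=
  entrywise B f ∘ₗ B.symm.toLinearMap

theorem entrywiseEnd_apply (f : R' →ₗ[ℝ] R') (X : Matrix m n R') :
    entrywiseEnd B f (B X) = B (X.map f) := by
  change B ((B.symm (B X)).map f) = _
  rw [B.symm_apply_apply]

theorem entrywise_injective {f : S →ₗ[ℝ] R'} (hf : Function.Injective f) :
    Function.Injective (entrywise B f) :=
  B.injective.comp (Matrix.map_injective hf)

theorem entrywise_mul_mul {d : S → R'} (hB : ∀ X Y, B (X * A.map d * Y) = B X * D * B Y)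
    {h : S → S} {f : S →ₗ[ℝ] R'} (hf : ∀ x a y, f (x * h a * y) = f x * d a * f y)
    (X Y : Matrix m n S) :
    entrywise B f (X * A.map h * Y) = entrywise B f X * D * entrywise B f Y := by
  rw [entrywise_apply, map_mul_mul hf, hB]
  rfl

theorem entrywiseEnd_mul_mul {d : S → R'} (hB : ∀ X Y, B (X * A.map d * Y) = B X * D * B Y)
    {f : R' →ₗ[ℝ] R'} (hf : ∀ x a y, f (x * d a * y) = f x * d a * f y) (X Y : Matrix M N R) :
    entrywiseEnd B f (X * D * Y) = entrywiseEnd B f X * D * entrywiseEnd B f Y := by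
  obtain ⟨X, rfl⟩ := B.surjective X
  obtain ⟨Y, rfl⟩ := B.surjective Y
  rw [← hB, entrywiseEnd_apply, entrywiseEnd_apply, entrywiseEnd_apply, map_mul_mul hf, hB]

theorem entrywise_T {d : S → R'} (hB : ∀ X Y, B (X * A.map d * Y) = B X * D * B Y)
    {c : S →ₗ[ℝ] S} {f : S →ₗ[ℝ] R'}
    (hf : ∀ x a y b z, f (x * a * c (y * b) * z) = f x * d a * (f y * d b) * f z)
    (X Y Z : Matrix m n S) :
    entrywise B f (T X (sandwich c A Y) Z) =
      entrywise B f X * D * entrywise B f Y * D * entrywise B f Z +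
        entrywise B f Z * D * entrywise B f Y * D * entrywise B f X := by
  rw [T, map_add, entrywise_apply, entrywise_apply, map_mul_sandwich_mul hf,
    map_mul_sandwich_mul hf, hB, hB, hB, hB]
  rfl

theorem eq_zero_of_neg_eq_self {V : Type*} [AddCommGroup V] [Module ℝ V] {x : V} (h : -x = x) :
    x = 0 := by
  have h1 : (2 : ℝ) • x = 0 := by
    rw [two_smul]
    nth_rw 1 [← h]
    exact neg_add_cancel x
  simpa using h1

/-- The space `V` is the direct sum of the images of `e` and `f`, which are the eigenspaces of
the involution `s`. -/
structure IsEigenDecomposition {V W : Type*} [AddCommGroup V] [Module ℝ V] [AddCommGroup W]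
    [Module ℝ W] (s : V →ₗ[ℝ] V) (e f : W →ₗ[ℝ] V) : Prop where
  left_injective : Function.Injective e
  right_injective : Function.Injective f
  map_left : ∀ x, s (e x) = e x
  map_right : ∀ x, s (f x) = -f x
  exists_add : ∀ r, ∃ x y, r = e x + f y

namespace IsEigenDecomposition

variable {V W : Type*} [AddCommGroup V] [Module ℝ V] [AddCommGroup W]
    [Module ℝ W] {s : V →ₗ[ℝ] V} {e f : W →ₗ[ℝ] V}

theorem involutive (h : IsEigenDecomposition s e f) (r : V) : s (s r) = r := by
  obtain ⟨x, y, rfl⟩ := h.exists_add r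
  simp only [map_add, map_neg, h.map_left, h.map_right, neg_neg]

theorem exists_left (h : IsEigenDecomposition s e f) (r : V) (hr : s r = r) : ∃ x, e x = r := by
  obtain ⟨x, y, rfl⟩ := h.exists_add r
  rw [map_add, h.map_left, h.map_right, add_right_inj] at hr
  exact ⟨x, by rw [eq_zero_of_neg_eq_self hr, add_zero]⟩

theorem exists_right (h : IsEigenDecomposition s e f) (r : V) (hr : s r = -r) :
    ∃ x, f x = r := by
  obtain ⟨x, y, rfl⟩ := h.exists_add r
  rw [map_add, h.map_left, h.map_right, neg_add, add_left_inj] at hr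
  exact ⟨y, by rw [eq_zero_of_neg_eq_self hr.symm, zero_add]⟩

/-- The map `t` preserves both eigenspaces of `s`. -/
theorem comm {t : V →ₗ[ℝ] V} {te tf : W → W} (h : IsEigenDecomposition s e f)
    (hte : ∀ x, t (e x) = e (te x)) (htf : ∀ x, t (f x) = -f (tf x)) (r : V) :
    s (t r) = t (s r) := by
  obtain ⟨x, y, rfl⟩ := h.exists_add r
  simp only [map_add, map_neg, hte, htf, h.map_left, h.map_right]

end IsEigenDecomposition

theorem IsEigenDecomposition.entrywise {s : R' →ₗ[ℝ] R'} {e f : S →ₗ[ℝ] R'}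
    (h : IsEigenDecomposition s e f) :
    IsEigenDecomposition (entrywiseEnd B s) (entrywise B e) (entrywise B f) where
  left_injective := entrywise_injective h.left_injective
  right_injective := entrywise_injective h.right_injective
  map_left X := by
    rw [entrywise_apply, entrywiseEnd_apply, Matrix.map_map]
    exact congrArg B (Matrix.ext fun i j => h.map_left (X i j))
  map_right X := by
    rw [entrywise_apply, entrywiseEnd_apply, Matrix.map_map, ← map_neg]
    exact congrArg B (Matrix.ext fun i j => h.map_right (X i j))
  exists_add X := by
    obtain ⟨X, rfl⟩ := B.surjective X
    choose x y hxy using fun i j => h.exists_add (X i j)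
    refine ⟨Matrix.of x, Matrix.of y, ?_⟩
    rw [entrywise_apply, entrywise_apply, ← map_add]
    exact congrArg B (Matrix.ext hxy)

end EntrywiseRealization

/-! ### Reduction of the cases to identities between scalars. -/

section EntrywiseCases

variable {S : Type*} [NormedRing S] [NormedAlgebra ℝ S] [FiniteDimensional ℝ S]

theorem symmetricCase_top_entrywise {m n R : Type*} [Fintype m] [Fintype n] [DecidableEq n]
    [NormedRing R] [NormedAlgebra ℝ R] [FiniteDimensional ℝ R]
    (A : Matrix n m S) {d : S → R} {s : R →ₗ[ℝ] R} {e f : S →ₗ[ℝ] R} {c : S →ₗ[ℝ] S}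
    {α : Matrix m n S → Matrix n m S}
    (hdec : IsEigenDecomposition s e f)
    (he : ∀ x a y, e (x * a * y) = e x * d a * e y)
    (hs : ∀ x a y, s (x * d a * y) = s x * d a * s y)
    (hf : ∀ x a y b z, f (x * a * c (y * b) * z) = f x * d a * (f y * d b) * f z)
    (hα : ∀ X, α X = A * (X * A).map c) :
    SymmetricCase ⊤ ⊤ α (⊤ : Subgroup (Gl (A.map d))) (fun x : Gl A => x.val.map e) := by
  obtain rfl : α = sandwich c A := funext hα
  let B : Matrix m n R ≃ₗ[ℝ] Matrix m n R := LinearEquiv.refl ℝ _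
  have hB : ∀ X Y, B (X * A.map d * Y) = B X * A.map d * B Y := fun _ _ => rfl
  have h := hdec.entrywise (B := B)
  refine symmetricCase_top (s := entrywiseEnd B s) (e := entrywise B e) (Φ := entrywise B f)
    (entrywiseEnd_mul_mul hB hs) h.involutive (fun X Y => ?_)
    h.left_injective h.map_left h.exists_left
    ⟨fun _ _ => trivial, h.right_injective, fun X => ?_, h.exists_right,
      fun X _ Y _ Z _ => entrywise_T hB hf X Y Z⟩
  · have h1 := entrywise_mul_mul (h := id) hB he X Y
    rwa [Matrix.map_id] at h1
  · exact ⟨fun _ => h.map_right X, fun _ => trivial⟩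

/-- The condition `s = -1` cuts out the image of `f`; by `htf`, the condition `t = -1` on that image
becomes the equation defining `V⁺`. The identity `hf` carries the triple product, and `hc` keeps `α`
inside `V⁺`. The maps `h` and `d` allow the parameter of `K`, that of `G`, and the matrix in `α` to
be different functions of `A`. -/
theorem symmetricCase_unitary_entrywise {m M R' R : Type*} [Fintype m] [DecidableEq m] [Fintype M]
    [DecidableEq M] [Ring R'] [Algebra ℝ R'] [NormedRing R] [NormedAlgebra ℝ R]
    [FiniteDimensional ℝ R] (B : Matrix m m R' ≃ₗ[ℝ] Matrix M M R) {A A' : Matrix m m S}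
    {D : Matrix M M R} {d : S → R'} {h : S → S} {s t : R' →ₗ[ℝ] R'} {e f : S →ₗ[ℝ] R'}
    {c tK tV tA : S →ₗ[ℝ] S} {T : Matrix M M R →ₗ[ℝ] Matrix M M R}
    {Vp : Submodule ℝ (Matrix m m S)} {α : Matrix m m S → Matrix m m S}
    {G : Subgroup (Gl D)} {K : Subgroup (Gl A')} {emb : K → Matrix M M R}
    (hB : ∀ X Y, B (X * A.map d * Y) = B X * D * B Y) (hA' : A' = A.map h)
    (hA : adjMap tA A = A) (hV : ∀ X, X ∈ Vp ↔ adjMap tV X = X)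
    (hG : IsUnitaryGroup T G) (hT : ∀ X, T (B X) = B (adjMap t X))
    (hK : IsUnitaryGroup (adjMap tK) K)
    (hemb : ∀ x : K, emb x = B (x.1.val.map e))
    (hα : ∀ X, α X = A * (X * A).map c)
    (hdec : IsEigenDecomposition s e f)
    (he : ∀ x a y, e (x * h a * y) = e x * d a * e y)
    (hs : ∀ x a y, s (x * d a * y) = s x * d a * s y)
    (hte : ∀ x, t (e x) = e (tK x)) (htf : ∀ x, t (f x) = -f (tV x))
    (hf : ∀ x a y b z, f (x * a * c (y * b) * z) = f x * d a * (f y * d b) * f z)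
    (hc : ∀ a x b, tV (a * c (x * b)) = tA b * c (tV x * tA a)) :
    SymmetricCase Vp Vp α G emb := by
  obtain rfl : α = sandwich c A := funext hα
  obtain rfl : emb = fun x : K => entrywise B e x.1.val := funext hemb
  subst hA'
  have h := hdec.entrywise (B := B)
  have hTe : ∀ X, T (entrywise B e X) = entrywise B e (adjMap tK X) := fun X => by
    rw [entrywise_apply, hT]
    exact congrArg B (Matrix.ext fun i j => hte (X j i))
  have hTf : ∀ X, T (entrywise B f X) = -entrywise B f (adjMap tV X) := fun X => by
    rw [entrywise_apply, hT, ← map_neg]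
    exact congrArg B (Matrix.ext fun i j => (htf (X j i)).trans (map_neg f _).symm)
  refine symmetricCase_unitary (s := entrywiseEnd B s) (e := entrywise B e) (Φ := entrywise B f)
    hG (entrywiseEnd_mul_mul hB hs) h.involutive (h.comm hTe hTf) hK (entrywise_mul_mul hB he)
    h.left_injective hTe h.map_left h.exists_left
    ⟨fun X hX => ?_, h.right_injective, fun X => ?_, fun V hV => h.exists_right V hV.2,
      fun X _ Y _ Z _ => entrywise_T hB hf X Y Z⟩
  · rw [hV] at hX ⊢
    exact adjMap_sandwich hc hX hA
  · rw [hV]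
    change _ ↔ T _ = _ ∧ _
    rw [hTf, neg_inj, h.right_injective.eq_iff]
    exact ⟨fun hX => ⟨hX, h.map_right X⟩, fun hX => hX.1⟩

/-- No eigenspace is needed here: the bijection `f`, such as multiplication by `i` or `j`,
identifies `V⁺` with the whole Lie algebra of `G`. -/
theorem groupCase_unitary_entrywise {m : Type*} [Fintype m] [DecidableEq m] {A : Matrix m m S}
    {t f c tV tA : S →ₗ[ℝ] S}
    {Vp : Submodule ℝ (Matrix m m S)} {α : Matrix m m S → Matrix m m S} {G : Subgroup (Gl A)}
    (hA : adjMap tA A = A) (hV : ∀ X, X ∈ Vp ↔ adjMap tV X = X)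
    (hG : IsUnitaryGroup (adjMap t) G)
    (hα : ∀ X, α X = A * (X * A).map c)
    (hbij : Function.Bijective f)
    (htf : ∀ x, t (f x) = -f (tV x))
    (hf : ∀ x a y b z, f (x * a * c (y * b) * z) = f x * a * (f y * b) * f z)
    (hc : ∀ a x b, tV (a * c (x * b)) = tA b * c (tV x * tA a)) :
    GroupCase Vp Vp α G := by
  obtain rfl : α = sandwich c A := funext hα
  let B : Matrix m m S ≃ₗ[ℝ] Matrix m m S := LinearEquiv.refl ℝ _
  have hB : ∀ X Y, B (X * A.map id * Y) = B X * A * B Y := fun X Y => by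
    rw [Matrix.map_id]
    rfl
  have hTf : ∀ X, adjMap t (entrywise B f X) = -entrywise B f (adjMap tV X) := fun X =>
    Matrix.ext fun i j => htf (X j i)
  refine groupCase_unitary (Φ := entrywise B f) hG
    ⟨fun X hX => ?_, entrywise_injective hbij.1, fun X => ?_, fun V _ => ?_,
      fun X _ Y _ Z _ => entrywise_T hB hf X Y Z⟩
  · rw [hV] at hX ⊢
    exact adjMap_sandwich hc hX hA
  · rw [hV]
    change _ ↔ adjMap t _ = _
    rw [hTf, neg_inj, (entrywise_injective hbij.1).eq_iff]
  · choose g hg using hbij.2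
    exact ⟨V.map g, Matrix.ext fun i j => hg (V i j)⟩

theorem symmetricCase_top_of_unitary_entrywise {m : Type*} [Fintype m] [DecidableEq m]
    {A : Matrix m m S} {t tA : S →ₗ[ℝ] S}
    {Vp : Submodule ℝ (Matrix m m S)} {α : Matrix m m S → Matrix m m S} {K : Subgroup (Gl A)}
    (hA : adjMap tA A = A) (hV : ∀ X, X ∈ Vp ↔ adjMap t X = X)
    (hK : IsUnitaryGroup (adjMap t) K)
    (hα : ∀ X, α X = A * X * A)
    (hc : ∀ a x b, t (a * (x * b)) = tA b * (t x * tA a)) :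
    SymmetricCase Vp Vp α (⊤ : Subgroup (Gl A)) (fun x : K => x.1.val) := by
  obtain rfl : α = sandwich LinearMap.id A := funext fun X => by
    rw [hα, sandwich_apply, LinearMap.id_coe, Matrix.map_id, Matrix.mul_assoc]
  let B : Matrix m m S ≃ₗ[ℝ] Matrix m m S := LinearEquiv.refl ℝ _
  have hB : ∀ X Y, B (X * A.map id * Y) = B X * A * B Y := fun X Y => by
    rw [Matrix.map_id]
    rfl
  refine symmetricCase_top_of_unitary (Φ := entrywise B LinearMap.id) hK
    ⟨fun X hX => ?_, entrywise_injective Function.injective_id, hV, fun V _ => ⟨V, rfl⟩,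
      fun X _ Y _ Z _ => entrywise_T hB (fun x a y b z => ?_) X Y Z⟩
  · rw [hV] at hX ⊢
    exact adjMap_sandwich hc hX hA
  · simp only [LinearMap.id_coe, id_eq, mul_assoc]

theorem groupCase_top_entrywise {m n : Type*} [Fintype m] [Fintype n] [DecidableEq n]
    (A : Matrix n m S) :
    GroupCase ⊤ ⊤ (fun X : Matrix m n S => A * X * A) (⊤ : Subgroup (Gl A)) := by
  have h : (fun X : Matrix m n S => A * X * A) = sandwich LinearMap.id A := funext fun X => by
    rw [sandwich_apply, LinearMap.id_coe, Matrix.map_id, Matrix.mul_assoc]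
  rw [h]
  let B : Matrix m n S ≃ₗ[ℝ] Matrix m n S := LinearEquiv.refl ℝ _
  have hB : ∀ X Y, B (X * A.map id * Y) = B X * A * B Y := fun X Y => by
    rw [Matrix.map_id]
    rfl
  refine groupCase_top (Φ := entrywise B LinearMap.id)
    ⟨fun _ _ => trivial, entrywise_injective Function.injective_id, fun X => Iff.rfl,
      fun V _ => ⟨V, rfl⟩, fun X _ Y _ Z _ => entrywise_T hB (fun x a y b z => ?_) X Y Z⟩
  simp only [LinearMap.id_coe, id_eq, mul_assoc]

end EntrywiseCases

end Homotope
end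

noncomputable section

namespace Homotope

set_option linter.unusedSectionVars false

/-! ### Unitary and symplectic groups -/

namespace RealInvolution

section

variable {m R : Type*} [Fintype m] [DecidableEq m] [NormedRing R] [NormedAlgebra ℝ R]
  [FiniteDimensional ℝ R] (δ : RealInvolution R) {A : Matrix m m R}

/-- The defining equation says that `X*` is a left quasi-inverse of `X`, hence equal to `X⁻¹`. -/
theorem isUnitaryGroup_U (hA : A ∈ δ.Herm m) :
    IsUnitaryGroup (adjMap δ.toLinearMap) (δ.U hA) where
  map_mul X Y := by
    change δ.adj (X * A * Y) = δ.adj Y * A * δ.adj X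
    rw [adj_mul, adj_mul, show δ.adj A = A from hA, Matrix.mul_assoc]
  involutive := δ.adj_adj
  mem_iff X := by
    change δ.adj X.val + X.val = δ.adj X.val * A * X.val ↔ _ = δ.adj X.val
    refine ⟨inv_aux, fun h => ?_⟩
    rw [← h, ← sub_eq_zero]
    exact Gl.val_inv_add_val X

/-- For skew-Hermitian `A` it is `X ↦ -X*` that reverses the products `X A Y`, and the defining
equation says `X⁻¹ = -X*`. -/
theorem isUnitaryGroup_Sp (hA : A ∈ δ.Aherm m) :
    IsUnitaryGroup (adjMap (-δ.toLinearMap)) (δ.Sp hA) where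
  map_mul X Y := by
    have h : ∀ X : Matrix m m R, adjMap (-δ.toLinearMap) X = -δ.adj X := fun _ => rfl
    rw [h, h, h, adj_mul, adj_mul, show δ.adj A = -A from hA]
    simp only [Matrix.mul_neg, Matrix.neg_mul, Matrix.mul_assoc, neg_neg]
  involutive X := by
    have h : ∀ X : Matrix m m R, adjMap (-δ.toLinearMap) X = -δ.adj X := fun _ => rfl
    rw [h, h, adj_neg, adj_adj, neg_neg]
  mem_iff X := by
    change δ.adj X.val - X.val = δ.adj X.val * A * X.val ↔ _ = -δ.adj X.val
    rw [sp_aux]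
    refine ⟨inv_aux, fun h => ?_⟩
    rw [← h, ← sub_eq_zero]
    exact Gl.val_inv_add_val X

theorem mem_Herm_iff (X : Matrix m m R) :
    X ∈ δ.Herm m ↔ adjMap δ.toLinearMap X = X := Iff.rfl

theorem mem_Aherm_iff (X : Matrix m m R) :
    X ∈ δ.Aherm m ↔ adjMap (-δ.toLinearMap) X = X := by
  change δ.adj X = -X ↔ -δ.adj X = X
  rw [neg_eq_iff_eq_neg]

end

end RealInvolution

/-! ### Grassmannians -/

section Grassmannian

open RealInvolution

variable {m n R : Type*} [Fintype m] [Fintype n] [DecidableEq m] [DecidableEq n] [NormedRing R]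
  [NormedAlgebra ℝ R] [FiniteDimensional ℝ R] {A : Matrix m m R} {B : Matrix n n R}

/-- The automorphism of the block matrices that changes the sign of the off-diagonal blocks. -/
def blockSign (m n R : Type*) [Ring R] [Algebra ℝ R] :
    Matrix (m ⊕ n) (m ⊕ n) R →ₗ[ℝ] Matrix (m ⊕ n) (m ⊕ n) R where
  toFun X := Matrix.fromBlocks X.toBlocks₁₁ (-X.toBlocks₁₂) (-X.toBlocks₂₁) X.toBlocks₂₂
  map_add' X Y := by
    rw [Matrix.fromBlocks_add, ← neg_add, ← neg_add]
    rfl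
  map_smul' c X := by
    rw [RingHom.id_apply, Matrix.fromBlocks_smul, smul_neg, smul_neg]
    rfl

theorem blockSign_fromBlocks (X₁ : Matrix m m R) (X₂ : Matrix m n R) (X₃ : Matrix n m R)
    (X₄ : Matrix n n R) : blockSign m n R (Matrix.fromBlocks X₁ X₂ X₃ X₄) =
      Matrix.fromBlocks X₁ (-X₂) (-X₃) X₄ := rfl

/-- The map is conjugation by `diag(1, -1)`, which commutes with `diag(A, B)`. -/
theorem blockSign_mul_mul (X Y : Matrix (m ⊕ n) (m ⊕ n) R) :
    blockSign m n R (X * Matrix.fromBlocks A 0 0 B * Y) =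
      blockSign m n R X * Matrix.fromBlocks A 0 0 B * blockSign m n R Y := by
  rw [← Matrix.fromBlocks_toBlocks X, ← Matrix.fromBlocks_toBlocks Y]
  simp only [Matrix.fromBlocks_multiply, blockSign_fromBlocks, Matrix.mul_zero, add_zero, zero_add,
    Matrix.neg_mul, Matrix.mul_neg, neg_neg, neg_add]

theorem blockSign_blockSign (X : Matrix (m ⊕ n) (m ⊕ n) R) :
    blockSign m n R (blockSign m n R X) = X := by
  rw [← Matrix.fromBlocks_toBlocks X]
  simp only [blockSign_fromBlocks, neg_neg]

theorem eq_fromBlocks_of_blockSign_eq {X : Matrix (m ⊕ n) (m ⊕ n) R}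
    (h : blockSign m n R X = X) : X = Matrix.fromBlocks X.toBlocks₁₁ 0 0 X.toBlocks₂₂ := by
  rw [← Matrix.fromBlocks_toBlocks X, blockSign_fromBlocks, Matrix.fromBlocks_inj] at h
  conv_lhs => rw [← Matrix.fromBlocks_toBlocks X]
  rw [eq_zero_of_neg_eq_self h.2.1, eq_zero_of_neg_eq_self h.2.2.1]

theorem eq_fromBlocks_of_blockSign_eq_neg {X : Matrix (m ⊕ n) (m ⊕ n) R}
    (h : blockSign m n R X = -X) : X = Matrix.fromBlocks 0 X.toBlocks₁₂ X.toBlocks₂₁ 0 := by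
  rw [← Matrix.fromBlocks_toBlocks X, blockSign_fromBlocks, Matrix.fromBlocks_neg,
    Matrix.fromBlocks_inj] at h
  conv_lhs => rw [← Matrix.fromBlocks_toBlocks X]
  rw [eq_zero_of_neg_eq_self h.1.symm, eq_zero_of_neg_eq_self h.2.2.2.symm]

/-- The matrix `(0, X; -t(X)ᵗ, 0)`. -/
def offDiagonal (m n : Type*) (t : R →ₗ[ℝ] R) :
    Matrix m n R →ₗ[ℝ] Matrix (m ⊕ n) (m ⊕ n) R where
  toFun X := Matrix.fromBlocks 0 X (-adjMap t X) 0
  map_add' X Y := by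
    rw [Matrix.fromBlocks_add, map_add, neg_add, add_zero, add_zero]
  map_smul' c X := by
    rw [RingHom.id_apply, Matrix.fromBlocks_smul, map_smul, smul_neg, smul_zero, smul_zero]

theorem offDiagonal_apply (t : R →ₗ[ℝ] R) (X : Matrix m n R) :
    offDiagonal m n t X = Matrix.fromBlocks 0 X (-adjMap t X) 0 := rfl

theorem adjMap_fromBlocks (t : R →ₗ[ℝ] R) (X₁ : Matrix m m R) (X₂ : Matrix m n R)
    (X₃ : Matrix n m R) (X₄ : Matrix n n R) : adjMap t (Matrix.fromBlocks X₁ X₂ X₃ X₄) =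
      Matrix.fromBlocks (adjMap t X₁) (adjMap t X₃) (adjMap t X₂) (adjMap t X₄) := by
  rw [adjMap_apply, Matrix.fromBlocks_map, Matrix.fromBlocks_transpose]
  rfl

theorem fromBlocks_sub (X X' : Matrix m m R) (Y Y' : Matrix n n R) :
    Matrix.fromBlocks X 0 0 Y - Matrix.fromBlocks X' 0 0 Y' =
      Matrix.fromBlocks (X - X') 0 0 (Y - Y') := by
  rw [sub_eq_add_neg, Matrix.fromBlocks_neg, Matrix.fromBlocks_add]
  simp only [neg_zero, add_zero, ← sub_eq_add_neg]

/-- The product of `Gl(A)` and `Gl(B)` as a subgroup of `Gl(diag(A, B))`. -/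
def diagHom (A : Matrix m m R) (B : Matrix n n R) :
    Gl A × Gl B →* Gl (Matrix.fromBlocks A 0 0 B) where
  toFun x := ⟨Matrix.fromBlocks x.1.val 0 0 x.2.val, Gl.isUnit_of_quasiInverse
    (Y := Matrix.fromBlocks (x.1⁻¹).val 0 0 (x.2⁻¹).val)
    (by simp [Matrix.fromBlocks_multiply, Matrix.fromBlocks_add, fromBlocks_sub,
          Gl.val_add_val_inv])
    (by simp [Matrix.fromBlocks_multiply, Matrix.fromBlocks_add, fromBlocks_sub,
          Gl.val_inv_add_val])⟩
  map_one' := Gl.ext Matrix.fromBlocks_zero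
  map_mul' x y := Gl.ext (by
    simp [Matrix.fromBlocks_multiply, Matrix.fromBlocks_add, fromBlocks_sub, Gl.val_mul])

theorem isEmbedding_diagHom : Topology.IsEmbedding (diagHom A B) := by
  let L : (m → m → R) × (n → n → R) →ₗ[ℝ] (m ⊕ n → m ⊕ n → R) :=
    { toFun := fun x => Matrix.of.symm (Matrix.fromBlocks (Matrix.of x.1) 0 0 (Matrix.of x.2))
      map_add' := fun x y => Matrix.of.injective
        (by simp [Matrix.fromBlocks_add] : Matrix.fromBlocks (Matrix.of (x.1 + y.1)) 0 0
          (Matrix.of (x.2 + y.2)) = Matrix.fromBlocks (Matrix.of x.1) 0 0 (Matrix.of x.2) +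
            Matrix.fromBlocks (Matrix.of y.1) 0 0 (Matrix.of y.2))
      map_smul' := fun c x => Matrix.of.injective
        (by simp [Matrix.fromBlocks_smul] : Matrix.fromBlocks (Matrix.of (c • x.1)) 0 0
          (Matrix.of (c • x.2)) = c • Matrix.fromBlocks (Matrix.of x.1) 0 0 (Matrix.of x.2)) }
  have hL : Function.Injective L := fun x y h => by
    have h1 := Matrix.fromBlocks_inj.1 (Matrix.of.symm.injective h)
    exact Prod.ext (Matrix.of.injective h1.1) (Matrix.of.injective h1.2.2.2)
  have h1 : Topology.IsEmbedding (L.toContinuousLinearMap) :=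
    (LinearMap.isClosedEmbedding_of_injective (f := L) (LinearMap.ker_eq_bot.2 hL)).isEmbedding
  have h2 : Topology.IsEmbedding (Gl.coord ∘ diagHom A B) :=
    h1.comp ((Gl.isOpenEmbedding_coord (A := A)).isEmbedding.prodMap
      (Gl.isOpenEmbedding_coord (A := B)).isEmbedding)
  exact Topology.IsEmbedding.of_comp
    (Gl.isOpenEmbedding_coord.isInducing.continuous_iff.2 h2.continuous)
    Gl.isOpenEmbedding_coord.continuous h2

/-- With `X` and its inverse both block diagonal, the quasi-inverse equations split into those of
the two diagonal blocks. -/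
theorem exists_diagHom_eq {X : Gl (Matrix.fromBlocks A 0 0 B)}
    (h : blockSign m n R X.val = X.val) (h' : blockSign m n R (X⁻¹).val = (X⁻¹).val) :
    ∃ x, diagHom A B x = X := by
  have h1 := eq_fromBlocks_of_blockSign_eq h
  have h2 := eq_fromBlocks_of_blockSign_eq h'
  have h3 := Gl.val_add_val_inv X
  have h4 := Gl.val_inv_add_val X
  rw [h1, h2] at h3 h4
  simp only [Matrix.fromBlocks_multiply, Matrix.fromBlocks_add, sub_eq_add_neg,
      Matrix.fromBlocks_neg,
    ← Matrix.fromBlocks_zero, Matrix.fromBlocks_inj, Matrix.mul_zero, Matrix.zero_mul, add_zero,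
    zero_add] at h3 h4
  simp only [← sub_eq_add_neg] at h3 h4
  refine ⟨(⟨X.val.toBlocks₁₁, Gl.isUnit_of_quasiInverse h3.1 h4.1⟩,
    ⟨X.val.toBlocks₂₂, Gl.isUnit_of_quasiInverse h3.2.2.2 h4.2.2.2⟩), Gl.ext h1.symm⟩

/-- The unitary and the symplectic case are treated together: `t` is `δ` or `-δ`, and `ht` records
the net effect of the signs of `A`, `B` and `t`. The upper right block of `Φ X D Φ Y D Φ Z` is `-X B
t(Y) A Z`, which dictates `α`. -/
theorem symmetricCase_grassmannian {t : R →ₗ[ℝ] R} {α : Matrix m n R → Matrix n m R}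
    {G : Subgroup (Gl (Matrix.fromBlocks A 0 0 B))} {K : Subgroup (Gl A)} {L : Subgroup (Gl B)}
    (hG : IsUnitaryGroup (adjMap t) G) (hK : IsUnitaryGroup (adjMap t) K)
    (hL : IsUnitaryGroup (adjMap t) L) (htt : ∀ x, t (t x) = x)
    (ht : ∀ X Y Z : Matrix m n R, adjMap t (X * B * adjMap t Y * A * Z) =
      adjMap t Z * A * Y * B * adjMap t X)
    (hα : ∀ X, α X = -(B * adjMap t X * A)) :
    SymmetricCase ⊤ ⊤ α G (fun x : K × L => Matrix.fromBlocks x.1.1.val 0 0 x.2.1.val) := by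
  let α' : Matrix m n R →ₗ[ℝ] Matrix n m R :=
    { toFun := fun X => -(B * adjMap t X * A)
      map_add' := fun X Y => by
        rw [map_add, Matrix.mul_add, Matrix.add_mul, neg_add]
      map_smul' := fun c X => by
        rw [map_smul, Matrix.mul_smul, Matrix.smul_mul, smul_neg, RingHom.id_apply] }
  obtain rfl : α = α' := funext hα
  have htt' : ∀ X : Matrix m n R, adjMap t (adjMap t X) = X := fun X =>
    Matrix.ext fun i j => htt (X i j)
  have hmem : ∀ x : Gl A × Gl B, diagHom A B x ∈ G ↔ x.1 ∈ K ∧ x.2 ∈ L := fun x => by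
    rw [hG.mem_iff, hK.mem_iff, hL.mem_iff, ← map_inv]
    change Matrix.fromBlocks (x.1⁻¹).val 0 0 (x.2⁻¹).val =
      adjMap t (Matrix.fromBlocks x.1.val 0 0 x.2.val) ↔ _
    rw [adjMap_fromBlocks, Matrix.fromBlocks_inj, map_zero, map_zero]
    simp only [true_and]
  refine symmetricCase_of_isRealization (Φ := offDiagonal m n t)
    (σ := Gl.map (blockSign m n R) blockSign_mul_mul)
    (ι := (diagHom A B).comp (K.subtype.prodMap L.subtype))
    (Gl.hasDifferential_antiInv _ hG.map_mul)
    hG.mem_iff_antiInv (Gl.hasDifferential_map _ blockSign_mul_mul)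
    (fun X => Gl.ext (blockSign_blockSign _)) (fun X hX => ?_)
    (isEmbedding_diagHom.comp
      (Topology.IsEmbedding.subtypeVal.prodMap Topology.IsEmbedding.subtypeVal)) (fun _ => rfl)
    (fun x => (hmem _).2 ⟨x.1.2, x.2.2⟩) (fun x => Gl.ext ?_) (fun X hX hX' => ?_)
    ⟨fun _ _ => trivial, fun X Y h => (Matrix.fromBlocks_inj.1 h).2.1, fun X => ?_, ?_, ?_⟩
  · rw [hG.mem_iff] at hX ⊢
    rw [← map_inv, Gl.val_map, Gl.val_map, hX]
    generalize X.val = Y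
    rw [← Matrix.fromBlocks_toBlocks Y]
    simp only [adjMap_fromBlocks, blockSign_fromBlocks, map_neg]
  · change blockSign m n R (Matrix.fromBlocks _ 0 0 _) = Matrix.fromBlocks _ 0 0 _
    rw [blockSign_fromBlocks, neg_zero, neg_zero]
  · have h1 : Gl.map (blockSign m n R) blockSign_mul_mul X⁻¹ = X⁻¹ := by rw [map_inv, hX']
    obtain ⟨x, rfl⟩ := exists_diagHom_eq (congrArg Gl.val hX') (congrArg Gl.val h1)
    exact ⟨(⟨x.1, ((hmem x).1 hX).1⟩, ⟨x.2, ((hmem x).1 hX).2⟩), rfl⟩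
  · refine ⟨fun _ => ⟨?_, ?_⟩, fun _ => trivial⟩
    · rw [LinearMap.neg_apply, offDiagonal_apply, adjMap_fromBlocks, Matrix.fromBlocks_neg,
        map_neg, htt', map_zero, map_zero, neg_zero, neg_neg, neg_zero]
    · rw [offDiagonal_apply, blockSign_fromBlocks, Matrix.fromBlocks_neg, neg_zero, neg_zero]
  · rintro V ⟨hV, hV'⟩
    have h1 := eq_fromBlocks_of_blockSign_eq_neg hV'
    refine ⟨V.toBlocks₁₂, ?_⟩
    rw [h1, LinearMap.neg_apply, adjMap_fromBlocks, Matrix.fromBlocks_neg,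
      Matrix.fromBlocks_inj] at hV
    rw [offDiagonal_apply, hV.2.2.1, ← h1]
  · rintro X - Y - Z -
    have hY : α' Y = -(B * adjMap t Y * A) := rfl
    simp only [T, hY, offDiagonal_apply, map_add, Matrix.fromBlocks_multiply, Matrix.fromBlocks_add,
      Matrix.mul_neg, Matrix.neg_mul, map_neg, ← Matrix.mul_assoc, ht, Matrix.mul_zero,
      Matrix.zero_mul, add_zero, zero_add, neg_neg, neg_zero, Matrix.fromBlocks_neg]
    -- In the lower left block, reversing the products interchanges `X` and `Z`; only the
    -- symmetrized product matches.
    rw [add_comm (adjMap t Z * A * Y * B * adjMap t X)]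

theorem symmetricCase_grassmannian_U (δ : RealInvolution R) (hA : A ∈ δ.Herm m)
    (hB : B ∈ δ.Herm n) :
    SymmetricCase ⊤ ⊤ (fun X : Matrix m n R => -(B * δ.adj X * A))
      (δ.U (fromBlocks_mem_Herm hA hB))
      (fun x : δ.U hA × δ.U hB => Matrix.fromBlocks x.1.1.val 0 0 x.2.1.val) := by
  refine symmetricCase_grassmannian (δ.isUnitaryGroup_U _) (δ.isUnitaryGroup_U _)
    (δ.isUnitaryGroup_U _) δ.involutive' (fun X Y Z => ?_) (fun X => rfl)
  change δ.adj (X * B * δ.adj Y * A * Z) = δ.adj Z * A * Y * B * δ.adj X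
  simp only [adj_mul, adj_adj, show δ.adj A = A from hA, show δ.adj B = B from hB,
    Matrix.mul_assoc]

theorem symmetricCase_grassmannian_Sp (δ : RealInvolution R) (hA : A ∈ δ.Aherm m)
    (hB : B ∈ δ.Aherm n) :
    SymmetricCase ⊤ ⊤ (fun X : Matrix m n R => B * δ.adj X * A)
      (δ.Sp (fromBlocks_mem_Aherm hA hB))
      (fun x : δ.Sp hA × δ.Sp hB => Matrix.fromBlocks x.1.1.val 0 0 x.2.1.val) := by
  refine symmetricCase_grassmannian (δ.isUnitaryGroup_Sp _) (δ.isUnitaryGroup_Sp _)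
    (δ.isUnitaryGroup_Sp _) (fun x => ?_) (fun X Y Z => ?_) (fun X => ?_)
  · simpa using δ.involutive' x
  · change -δ.adj (X * B * -δ.adj Y * A * Z) = -δ.adj Z * A * Y * B * -δ.adj X
    simp only [adj_mul, adj_neg, adj_adj, show δ.adj A = -A from hA, show δ.adj B = -B from hB,
      Matrix.mul_assoc, Matrix.neg_mul, Matrix.mul_neg, neg_neg]
  · change B * δ.adj X * A = -(B * -δ.adj X * A)
    rw [Matrix.mul_neg, Matrix.neg_mul, neg_neg]

end Grassmannian

end Homotope
end

noncomputable section

namespace Homotope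

set_option linter.unusedSectionVars false

theorem neg_mul_mul_eq {p q S : Type*} [Fintype p] [Fintype q] [Ring S] [Algebra ℝ S]
    (A : Matrix p q S) (X : Matrix q p S) :
    -(A * X * A) = A * (X * A).map (-LinearMap.id : S →ₗ[ℝ] S) := by
  rw [Matrix.mul_assoc, ← Matrix.mul_neg]
  rfl

theorem neg_mul_map_eq {p q S : Type*} [Fintype q] [Ring S] [Algebra ℝ S]
    (A : Matrix p q S) (X : Matrix q q S) (c : S →ₗ[ℝ] S) :
    -(A * X.map c) = A * X.map (-c) := by
  rw [← Matrix.mul_neg]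
  rfl

/-! ### The coefficient algebras `𝕜[i]` -/

section AdjoinI

variable {𝕜 : Type*} [RCLike 𝕜] {m n : Type*} [Fintype m] [Fintype n] [DecidableEq m]
  [DecidableEq n]

namespace AdjI

/-- The embedding of `𝕜` into `𝕜[i]`. -/
def ofBase (𝕜 : Type*) [RCLike 𝕜] : 𝕜 →ₗ[ℝ] AdjI 𝕜 where
  toFun := algebraMap 𝕜 (AdjI 𝕜)
  map_add' := map_add _
  map_smul' c x := by ext <;> simp

/-- The map `x ↦ x i`. -/
def mulI (𝕜 : Type*) [RCLike 𝕜] : 𝕜 →ₗ[ℝ] AdjI 𝕜 where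
  toFun x := ⟨0, x⟩
  map_add' x y := by ext <;> simp
  map_smul' c x := by ext <;> simp

theorem re_ofBase (x : 𝕜) : (ofBase 𝕜 x).re = x := by simp [ofBase]
theorem im_ofBase (x : 𝕜) : (ofBase 𝕜 x).im = 0 := by simp [ofBase]
theorem re_mulI (x : 𝕜) : (mulI 𝕜 x).re = 0 := rfl
theorem im_mulI (x : 𝕜) : (mulI 𝕜 x).im = x := rfl
theorem re_starInv (x : AdjI 𝕜) : ((starInv (AdjI 𝕜)).toLinearMap x).re = x.re := by
  change (star x).re = _
  simp
theorem im_starInv (x : AdjI 𝕜) : ((starInv (AdjI 𝕜)).toLinearMap x).im = -x.im := by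
  change (star x).im = _
  simp

theorem isEigenDecomposition :
    IsEigenDecomposition (starInv (AdjI 𝕜)).toLinearMap (ofBase 𝕜) (mulI 𝕜) where
  left_injective x y h := by simpa [re_ofBase] using congrArg QuadraticAlgebra.re h
  right_injective x y h := congrArg QuadraticAlgebra.im h
  map_left x := by ext <;> simp [re_starInv, im_starInv, re_ofBase, im_ofBase]
  map_right x := by ext <;> simp [re_starInv, im_starInv, re_mulI, im_mulI]
  exists_add r := ⟨r.re, r.im, by ext <;> simp [re_ofBase, im_ofBase, re_mulI, im_mulI]⟩

theorem ofBase_mul_mul (x a y : 𝕜) :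
    ofBase 𝕜 (x * a * y) = ofBase 𝕜 x * ofBase 𝕜 a * ofBase 𝕜 y := by
  change algebraMap 𝕜 (AdjI 𝕜) _ = _
  rw [map_mul, map_mul]
  rfl

theorem starInv_mul_mul (x : AdjI 𝕜) (a : 𝕜) (y : AdjI 𝕜) :
    (starInv (AdjI 𝕜)).toLinearMap (x * ofBase 𝕜 a * y) =
      (starInv (AdjI 𝕜)).toLinearMap x * ofBase 𝕜 a * (starInv (AdjI 𝕜)).toLinearMap y := by
  ext
  · simp [re_starInv, im_starInv, re_ofBase, im_ofBase]
  · simp [re_starInv, im_starInv, re_ofBase, im_ofBase]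
    ring

/-- The sign of `α` comes from `i³ = -i`. -/
theorem mulI_mul (x a y b z : 𝕜) : mulI 𝕜 (x * a * (-LinearMap.id : 𝕜 →ₗ[ℝ] 𝕜) (y * b) * z) =
    mulI 𝕜 x * ofBase 𝕜 a * (mulI 𝕜 y * ofBase 𝕜 b) * mulI 𝕜 z := by
  ext <;> simp [re_mulI, im_mulI, re_ofBase, im_ofBase]

theorem symmetricCase_top (A : Matrix n m 𝕜) :
    SymmetricCase ⊤ ⊤ (fun X : Matrix m n 𝕜 => -(A * X * A))
      (⊤ : Subgroup (Gl (A.map (algebraMap 𝕜 (AdjI 𝕜)))))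
      (fun h : Gl A => h.val.map (algebraMap 𝕜 (AdjI 𝕜))) :=
  symmetricCase_top_entrywise A isEigenDecomposition ofBase_mul_mul starInv_mul_mul mulI_mul
    (neg_mul_mul_eq A)

/-- The four symmetric spaces of unitary groups over `𝕜[i]`, modulo unitary groups over `𝕜`. -/
theorem symmetricCase_unitary {A : Matrix m m 𝕜} {t : AdjI 𝕜 →ₗ[ℝ] AdjI 𝕜} {tK tV tA : 𝕜 →ₗ[ℝ] 𝕜}
    {Vp : Submodule ℝ (Matrix m m 𝕜)} {G : Subgroup (Gl (A.map (algebraMap 𝕜 (AdjI 𝕜))))}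
    {K : Subgroup (Gl A)} (hA : adjMap tA A = A)
    (hV : ∀ X, X ∈ Vp ↔ adjMap tV X = X)
    (hG : IsUnitaryGroup (adjMap t) G) (hK : IsUnitaryGroup (adjMap tK) K)
    (htV : (∀ x, tV x = x) ∨ ∀ x, tV x = -x)
    (htA : (∀ x, tA x = x) ∨ ∀ x, tA x = -x)
    (hte : ∀ x, t (ofBase 𝕜 x) = ofBase 𝕜 (tK x)) (htf : ∀ x, t (mulI 𝕜 x) = -mulI 𝕜 (tV x)) :
    SymmetricCase Vp Vp (fun X => -(A * X * A)) G
      (fun h : K => h.1.val.map (algebraMap 𝕜 (AdjI 𝕜))) := by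
  have hcomm : ∀ a x b : 𝕜, a * (x * b) = b * (x * a) := fun a x b => by ring
  refine symmetricCase_unitary_entrywise (LinearEquiv.refl ℝ _) (fun _ _ => rfl)
    (Matrix.map_id _).symm hA hV hG (fun _ => rfl) hK (fun _ => rfl) (neg_mul_mul_eq A)
    isEigenDecomposition ofBase_mul_mul starInv_mul_mul hte htf mulI_mul (fun a x b => ?_)
  -- The sign of `tA` occurs twice and cancels; that of `tV` occurs once on each side.
  rcases htV with h | h <;> rcases htA with h' | h' <;> simp [h, h', hcomm a x b]

end AdjI

end AdjoinI

end Homotope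
end

noncomputable section

namespace Homotope

set_option linter.unusedSectionVars false

/-! ### Quaternionic coefficients -/

section Quaternion

variable {m n : Type*} [Fintype m] [Fintype n] [DecidableEq m] [DecidableEq n]

/-- The quaternion with given components. -/
def quat (a b c d : ℝ) : ℍ[ℝ] := ⟨a, b, c, d⟩

@[simp] theorem re_quat (a b c d : ℝ) : (quat a b c d).re = a := rfl
@[simp] theorem imI_quat (a b c d : ℝ) : (quat a b c d).imI = b := rfl
@[simp] theorem imJ_quat (a b c d : ℝ) : (quat a b c d).imJ = c := rfl
@[simp] theorem imK_quat (a b c d : ℝ) : (quat a b c d).imK = d := rfl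

theorem quat_inj {a b c d a' b' c' d' : ℝ} :
    quat a b c d = quat a' b' c' d' ↔ a = a' ∧ b = b' ∧ c = c' ∧ d = d' := by
  rw [Quaternion.ext_iff]
  rfl

theorem complexJ_eq (z : ℂ) : complexJ z = quat z.re 0 z.im 0 := rfl

/-- The embedding of `ℂ` into `ℍ`. -/
def quatOfComplex : ℂ →ₗ[ℝ] ℍ[ℝ] where
  toFun z := z
  map_add' x y := by ext <;> simp
  map_smul' c x := by ext <;> simp

/-- The embedding of `ℂ = ℝ[j]` into `ℍ`. -/
def complexJLinear : ℂ →ₗ[ℝ] ℍ[ℝ] where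
  toFun := complexJ
  map_add' x y := by ext <;> simp [complexJ_eq]
  map_smul' c x := by ext <;> simp [complexJ_eq]

/-- The map `z ↦ j z`. -/
def quatJMul : ℂ →ₗ[ℝ] ℍ[ℝ] where
  toFun z := quat 0 0 z.re (-z.im)
  map_add' x y := by ext <;> simp [add_comm]
  map_smul' c x := by ext <;> simp

/-- The map `x + i y ↦ i (x + j y)`. -/
def quatIMulJ : ℂ →ₗ[ℝ] ℍ[ℝ] where
  toFun z := quat 0 z.re 0 z.im
  map_add' x y := by ext <;> simp
  map_smul' c x := by ext <;> simp

/-- The map `z ↦ -z j`. -/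
def quatNegMulJ : ℂ →ₗ[ℝ] ℍ[ℝ] where
  toFun z := -((z : ℍ[ℝ]) * qj)
  map_add' x y := by ext <;> simp [re_qj, imI_qj, imJ_qj, imK_qj, add_comm]
  map_smul' c x := by ext <;> simp [re_qj, imI_qj, imJ_qj, imK_qj]

/-- The map `z ↦ i z̄`. -/
def quatIMulConj : ℂ →ₗ[ℝ] ℍ[ℝ] where
  toFun z := quat z.im z.re 0 0
  map_add' x y := by ext <;> simp
  map_smul' c x := by ext <;> simp

/-- The automorphism `x ↦ i x i⁻¹` of `ℍ`. -/
def quatConjI : ℍ[ℝ] →ₗ[ℝ] ℍ[ℝ] where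
  toFun x := quat x.re x.imI (-x.imJ) (-x.imK)
  map_add' x y := by ext <;> simp [add_comm]
  map_smul' c x := by ext <;> simp

/-- The automorphism `x ↦ j x j⁻¹` of `ℍ`, as a linear map. -/
def quatConjJ : ℍ[ℝ] →ₗ[ℝ] ℍ[ℝ] where
  toFun := conjJ
  map_add' x y := by simp [conjJ, mul_add, add_mul]
  map_smul' c x := by simp [conjJ]

theorem coeComplex_eq (z : ℂ) : (z : ℍ[ℝ]) = quat z.re z.im 0 0 := rfl
theorem quatOfComplex_apply (z : ℂ) : quatOfComplex z = quat z.re z.im 0 0 := rfl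
theorem complexJLinear_apply (z : ℂ) : complexJLinear z = quat z.re 0 z.im 0 := rfl
theorem quatJMul_apply (z : ℂ) : quatJMul z = quat 0 0 z.re (-z.im) := rfl
theorem quatIMulJ_apply (z : ℂ) : quatIMulJ z = quat 0 z.re 0 z.im := rfl
theorem quatIMulConj_apply (z : ℂ) : quatIMulConj z = quat z.im z.re 0 0 := rfl
theorem quatConjI_apply (x : ℍ[ℝ]) : quatConjI x = quat x.re x.imI (-x.imJ) (-x.imK) := rfl
theorem quatConjJ_apply (x : ℍ[ℝ]) : quatConjJ x = quat x.re (-x.imI) x.imJ (-x.imK) := by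
  change conjJ x = _
  ext
  · exact re_conjJ x
  · exact imI_conjJ x
  · exact imJ_conjJ x
  · exact imK_conjJ x
theorem quatNegMulJ_apply (z : ℂ) : quatNegMulJ z = quat 0 0 (-z.re) (-z.im) := by
  change -((z : ℍ[ℝ]) * qj) = _
  ext <;> simp [re_qj, imI_qj, imJ_qj, imK_qj]
theorem qj_mul_coe (z : ℂ) : qj * (z : ℍ[ℝ]) = quat 0 0 z.re (-z.im) := by
  ext <;> simp [re_qj, imI_qj, imJ_qj, imK_qj]
theorem starInv_complex_apply (z : ℂ) : (starInv ℂ).toLinearMap z = ⟨z.re, -z.im⟩ := rfl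
theorem idInv_apply {R : Type*} [CommRing R] [Algebra ℝ R] (x : R) :
    (idInv R).toLinearMap x = x := rfl

theorem isEigenDecomposition_quatJMul :
    IsEigenDecomposition quatConjI quatOfComplex quatJMul where
  left_injective x y h := by
    simpa [quatOfComplex_apply, Complex.ext_iff, quat_inj] using h
  right_injective x y h := by
    simpa [quatJMul_apply, Complex.ext_iff, quat_inj] using h
  map_left x := by ext <;> simp [quatConjI_apply, quatOfComplex_apply]
  map_right x := by ext <;> simp [quatConjI_apply, quatJMul_apply]
  exists_add r := ⟨⟨r.re, r.imI⟩, ⟨r.imJ, -r.imK⟩, by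
    ext <;> simp [quatJMul_apply, quatOfComplex_apply]⟩

theorem isEigenDecomposition_quatIMulJ :
    IsEigenDecomposition quatConjJ complexJLinear quatIMulJ where
  left_injective x y h := by
    simpa [complexJLinear_apply, Complex.ext_iff, quat_inj] using h
  right_injective x y h := by
    simpa [quatIMulJ_apply, Complex.ext_iff, quat_inj] using h
  map_left x := by ext <;> simp [quatConjJ_apply, complexJLinear_apply]
  map_right x := by ext <;> simp [quatConjJ_apply, quatIMulJ_apply]
  exists_add r := ⟨⟨r.re, r.imJ⟩, ⟨r.imI, r.imK⟩, by
    ext <;> simp [complexJLinear_apply, quatIMulJ_apply]⟩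

theorem isEigenDecomposition_quatIMulConj :
    IsEigenDecomposition (-quatConjI) quatNegMulJ quatIMulConj where
  left_injective x y h := by
    simpa [quatNegMulJ_apply, Complex.ext_iff, quat_inj] using h
  right_injective x y h := by
    simpa [quatIMulConj_apply, Complex.ext_iff, quat_inj, and_comm] using h
  map_left x := by ext <;> simp [quatConjI_apply, quatNegMulJ_apply]
  map_right x := by ext <;> simp [quatConjI_apply, quatIMulConj_apply]
  exists_add r := ⟨⟨-r.imJ, -r.imK⟩, ⟨r.imI, r.re⟩, by
    ext <;> simp [quatNegMulJ_apply, quatIMulConj_apply]⟩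

theorem quatOfComplex_mul_mul (x a y : ℂ) :
    quatOfComplex (x * a * y) = quatOfComplex x * (a : ℍ[ℝ]) * quatOfComplex y := by
  ext <;> simp only [quatOfComplex_apply, coeComplex_eq, re_quat, imI_quat, imJ_quat, imK_quat,
      Quaternion.re_mul, Quaternion.imI_mul,
    Quaternion.imJ_mul, Quaternion.imK_mul, Complex.mul_re, Complex.mul_im] <;> ring

theorem quatConjI_mul_mul (x : ℍ[ℝ]) (a : ℂ) (y : ℍ[ℝ]) :
    quatConjI (x * (a : ℍ[ℝ]) * y) = quatConjI x * (a : ℍ[ℝ]) * quatConjI y := by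
  ext <;> simp only [quatConjI_apply, coeComplex_eq, re_quat, imI_quat, imJ_quat, imK_quat,
      Quaternion.re_mul, Quaternion.imI_mul,
    Quaternion.imJ_mul, Quaternion.imK_mul] <;> ring

/-- For complex `w` one has `j w j = -w̄`; take `w = y b`. -/
theorem quatJMul_mul (x a y b z : ℂ) :
    quatJMul (x * a * (-(starInv ℂ).toLinearMap) (y * b) * z) =
      quatJMul x * (a : ℍ[ℝ]) * (quatJMul y * (b : ℍ[ℝ])) * quatJMul z := by
  ext <;> simp only [quatJMul_apply, coeComplex_eq, re_quat, imI_quat, imJ_quat, imK_quat,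
      Quaternion.re_mul, Quaternion.imI_mul,
    Quaternion.imJ_mul, Quaternion.imK_mul, LinearMap.neg_apply, starInv_complex_apply,
    Complex.mul_re, Complex.mul_im, Complex.neg_re, Complex.neg_im] <;> ring

theorem complexJLinear_mul_mul (x a y : ℂ) :
    complexJLinear (x * a * y) = complexJLinear x * complexJ a * complexJLinear y := by
  ext <;> simp only [complexJLinear_apply, complexJ_eq, re_quat, imI_quat, imJ_quat, imK_quat,
      Quaternion.re_mul, Quaternion.imI_mul,
    Quaternion.imJ_mul, Quaternion.imK_mul, Complex.mul_re, Complex.mul_im] <;> ring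

theorem quatConjJ_mul_mul (x : ℍ[ℝ]) (a : ℂ) (y : ℍ[ℝ]) :
    quatConjJ (x * complexJ a * y) = quatConjJ x * complexJ a * quatConjJ y := by
  ext <;> simp only [quatConjJ_apply, complexJ_eq, re_quat, imI_quat, imJ_quat, imK_quat,
      Quaternion.re_mul, Quaternion.imI_mul,
    Quaternion.imJ_mul, Quaternion.imK_mul] <;> ring

theorem quatIMulJ_mul (x a y b z : ℂ) :
    quatIMulJ (x * a * (-(starInv ℂ).toLinearMap) (y * b) * z) =
      quatIMulJ x * complexJ a * (quatIMulJ y * complexJ b) * quatIMulJ z := by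
  ext <;> simp only [quatIMulJ_apply, complexJ_eq, re_quat, imI_quat, imJ_quat, imK_quat,
      Quaternion.re_mul, Quaternion.imI_mul,
    Quaternion.imJ_mul, Quaternion.imK_mul, LinearMap.neg_apply, starInv_complex_apply,
    Complex.mul_re, Complex.mul_im, Complex.neg_re, Complex.neg_im] <;> ring

theorem quatNegMulJ_mul_mul (x a y : ℂ) :
    quatNegMulJ (x * a * y) = quatNegMulJ x * (qj * (a : ℍ[ℝ])) * quatNegMulJ y := by
  ext <;> simp only [quatNegMulJ_apply, qj_mul_coe, re_quat, imI_quat, imJ_quat, imK_quat,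
      Quaternion.re_mul, Quaternion.imI_mul,
    Quaternion.imJ_mul, Quaternion.imK_mul, Complex.mul_re, Complex.mul_im] <;> ring

/-- Conjugation by `i` changes the sign of the middle factor `j a`, so it is its negative that
preserves the products. This exchanges the eigenspaces: the subgroup now sits in `ℂ j`. -/
theorem neg_quatConjI_mul_mul (x : ℍ[ℝ]) (a : ℂ) (y : ℍ[ℝ]) :
    (-quatConjI) (x * (qj * (a : ℍ[ℝ])) * y) =
      (-quatConjI) x * (qj * (a : ℍ[ℝ])) * (-quatConjI) y := by
  ext <;> simp only [LinearMap.neg_apply, quatConjI_apply, qj_mul_coe, re_quat, imI_quat,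
      imJ_quat, imK_quat, Quaternion.re_mul,
    Quaternion.imI_mul, Quaternion.imJ_mul, Quaternion.imK_mul, Quaternion.re_neg,
    Quaternion.imI_neg, Quaternion.imJ_neg, Quaternion.imK_neg] <;> ring

theorem quatIMulConj_mul (x a y b z : ℂ) :
    quatIMulConj (x * a * (-(starInv ℂ).toLinearMap) (y * b) * z) =
      quatIMulConj x * (qj * (a : ℍ[ℝ])) * (quatIMulConj y * (qj * (b : ℍ[ℝ]))) *
        quatIMulConj z := by
  ext <;> simp only [quatIMulConj_apply, qj_mul_coe, re_quat, imI_quat, imJ_quat, imK_quat,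
      Quaternion.re_mul, Quaternion.imI_mul,
    Quaternion.imJ_mul, Quaternion.imK_mul, LinearMap.neg_apply, starInv_complex_apply,
    Complex.mul_re, Complex.mul_im, Complex.neg_re, Complex.neg_im] <;> ring

theorem neg_conjJ (x : ℍ[ℝ]) : -conjJ x = qj * x * qj := by
  rw [conjJ, qj_inv, mul_neg, neg_neg]

theorem qj_mul_qj : qj * qj = -1 := by
  ext <;> simp [re_qj, imI_qj, imJ_qj, imK_qj]

theorem bijective_qj_mul : Function.Bijective (LinearMap.mulLeft ℝ qj) := by
  have h : ∀ x : ℍ[ℝ], qj * (qj * x) = -x := fun x => by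
    rw [← mul_assoc, qj_mul_qj, neg_one_mul]
  refine ⟨fun x y hxy => ?_, fun x => ⟨-(qj * x), ?_⟩⟩
  · have h1 := congrArg (fun x => qj * x) hxy
    simpa [h] using h1
  · rw [LinearMap.mulLeft_apply, mul_neg, h, neg_neg]

/-- This is the equality `-θ(w) = j w j` with `w = y b`. -/
theorem qj_mul_mul (x a y b z : ℍ[ℝ]) :
    LinearMap.mulLeft ℝ qj (x * a * (-quatConjJ) (y * b) * z) =
      LinearMap.mulLeft ℝ qj x * a * (LinearMap.mulLeft ℝ qj y * b) *
        LinearMap.mulLeft ℝ qj z := by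
  change qj * (x * a * -conjJ (y * b) * z) = qj * x * a * (qj * y * b) * (qj * z)
  rw [neg_conjJ]
  simp only [mul_assoc]

theorem conjJ_mul (x y : ℍ[ℝ]) : conjJ (x * y) = conjJ x * conjJ y := by
  have h : ∀ z, qj⁻¹ * (qj * z) = z := fun z => by
    rw [qj_inv, ← mul_assoc, neg_mul, qj_mul_qj, neg_neg, one_mul]
  simp only [conjJ, mul_assoc, h]

theorem conjJ_neg (x : ℍ[ℝ]) : conjJ (-x) = -conjJ x := by
  rw [conjJ, conjJ, mul_neg, neg_mul]

theorem conjJ_conjJ (x : ℍ[ℝ]) : conjJ (conjJ x) = x := by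
  ext <;> simp [re_conjJ, imI_conjJ, imJ_conjJ, imK_conjJ]

theorem star_conjJ (x : ℍ[ℝ]) : star (conjJ x) = conjJ (star x) := by
  ext <;> simp [re_conjJ, imI_conjJ, imJ_conjJ, imK_conjJ]

theorem starInv_neg_conjJ (a x b : ℍ[ℝ]) :
    (starInv ℍ[ℝ]).toLinearMap (a * (-quatConjJ) (x * b)) = tildeInv.toLinearMap b *
      (-quatConjJ) ((starInv ℍ[ℝ]).toLinearMap x * tildeInv.toLinearMap a) := by
  change star (a * -conjJ (x * b)) = conjJ (star b) * -conjJ (star x * conjJ (star a))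
  simp only [star_mul, star_neg, conjJ_mul, conjJ_conjJ, star_conjJ, mul_neg, mul_assoc]

theorem tildeInv_neg_conjJ (a x b : ℍ[ℝ]) :
    tildeInv.toLinearMap (a * (-quatConjJ) (x * b)) = (starInv ℍ[ℝ]).toLinearMap b *
      (-quatConjJ) (tildeInv.toLinearMap x * (starInv ℍ[ℝ]).toLinearMap a) := by
  change conjJ (star (a * -conjJ (x * b))) = star b * -conjJ (conjJ (star x) * star a)
  simp only [star_mul, star_neg, conjJ_mul, conjJ_neg, conjJ_conjJ, star_conjJ, mul_neg, mul_assoc]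

end Quaternion

end Homotope
end

noncomputable section

namespace Homotope

set_option linter.unusedSectionVars false

/-! ### Lie triple systems of groups and of quaternionic symmetric spaces -/

section QuaternionicCases

open RealInvolution

theorem starInv_apply {R : Type*} [Ring R] [Algebra ℝ R] [StarRing R] [StarModule ℝ R] (x : R) :
    (starInv R).toLinearMap x = star x := rfl

theorem tildeInv_quat_apply (x : ℍ[ℝ]) :
    tildeInv.toLinearMap x = quat x.re x.imI (-x.imJ) x.imK := tildeInv_apply x

variable {m n : Type*} [Fintype m] [Fintype n] [DecidableEq m] [DecidableEq n]

section Commutative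

variable {𝕜 : Type*} [RCLike 𝕜] {A : Matrix m m 𝕜}

theorem groupCase_symplectic (hA : A ∈ (idInv 𝕜).Aherm m) :
    GroupCase ((idInv 𝕜).Herm m) ((idInv 𝕜).Herm m) (fun X => A * X * A) ((idInv 𝕜).Sp hA) :=
  groupCase_unitary_entrywise (f := LinearMap.id) (c := LinearMap.id)
    ((mem_Aherm_iff _ _).1 hA) (mem_Herm_iff _) (isUnitaryGroup_Sp _ hA)
    (fun X => by rw [LinearMap.id_coe, Matrix.map_id, Matrix.mul_assoc]) Function.bijective_id
    (fun _ => rfl) (fun x a y b z => by simp only [LinearMap.id_coe, id_eq, mul_assoc])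
    (fun a x b => by simp [idInv_apply]; ring)

theorem groupCase_orthogonal (hA : A ∈ (idInv 𝕜).Herm m) :
    GroupCase ((idInv 𝕜).Aherm m) ((idInv 𝕜).Aherm m) (fun X => A * X * A) ((idInv 𝕜).U hA) :=
  groupCase_unitary_entrywise (f := LinearMap.id) (c := LinearMap.id)
    ((mem_Herm_iff _ _).1 hA) (mem_Aherm_iff _) (isUnitaryGroup_U _ hA)
    (fun X => by rw [LinearMap.id_coe, Matrix.map_id, Matrix.mul_assoc]) Function.bijective_id
    (fun x => (neg_neg x).symm) (fun x a y b z => by simp only [LinearMap.id_coe, id_eq, mul_assoc])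
    (fun a x b => by simp [idInv_apply]; ring)

end Commutative

section Complex

variable {A : Matrix m m ℂ}

theorem groupCase_unitary_complex (hA : A ∈ (starInv ℂ).Herm m) :
    GroupCase ((starInv ℂ).Herm m) ((starInv ℂ).Herm m) (fun X => -(A * X * A))
      ((starInv ℂ).U hA) :=
  groupCase_unitary_entrywise (f := LinearMap.mulLeft ℝ Complex.I)
    ((mem_Herm_iff _ _).1 hA) (mem_Herm_iff _) (isUnitaryGroup_U _ hA) (neg_mul_mul_eq A)
    ⟨fun x y h => mul_left_cancel₀ Complex.I_ne_zero h,
      fun x => ⟨-(Complex.I * x), by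
        rw [LinearMap.mulLeft_apply, mul_neg, ← mul_assoc, Complex.I_mul_I, neg_one_mul, neg_neg]⟩⟩
    (fun x => by simp [starInv_apply, mul_comm])
    (fun x a y b z => by
      simp only [LinearMap.mulLeft_apply, LinearMap.neg_apply, LinearMap.id_apply]
      linear_combination (-Complex.I * x * a * y * b * z) * Complex.I_mul_I)
    (fun a x b => by simp [starInv_apply]; ring)

theorem symmetricCase_top_quaternion (A : Matrix n m ℂ) :
    SymmetricCase ⊤ ⊤ (fun X : Matrix m n ℂ => -(A * (X * A).map star))
      (⊤ : Subgroup (Gl (A.map (fun z => (z : ℍ[ℝ])))))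
      (fun h : Gl A => h.val.map (fun z => (z : ℍ[ℝ]))) :=
  symmetricCase_top_entrywise A isEigenDecomposition_quatJMul quatOfComplex_mul_mul
    quatConjI_mul_mul quatJMul_mul (fun _ => neg_mul_map_eq A _ (starInv ℂ).toLinearMap)

/-- The quaternions `j z` are purely imaginary, so conjugation is `-1` on them and `V⁺` consists of
symmetric matrices. -/
theorem symmetricCase_starInv_quaternion (hA : A ∈ (starInv ℂ).Herm m) :
    SymmetricCase ((idInv ℂ).Herm m) ((idInv ℂ).Herm m) (fun X => -(A * (X * A).map star))
      ((starInv ℍ[ℝ]).U (map_mem_Herm starInv_coeComplex hA))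
      (fun h : (starInv ℂ).U hA => h.1.val.map (fun z => (z : ℍ[ℝ]))) :=
  symmetricCase_unitary_entrywise (LinearEquiv.refl ℝ _) (fun _ _ => rfl)
    (Matrix.map_id _).symm ((mem_Herm_iff _ _).1 hA) (mem_Herm_iff _) (isUnitaryGroup_U _ _)
      (fun _ => rfl)
    (isUnitaryGroup_U _ hA) (fun _ => rfl) (fun _ => neg_mul_map_eq A _ (starInv ℂ).toLinearMap)
    isEigenDecomposition_quatJMul quatOfComplex_mul_mul quatConjI_mul_mul starInv_coeComplex
    (fun x => by ext <;> simp [starInv_apply, idInv_apply, quatJMul_apply]) quatJMul_mul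
    (fun a x b => by simp [starInv_apply, idInv_apply]; ring)

/-- The split involution sends `j z` to `-j z̄`, whence Hermitian matrices. -/
theorem symmetricCase_tildeInv_quaternion (hA : A ∈ (idInv ℂ).Herm m) :
    SymmetricCase ((starInv ℂ).Herm m) ((starInv ℂ).Herm m) (fun X => -(A * (X * A).map star))
      (tildeInv.U (map_mem_Herm tildeInv_coeComplex hA))
      (fun h : (idInv ℂ).U hA => h.1.val.map (fun z => (z : ℍ[ℝ]))) :=
  symmetricCase_unitary_entrywise (LinearEquiv.refl ℝ _) (fun _ _ => rfl)
    (Matrix.map_id _).symm ((mem_Herm_iff _ _).1 hA) (mem_Herm_iff _) (isUnitaryGroup_U _ _)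
      (fun _ => rfl)
    (isUnitaryGroup_U _ hA) (fun _ => rfl) (fun _ => neg_mul_map_eq A _ (starInv ℂ).toLinearMap)
    isEigenDecomposition_quatJMul quatOfComplex_mul_mul quatConjI_mul_mul tildeInv_coeComplex
    (fun x => by rw [tildeInv_apply]; ext <;> simp [starInv_apply, quatJMul_apply]) quatJMul_mul
    (fun a x b => by simp [starInv_apply, idInv_apply]; ring)

/-- The split involution fixes `i` and `k`, hence all of `i ℝ[j]`, whence skew-symmetric matrices.
-/
theorem symmetricCase_tildeInv_complexJ (hA : A ∈ (starInv ℂ).Herm m) :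
    SymmetricCase ((idInv ℂ).Aherm m) ((idInv ℂ).Aherm m) (fun X => -(A * (X * A).map star))
      (tildeInv.U (map_mem_Herm tildeInv_complexJ hA))
      (fun h : (starInv ℂ).U hA => h.1.val.map complexJ) :=
  symmetricCase_unitary_entrywise (LinearEquiv.refl ℝ _) (fun _ _ => rfl)
    (Matrix.map_id _).symm ((mem_Herm_iff _ _).1 hA) (mem_Aherm_iff _) (isUnitaryGroup_U _ _)
      (fun _ => rfl)
    (isUnitaryGroup_U _ hA) (fun _ => rfl) (fun _ => neg_mul_map_eq A _ (starInv ℂ).toLinearMap)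
    isEigenDecomposition_quatIMulJ complexJLinear_mul_mul quatConjJ_mul_mul tildeInv_complexJ
    (fun x => by rw [tildeInv_apply]; ext <;> simp [idInv_apply, quatIMulJ_apply]) quatIMulJ_mul
    (fun a x b => by simp [starInv_apply, idInv_apply]; ring)

theorem symmetricCase_starInv_qj (hA : A ∈ (idInv ℂ).Aherm m) :
    SymmetricCase ((starInv ℂ).Herm m) ((starInv ℂ).Herm m) (fun X => -(A * (X * A).map star))
      ((starInv ℍ[ℝ]).U (qj_smul_mem_Herm hA))
      (fun h : (idInv ℂ).Sp hA => h.1.val.map (fun z => -((z : ℍ[ℝ]) * qj))) :=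
  symmetricCase_unitary_entrywise (t := (starInv ℍ[ℝ]).toLinearMap) (LinearEquiv.refl ℝ _)
      (fun _ _ => rfl)
    (Matrix.map_id _).symm ((mem_Aherm_iff _ _).1 hA) (mem_Herm_iff _) (isUnitaryGroup_U _ _)
    (fun _ => rfl) (isUnitaryGroup_Sp _ hA) (fun _ => rfl)
    (fun _ => neg_mul_map_eq A _ (starInv ℂ).toLinearMap)
    isEigenDecomposition_quatIMulConj quatNegMulJ_mul_mul neg_quatConjI_mul_mul
    (fun x => by ext <;> simp [starInv_apply, idInv_apply, quatNegMulJ_apply])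
    (fun x => by ext <;> simp [starInv_apply, quatIMulConj_apply]) quatIMulConj_mul
    (fun a x b => by simp [starInv_apply, idInv_apply]; ring)

end Complex

section Quaternion

variable {A : Matrix m m ℍ[ℝ]}

/-- Left multiplication by `j` turns the conjugation into the negative of the split involution. -/
theorem groupCase_tildeInv (hA : A ∈ tildeInv.Herm m) :
    GroupCase ((starInv ℍ[ℝ]).Herm m) ((starInv ℍ[ℝ]).Herm m)
      (fun X => -(A * (X * A).map conjJ)) (tildeInv.U hA) :=
  groupCase_unitary_entrywise ((mem_Herm_iff _ _).1 hA) (mem_Herm_iff _) (isUnitaryGroup_U _ hA)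
    (fun _ => neg_mul_map_eq A _ quatConjJ) bijective_qj_mul
    (fun x => by ext <;> simp [starInv_apply, tildeInv_quat_apply, re_qj, imI_qj, imJ_qj, imK_qj])
    qj_mul_mul starInv_neg_conjJ

theorem groupCase_starInv (hA : A ∈ (starInv ℍ[ℝ]).Herm m) :
    GroupCase (tildeInv.Herm m) (tildeInv.Herm m)
      (fun X => -(A * (X * A).map conjJ)) ((starInv ℍ[ℝ]).U hA) :=
  groupCase_unitary_entrywise ((mem_Herm_iff _ _).1 hA) (mem_Herm_iff _) (isUnitaryGroup_U _ hA)
    (fun _ => neg_mul_map_eq A _ quatConjJ) bijective_qj_mul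
    (fun x => by ext <;> simp [starInv_apply, tildeInv_quat_apply, re_qj, imI_qj, imJ_qj, imK_qj])
    qj_mul_mul tildeInv_neg_conjJ

end Quaternion

end QuaternionicCases

end Homotope
end

noncomputable section

namespace Homotope

set_option linter.unusedSectionVars false

/-! ### Realizations by block matrices -/

namespace IsEigenDecomposition

variable {V W : Type*} [AddCommGroup V] [Module ℝ V] [AddCommGroup W]
    [Module ℝ W] {s : V →ₗ[ℝ] V} {e f : W →ₗ[ℝ] V}

theorem neg (h : IsEigenDecomposition s e f) : IsEigenDecomposition (-s) f e where
  left_injective := h.right_injective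
  right_injective := h.left_injective
  map_left x := by rw [LinearMap.neg_apply, h.map_right, neg_neg]
  map_right x := by rw [LinearMap.neg_apply, h.map_left]
  exists_add r := by
    obtain ⟨x, y, rfl⟩ := h.exists_add r
    exact ⟨y, x, add_comm _ _⟩

theorem comp (h : IsEigenDecomposition s e f) {g g' : W →ₗ[ℝ] W} (hg : Function.Bijective g)
    (hg' : Function.Bijective g') : IsEigenDecomposition s (e ∘ₗ g) (f ∘ₗ g') where
  left_injective := h.left_injective.comp hg.1
  right_injective := h.right_injective.comp hg'.1
  map_left x := h.map_left _
  map_right x := h.map_right _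
  exists_add r := by
    obtain ⟨x, y, rfl⟩ := h.exists_add r
    obtain ⟨x, rfl⟩ := hg.2 x
    obtain ⟨y, rfl⟩ := hg'.2 y
    exact ⟨x, y, rfl⟩

end IsEigenDecomposition

section BlockEquiv

variable {m R : Type*} [Fintype m] [Ring R] [Algebra ℝ R]

/-- Matrices of `2 × 2`-matrices as block matrices. -/
def blockEquiv (m R : Type*) [Ring R] [Algebra ℝ R] :
    Matrix m m (Matrix (Fin 2) (Fin 2) R) ≃ₗ[ℝ] Matrix (m ⊕ m) (m ⊕ m) R where
  toFun X := Matrix.fromBlocks (Matrix.of fun i j => X i j 0 0) (Matrix.of fun i j => X i j 0 1)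
    (Matrix.of fun i j => X i j 1 0) (Matrix.of fun i j => X i j 1 1)
  map_add' X Y := by
    rw [Matrix.fromBlocks_add]
    rfl
  map_smul' c X := by
    rw [RingHom.id_apply, Matrix.fromBlocks_smul]
    rfl
  invFun Y := Matrix.of fun i j => !![Y.toBlocks₁₁ i j, Y.toBlocks₁₂ i j;
    Y.toBlocks₂₁ i j, Y.toBlocks₂₂ i j]
  left_inv X := by
    ext i j k l
    fin_cases k <;> fin_cases l <;> rfl
  right_inv Y := Matrix.fromBlocks_toBlocks Y

theorem blockEquiv_apply (X : Matrix m m (Matrix (Fin 2) (Fin 2) R)) :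
    blockEquiv m R X =
      Matrix.fromBlocks (Matrix.of fun i j => X i j 0 0) (Matrix.of fun i j => X i j 0 1)
        (Matrix.of fun i j => X i j 1 0) (Matrix.of fun i j => X i j 1 1) := rfl

theorem blockEquiv_mul (X Y : Matrix m m (Matrix (Fin 2) (Fin 2) R)) :
    blockEquiv m R (X * Y) = blockEquiv m R X * blockEquiv m R Y := by
  rw [blockEquiv_apply, blockEquiv_apply, blockEquiv_apply, Matrix.fromBlocks_multiply,
    Matrix.fromBlocks_inj]
  refine ⟨?_, ?_, ?_, ?_⟩ <;> ext i j <;>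
    simp [Matrix.mul_apply, Matrix.sum_apply, Finset.sum_add_distrib]

theorem adjMap_blockEquiv (t : R →ₗ[ℝ] R) (X : Matrix m m (Matrix (Fin 2) (Fin 2) R)) :
    adjMap t (blockEquiv m R X) = blockEquiv m R (adjMap (adjMap t) X) := by
  rw [blockEquiv_apply, adjMap_apply, Matrix.fromBlocks_map, Matrix.fromBlocks_transpose]
  rfl

end BlockEquiv

theorem map_mul_mul_of_map_eq {R : Type*} [Ring R] [Algebra ℝ R] {s : R →ₗ[ℝ] R}
    (hs : ∀ x y, s (x * y) = s x * s y) {r : R} (hr : s r = r) (x y : R) :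
    s (x * r * y) = s x * r * s y := by
  rw [hs, hs, hr]

theorem neg_map_mul_mul_of_map_eq_neg {R : Type*} [Ring R] [Algebra ℝ R] {s : R →ₗ[ℝ] R}
    (hs : ∀ x y, s (x * y) = s x * s y) {r : R} (hr : s r = -r) (x y : R) :
    (-s) (x * r * y) = (-s) x * r * (-s) y := by
  simp only [LinearMap.neg_apply, hs, hr, mul_neg, neg_mul]

/-- Unitary groups over `R`, modulo unitary groups over an algebra that is realized by the
`2 × 2`-matrices over `R`. -/
theorem symmetricCase_unitary_block {S : Type*} [NormedRing S] [NormedAlgebra ℝ S]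
    [FiniteDimensional ℝ S] {m R : Type*} [Fintype m] [DecidableEq m]
    [NormedRing R] [NormedAlgebra ℝ R] [FiniteDimensional ℝ R] {A A' : Matrix m m S}
    {D : Matrix (m ⊕ m) (m ⊕ m) R} {d : S → Matrix (Fin 2) (Fin 2) R} {h : S → S}
    {s : Matrix (Fin 2) (Fin 2) R →ₗ[ℝ] Matrix (Fin 2) (Fin 2) R}
    {e f : S →ₗ[ℝ] Matrix (Fin 2) (Fin 2) R} {c tK tV tA : S →ₗ[ℝ] S} {t : R →ₗ[ℝ] R}
    {Vp : Submodule ℝ (Matrix m m S)} {α : Matrix m m S → Matrix m m S}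
    {G : Subgroup (Gl D)} {K : Subgroup (Gl A')} {emb : K → Matrix (m ⊕ m) (m ⊕ m) R}
    (hD : D = blockEquiv m R (A.map d)) (hA' : A' = A.map h)
    (hA : adjMap tA A = A) (hV : ∀ X, X ∈ Vp ↔ adjMap tV X = X)
    (hG : IsUnitaryGroup (adjMap t) G) (hK : IsUnitaryGroup (adjMap tK) K)
    (hemb : ∀ x : K, emb x = blockEquiv m R (x.1.val.map e))
    (hα : ∀ X, α X = A * (X * A).map c)
    (hdec : IsEigenDecomposition s e f)
    (he : ∀ x a y, e (x * h a * y) = e x * d a * e y)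
    (hs : ∀ x a y, s (x * d a * y) = s x * d a * s y)
    (hte : ∀ x, adjMap t (e x) = e (tK x)) (htf : ∀ x, adjMap t (f x) = -f (tV x))
    (hf : ∀ x a y b z, f (x * a * c (y * b) * z) = f x * d a * (f y * d b) * f z)
    (hc : ∀ a x b, tV (a * c (x * b)) = tA b * c (tV x * tA a)) :
    SymmetricCase Vp Vp α G emb :=
  symmetricCase_unitary_entrywise (blockEquiv m R)
    (fun X Y => by rw [blockEquiv_mul, blockEquiv_mul, hD]) hA' hA hV hG (adjMap_blockEquiv t) hK
    hemb hα hdec he hs hte htf hf hc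

section MatrixConj

variable {𝕜 : Type*} [RCLike 𝕜]

/-- The automorphism `x ↦ J x̄ J⁻¹` of the algebra of `2 × 2`-matrices. -/
def matrixConjJ (𝕜 : Type*) [RCLike 𝕜] :
    Matrix (Fin 2) (Fin 2) 𝕜 →ₗ[ℝ] Matrix (Fin 2) (Fin 2) 𝕜 where
  toFun X := !![star (X 1 1), -star (X 1 0); -star (X 0 1), star (X 0 0)]
  map_add' X Y := by ext i j; fin_cases i <;> fin_cases j <;> simp [add_comm]
  map_smul' c X := by ext i j; fin_cases i <;> fin_cases j <;> simp [RCLike.real_smul_eq_coe_mul]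

theorem matrixConjJ_apply (X : Matrix (Fin 2) (Fin 2) 𝕜) :
    matrixConjJ 𝕜 X = !![star (X 1 1), -star (X 1 0); -star (X 0 1), star (X 0 0)] := rfl

theorem matrixConjJ_mul (X Y : Matrix (Fin 2) (Fin 2) 𝕜) :
    matrixConjJ 𝕜 (X * Y) = matrixConjJ 𝕜 X * matrixConjJ 𝕜 Y := by
  ext i j
  fin_cases i <;> fin_cases j <;>
    simp [matrixConjJ_apply, Matrix.mul_apply, Fin.sum_univ_two, add_comm]

end MatrixConj

/-! ### Complex numbers as real matrices -/

section RealMatrices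

open RealInvolution

/-- The embedding of `ℂ` into the algebra `M(2, 2; ℝ)`. -/
def complexToMatrixLinear : ℂ →ₗ[ℝ] Matrix (Fin 2) (Fin 2) ℝ where
  toFun := complexToMatrix
  map_add' x y := by
    ext i j; fin_cases i <;> fin_cases j <;> simp [complexToMatrix, add_comm]
  map_smul' c x := by ext i j; fin_cases i <;> fin_cases j <;> simp [complexToMatrix]

/-- The map `a + i b ↦ (a, b; b, -a)`. -/
def complexToMatrixRefl : ℂ →ₗ[ℝ] Matrix (Fin 2) (Fin 2) ℝ where
  toFun z := !![z.re, z.im; z.im, -z.re]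
  map_add' x y := by ext i j; fin_cases i <;> fin_cases j <;> simp [add_comm]
  map_smul' c x := by ext i j; fin_cases i <;> fin_cases j <;> simp

theorem complexToMatrixLinear_apply (z : ℂ) :
    complexToMatrixLinear z = !![z.re, z.im; -z.im, z.re] := rfl
theorem complexToMatrixRefl_apply (z : ℂ) :
    complexToMatrixRefl z = !![z.re, z.im; z.im, -z.re] := rfl

theorem complexToMatrixLinear_mul (x y : ℂ) : complexToMatrixLinear (x * y) =
    complexToMatrixLinear x * complexToMatrixLinear y := by
  ext i j
  fin_cases i <;> fin_cases j <;>
    simp [complexToMatrixLinear_apply, Matrix.mul_apply, Fin.sum_univ_two] <;> ring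

/-- With `r = diag(1, -1)` one has `ρ'(x) = r ρ(x)`, `r² = 1` and `r ρ(x) r = ρ(x̄)`. This and the
next two lemmas are the resulting multiplication table. -/
theorem complexToMatrixRefl_mul_linear (x y : ℂ) :
    complexToMatrixRefl x * complexToMatrixLinear y = complexToMatrixRefl (x * y) := by
  ext i j
  fin_cases i <;> fin_cases j <;>
    simp [complexToMatrixRefl_apply, complexToMatrixLinear_apply, Matrix.mul_apply,
      Fin.sum_univ_two] <;> ring

theorem complexToMatrixLinear_mul_refl (x y : ℂ) :
    complexToMatrixLinear x * complexToMatrixRefl y = complexToMatrixRefl (star x * y) := by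
  ext i j
  fin_cases i <;> fin_cases j <;>
    simp [complexToMatrixRefl_apply, complexToMatrixLinear_apply, Matrix.mul_apply,
      Fin.sum_univ_two]
  all_goals ring

theorem complexToMatrixRefl_mul_refl (x y : ℂ) :
    complexToMatrixRefl x * complexToMatrixRefl y = complexToMatrixLinear (star x * y) := by
  ext i j
  fin_cases i <;> fin_cases j <;>
    simp [complexToMatrixRefl_apply, complexToMatrixLinear_apply, Matrix.mul_apply,
      Fin.sum_univ_two]
  all_goals ring

theorem isEigenDecomposition_complexToMatrix :
    IsEigenDecomposition (matrixConjJ ℝ) complexToMatrixLinear complexToMatrixRefl where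
  left_injective x y h := Complex.ext (congrFun (congrFun h 0) 0) (congrFun (congrFun h 0) 1)
  right_injective x y h := Complex.ext (congrFun (congrFun h 0) 0) (congrFun (congrFun h 0) 1)
  map_left x := by
    ext i j
    fin_cases i <;> fin_cases j <;> simp [matrixConjJ_apply, complexToMatrixLinear_apply]
  map_right x := by
    ext i j
    fin_cases i <;> fin_cases j <;> simp [matrixConjJ_apply, complexToMatrixRefl_apply]
  exists_add r := ⟨⟨(r 0 0 + r 1 1) / 2, (r 0 1 - r 1 0) / 2⟩,
    ⟨(r 0 0 - r 1 1) / 2, (r 0 1 + r 1 0) / 2⟩, by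
      ext i j
      fin_cases i <;> fin_cases j <;>
        simp [complexToMatrixLinear_apply, complexToMatrixRefl_apply] <;> ring⟩

theorem adjMap_complexToMatrixLinear (z : ℂ) :
    adjMap (idInv ℝ).toLinearMap (complexToMatrixLinear z) = complexToMatrixLinear (star z) := by
  ext i j
  fin_cases i <;> fin_cases j <;>
    simp [adjMap_apply, complexToMatrixLinear_apply, idInv_apply]

theorem adjMap_complexToMatrixRefl (z : ℂ) :
    adjMap (idInv ℝ).toLinearMap (complexToMatrixRefl z) = complexToMatrixRefl z := by
  ext i j
  fin_cases i <;> fin_cases j <;>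
    simp [adjMap_apply, complexToMatrixRefl_apply, idInv_apply]

theorem adjMap_neg {m n R : Type*} [Ring R] [Algebra ℝ R] (t : R →ₗ[ℝ] R) (X : Matrix m n R) :
    adjMap (-t) X = -adjMap t X := rfl

variable {m n : Type*} [Fintype m] [Fintype n] [DecidableEq m] [DecidableEq n]

theorem realMat_eq_blockEquiv (X : Matrix m m ℂ) :
    realMat X = blockEquiv m ℝ (X.map complexToMatrixLinear) := rfl

theorem realMat'_eq_blockEquiv (X : Matrix m m ℂ) :
    realMat' X = blockEquiv m ℝ (X.map complexToMatrixRefl) := rfl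

theorem bijective_starInv (R : Type*) [Ring R] [Algebra ℝ R] [StarRing R] [StarModule ℝ R] :
    Function.Bijective (starInv R).toLinearMap :=
  Function.Involutive.bijective (starInv R).involutive'

/-- The reflection `r` plays the role of `j`, but has square `1` instead of `-1`. This is why `α`
loses its sign. -/
theorem symmetricCase_top_matrix (A : Matrix n m ℂ) :
    SymmetricCase ⊤ ⊤ (fun X : Matrix m n ℂ => A * (X * A).map star)
      (⊤ : Subgroup (Gl (A.map complexToMatrix)))
      (fun h : Gl A => h.val.map complexToMatrix) :=
  symmetricCase_top_entrywise A (c := (starInv ℂ).toLinearMap)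
    (d := complexToMatrixLinear) isEigenDecomposition_complexToMatrix
    (fun x a y => by rw [complexToMatrixLinear_mul, complexToMatrixLinear_mul])
    (fun x a y => map_mul_mul_of_map_eq matrixConjJ_mul
      (isEigenDecomposition_complexToMatrix.map_left a) x y)
    (fun x a y b z => by
      simp only [complexToMatrixRefl_mul_linear, complexToMatrixRefl_mul_refl,
        complexToMatrixLinear_mul_refl, starInv_apply, star_mul, star_star]
      ring_nf)
    (fun _ => rfl)

variable {A : Matrix m m ℂ}

/-- The only case where `h` is not the identity: both groups have a parameter built from `i ā`, and
`f(x) = ρ'(x̄)`. In the triple product one of the two factors `i` is conjugated, so that they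
cancel. -/
theorem symmetricCase_realMat_Sp (hA : A ∈ (starInv ℂ).Herm m) :
    SymmetricCase ((idInv ℂ).Herm m) ((idInv ℂ).Herm m) (fun X => A * (X * A).map star)
      ((idInv ℝ).Sp (realMat_mem_Aherm (I_smul_conj_mem_Aherm hA)))
      (fun h : (starInv ℂ).Sp (I_smul_conj_mem_Aherm hA) => realMat h.1.val) :=
  symmetricCase_unitary_block (d := fun a => complexToMatrixLinear (Complex.I * star a))
    (h := fun a => Complex.I * star a) (c := (starInv ℂ).toLinearMap)
    (realMat_eq_blockEquiv _) rfl ((mem_Herm_iff _ _).1 hA) (mem_Herm_iff _)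
    (isUnitaryGroup_Sp _ _) (isUnitaryGroup_Sp _ _) (fun _ => rfl) (fun _ => rfl)
    (isEigenDecomposition_complexToMatrix.comp (g := LinearMap.id) Function.bijective_id
      (bijective_starInv ℂ))
    (fun x a y => by
      simp only [LinearMap.comp_apply, LinearMap.id_apply, complexToMatrixLinear_mul])
    (fun x a y => map_mul_mul_of_map_eq matrixConjJ_mul
      (isEigenDecomposition_complexToMatrix.map_left _) x y)
    (fun x => by
      simp only [LinearMap.comp_apply, LinearMap.id_apply, adjMap_neg,
        adjMap_complexToMatrixLinear, LinearMap.neg_apply, starInv_apply, map_neg])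
    (fun x => by
      simp only [LinearMap.comp_apply, adjMap_neg,
        adjMap_complexToMatrixRefl, idInv_apply])
    (fun x a y b z => by
      simp only [LinearMap.comp_apply, complexToMatrixRefl_mul_linear,
        complexToMatrixRefl_mul_refl, complexToMatrixLinear_mul_refl, starInv_apply, star_mul,
        star_star]
      congr 1
      simp
      linear_combination (starRingEnd ℂ x * starRingEnd ℂ a * y * b * starRingEnd ℂ z) *
        Complex.I_mul_I)
    (fun a x b => by simp [starInv_apply, idInv_apply]; ring)

theorem symmetricCase_realMat_U (hA : A ∈ (starInv ℂ).Herm m) :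
    SymmetricCase ((idInv ℂ).Aherm m) ((idInv ℂ).Aherm m) (fun X => A * (X * A).map star)
      ((idInv ℝ).U (realMat_mem_Herm hA))
      (fun h : (starInv ℂ).U hA => realMat h.1.val) :=
  symmetricCase_unitary_block (d := complexToMatrixLinear) (h := id)
    (c := (starInv ℂ).toLinearMap)
    (realMat_eq_blockEquiv _) (Matrix.map_id _).symm ((mem_Herm_iff _ _).1 hA) (mem_Aherm_iff _)
    (isUnitaryGroup_U _ _) (isUnitaryGroup_U _ _) (fun _ => rfl) (fun _ => rfl)
    isEigenDecomposition_complexToMatrix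
    (fun x a y => by simp only [id_eq, complexToMatrixLinear_mul])
    (fun x a y => map_mul_mul_of_map_eq matrixConjJ_mul
      (isEigenDecomposition_complexToMatrix.map_left _) x y)
    adjMap_complexToMatrixLinear
    (fun x => by
      simp only [adjMap_complexToMatrixRefl, idInv_apply, LinearMap.neg_apply, map_neg, neg_neg])
    (fun x a y b z => by
      simp only [complexToMatrixRefl_mul_linear, complexToMatrixRefl_mul_refl,
        complexToMatrixLinear_mul_refl, starInv_apply, star_mul, star_star]
      ring_nf)
    (fun a x b => by simp [starInv_apply, idInv_apply]; ring)

/-- The parameter lies in the `-1`-eigenspace, so the roles of `ρ` and `ρ'` are exchanged; the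
conjugation in `e` is forced by `ρ'(x̄) ρ'(a) ρ'(ȳ)` being `ρ'` of the conjugate of `x a y`. The
factor `i` in `f(x) = ρ(i x̄)` turns Hermitian into skew-Hermitian matrices. -/
theorem symmetricCase_realMat'_U (hA : A ∈ (idInv ℂ).Herm m) :
    SymmetricCase ((starInv ℂ).Herm m) ((starInv ℂ).Herm m) (fun X => A * (X * A).map star)
      ((idInv ℝ).U (realMat'_mem_Herm hA))
      (fun h : (idInv ℂ).U hA => realMat' (h.1.val.map star)) :=
  symmetricCase_unitary_block (d := complexToMatrixRefl) (h := id)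
    (c := (starInv ℂ).toLinearMap)
    (realMat'_eq_blockEquiv _) (Matrix.map_id _).symm ((mem_Herm_iff _ _).1 hA) (mem_Herm_iff _)
    (isUnitaryGroup_U _ _) (isUnitaryGroup_U _ _) (fun _ => rfl) (fun _ => rfl)
    (isEigenDecomposition_complexToMatrix.neg.comp (bijective_starInv ℂ)
      (g' := LinearMap.mulLeft ℝ Complex.I ∘ₗ (starInv ℂ).toLinearMap)
      (Function.Involutive.bijective fun x => by
        simp [starInv_apply, ← mul_assoc]))
    (fun x a y => by
      simp only [id_eq, LinearMap.comp_apply, complexToMatrixRefl_mul_refl,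
        complexToMatrixLinear_mul_refl, starInv_apply, star_mul, star_star]
      ring_nf)
    (fun x a y => neg_map_mul_mul_of_map_eq_neg matrixConjJ_mul
      (isEigenDecomposition_complexToMatrix.map_right _) x y)
    (fun x => by simp only [LinearMap.comp_apply, adjMap_complexToMatrixRefl, idInv_apply])
    (fun x => by
      simp only [LinearMap.comp_apply, adjMap_complexToMatrixLinear, LinearMap.mulLeft_apply,
        starInv_apply, ← map_neg]
      simp [mul_comm])
    (fun x a y b z => by
      simp only [LinearMap.comp_apply, complexToMatrixRefl_mul_refl,
          complexToMatrixLinear_mul_refl, starInv_apply, star_mul,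
        star_star, LinearMap.mulLeft_apply, ← complexToMatrixLinear_mul]
      congr 1
      simp
      linear_combination (Complex.I * starRingEnd ℂ x * starRingEnd ℂ a * y * b *
        starRingEnd ℂ z) * Complex.I_mul_I)
    (fun a x b => by simp [starInv_apply, idInv_apply]; ring)

/-- Unlike in the orthogonal case, `t` is minus the transposition, so `f(x) = ρ(x̄)` needs no factor
`i`. -/
theorem symmetricCase_realMat'_Sp (hA : A ∈ (idInv ℂ).Aherm m) :
    SymmetricCase ((starInv ℂ).Herm m) ((starInv ℂ).Herm m) (fun X => A * (X * A).map star)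
      ((idInv ℝ).Sp (realMat'_mem_Aherm hA))
      (fun h : (idInv ℂ).Sp hA => realMat' (h.1.val.map star)) :=
  symmetricCase_unitary_block (d := complexToMatrixRefl) (h := id)
    (c := (starInv ℂ).toLinearMap)
    (realMat'_eq_blockEquiv _) (Matrix.map_id _).symm ((mem_Aherm_iff _ _).1 hA) (mem_Herm_iff _)
    (isUnitaryGroup_Sp _ _) (isUnitaryGroup_Sp _ _) (fun _ => rfl) (fun _ => rfl)
    (isEigenDecomposition_complexToMatrix.neg.comp (bijective_starInv ℂ) (bijective_starInv ℂ))
    (fun x a y => by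
      simp only [id_eq, LinearMap.comp_apply, complexToMatrixRefl_mul_refl,
        complexToMatrixLinear_mul_refl, starInv_apply, star_mul, star_star]
      ring_nf)
    (fun x a y => neg_map_mul_mul_of_map_eq_neg matrixConjJ_mul
      (isEigenDecomposition_complexToMatrix.map_right _) x y)
    (fun x => by
      simp only [LinearMap.comp_apply, adjMap_neg, adjMap_complexToMatrixRefl, idInv_apply,
        LinearMap.neg_apply, map_neg])
    (fun x => by
      simp only [LinearMap.comp_apply, adjMap_neg, adjMap_complexToMatrixLinear, starInv_apply])
    (fun x a y b z => by
      simp only [LinearMap.comp_apply, complexToMatrixRefl_mul_refl,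
          complexToMatrixLinear_mul_refl, starInv_apply, star_mul,
        star_star, ← complexToMatrixLinear_mul]
      ring_nf)
    (fun a x b => by simp [starInv_apply, idInv_apply]; ring)

end RealMatrices

end Homotope
end

noncomputable section

namespace Homotope

set_option linter.unusedSectionVars false

/-! ### Quaternions as complex matrices -/

section ComplexMatrices

open RealInvolution

/-- The embedding of `ℍ` into the algebra `M(2, 2; ℂ)`. -/
def quaternionToMatrixLinear : ℍ[ℝ] →ₗ[ℝ] Matrix (Fin 2) (Fin 2) ℂ where
  toFun := quaternionToMatrix
  map_add' x y := by
    ext i j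
    fin_cases i <;> fin_cases j <;> simp [quaternionToMatrix, Complex.ext_iff, add_comm]
  map_smul' c x := by
    ext i j
    fin_cases i <;> fin_cases j <;> simp [quaternionToMatrix, Complex.ext_iff]

theorem quaternionToMatrixLinear_apply (x : ℍ[ℝ]) : quaternionToMatrixLinear x =
    !![⟨x.re, x.imI⟩, ⟨x.imJ, x.imK⟩; -star ⟨x.imJ, x.imK⟩, star ⟨x.re, x.imI⟩] := rfl

theorem quaternionToMatrixLinear_mul (x y : ℍ[ℝ]) : quaternionToMatrixLinear (x * y) =
    quaternionToMatrixLinear x * quaternionToMatrixLinear y := by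
  ext i j
  fin_cases i <;> fin_cases j <;> apply Complex.ext <;>
    simp [quaternionToMatrixLinear_apply, Matrix.mul_apply, Fin.sum_univ_two] <;> ring

/-- The map `x ↦ i x` from `ℍ` to `M(2, 2; ℂ) = ℍ ⊗ ℂ`. -/
def quaternionToMatrixI : ℍ[ℝ] →ₗ[ℝ] Matrix (Fin 2) (Fin 2) ℂ where
  toFun x := Complex.I • quaternionToMatrixLinear x
  map_add' x y := by rw [map_add, smul_add]
  map_smul' c x := by rw [map_smul, smul_comm, RingHom.id_apply]

theorem quaternionToMatrixI_apply (x : ℍ[ℝ]) :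
    quaternionToMatrixI x = Complex.I • quaternionToMatrixLinear x := rfl

theorem quaternionToMatrixLinear_mul_I (x y : ℍ[ℝ]) :
    quaternionToMatrixLinear x * quaternionToMatrixI y = quaternionToMatrixI (x * y) := by
  rw [quaternionToMatrixI_apply, quaternionToMatrixI_apply, mul_smul_comm,
    quaternionToMatrixLinear_mul]

theorem quaternionToMatrixI_mul_linear (x y : ℍ[ℝ]) :
    quaternionToMatrixI x * quaternionToMatrixLinear y = quaternionToMatrixI (x * y) := by
  rw [quaternionToMatrixI_apply, quaternionToMatrixI_apply, smul_mul_assoc,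
    quaternionToMatrixLinear_mul]

theorem quaternionToMatrixI_mul_I (x y : ℍ[ℝ]) :
    quaternionToMatrixI x * quaternionToMatrixI y = quaternionToMatrixLinear (-(x * y)) := by
  rw [quaternionToMatrixI_apply, quaternionToMatrixI_apply, smul_mul_smul_comm, Complex.I_mul_I,
    neg_one_smul, map_neg, quaternionToMatrixLinear_mul]

theorem quaternionToMatrixLinear_injective : Function.Injective quaternionToMatrixLinear :=
  fun x y h => by
    have h1 := congrFun (congrFun h 0) 0
    have h2 := congrFun (congrFun h 0) 1
    exact Quaternion.ext_iff.2 ⟨congrArg Complex.re h1, congrArg Complex.im h1,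
      congrArg Complex.re h2, congrArg Complex.im h2⟩

/-- This is `M(2, 2; ℂ) = κ(ℍ) ⊕ i κ(ℍ)`, the complexification of `ℍ`. -/
theorem isEigenDecomposition_quaternionToMatrix :
    IsEigenDecomposition (matrixConjJ ℂ) quaternionToMatrixLinear quaternionToMatrixI where
  left_injective := quaternionToMatrixLinear_injective
  right_injective x y h :=
    quaternionToMatrixLinear_injective (smul_right_injective _ Complex.I_ne_zero h)
  map_left x := by
    ext i j
    fin_cases i <;> fin_cases j <;> simp [matrixConjJ_apply, quaternionToMatrixLinear_apply]
  map_right x := by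
    ext i j
    fin_cases i <;> fin_cases j <;>
      simp [matrixConjJ_apply, quaternionToMatrixI_apply, quaternionToMatrixLinear_apply]
  exists_add r := ⟨
    quat (((r 0 0).re + (r 1 1).re) / 2) (((r 0 0).im - (r 1 1).im) / 2)
      (((r 0 1).re - (r 1 0).re) / 2) (((r 0 1).im + (r 1 0).im) / 2),
    quat (((r 0 0).im + (r 1 1).im) / 2) (((r 1 1).re - (r 0 0).re) / 2)
      (((r 0 1).im - (r 1 0).im) / 2) (-((r 0 1).re + (r 1 0).re) / 2), by
    ext i j
    fin_cases i <;> fin_cases j <;> apply Complex.ext <;>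
      simp [quaternionToMatrixLinear_apply, quaternionToMatrixI_apply] <;> ring⟩

theorem adjMap_starInv_quaternionToMatrixLinear (x : ℍ[ℝ]) :
    adjMap (starInv ℂ).toLinearMap (quaternionToMatrixLinear x) =
      quaternionToMatrixLinear (star x) := by
  ext i j
  fin_cases i <;> fin_cases j <;> apply Complex.ext <;>
    simp [adjMap_apply, quaternionToMatrixLinear_apply, starInv_apply]

theorem adjMap_idInv_quaternionToMatrixLinear (x : ℍ[ℝ]) :
    adjMap (idInv ℂ).toLinearMap (quaternionToMatrixLinear x) =
      quaternionToMatrixLinear (tildeInv.toLinearMap x) := by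
  rw [tildeInv_quat_apply]
  ext i j
  fin_cases i <;> fin_cases j <;> apply Complex.ext <;>
    simp [adjMap_apply, quaternionToMatrixLinear_apply, idInv_apply]

theorem adjMap_starInv_quaternionToMatrixI (x : ℍ[ℝ]) :
    adjMap (starInv ℂ).toLinearMap (quaternionToMatrixI x) = -quaternionToMatrixI (star x) := by
  rw [quaternionToMatrixI_apply, quaternionToMatrixI_apply,
    ← adjMap_starInv_quaternionToMatrixLinear]
  ext i j
  simp [adjMap_apply, starInv_apply]

theorem adjMap_idInv_quaternionToMatrixI (x : ℍ[ℝ]) :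
    adjMap (idInv ℂ).toLinearMap (quaternionToMatrixI x) =
      quaternionToMatrixI (tildeInv.toLinearMap x) := by
  rw [quaternionToMatrixI_apply, quaternionToMatrixI_apply,
    ← adjMap_idInv_quaternionToMatrixLinear]
  ext i j
  simp [adjMap_apply, idInv_apply]

theorem star_qj : star qj = -qj := by
  ext <;> simp [re_qj, imI_qj, imJ_qj, imK_qj]

/-- Right multiplication by `j` interchanges the two involutions up to sign. This and `star_mul_qj`
let a group defined by one of them sit in a group defined by the other. -/
theorem tildeInv_mul_qj (x : ℍ[ℝ]) :
    tildeInv.toLinearMap (x * qj) = -(star x * qj) := by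
  change conjJ (star (x * qj)) = _
  rw [star_mul, star_qj, ← neg_neg (conjJ _), neg_conjJ, neg_mul, mul_neg, ← mul_assoc, qj_mul_qj,
    neg_one_mul, neg_neg]

theorem mul_qj_mul_qj_mul (x a : ℍ[ℝ]) : x * qj * (qj * a) = -(x * a) := by
  rw [mul_assoc, ← mul_assoc qj, qj_mul_qj, neg_one_mul, mul_neg]

theorem star_mul_qj (x : ℍ[ℝ]) : star (x * qj) = -(tildeInv.toLinearMap x * qj) := by
  change _ = -(conjJ (star x) * qj)
  rw [← neg_mul, neg_conjJ, star_mul, star_qj, mul_assoc, qj_mul_qj, neg_mul, mul_neg_one]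

theorem bijective_mul_qj : Function.Bijective (LinearMap.mulRight ℝ qj) := by
  have h : ∀ x : ℍ[ℝ], x * qj * qj = -x := fun x => by
    rw [mul_assoc, qj_mul_qj, mul_neg_one]
  refine ⟨fun x y hxy => ?_, fun x => ⟨-(x * qj), ?_⟩⟩
  · have h1 := congrArg (fun x => x * qj) hxy
    simpa [h] using h1
  · rw [LinearMap.mulRight_apply, neg_mul, h, neg_neg]

theorem bijective_quatConjJ : Function.Bijective quatConjJ :=
  Function.Involutive.bijective conjJ_conjJ

theorem bijective_neg_mul_qj : Function.Bijective (-LinearMap.mulRight ℝ qj) :=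
  (neg_bijective).comp bijective_mul_qj

theorem starInv_conjJ (a x b : ℍ[ℝ]) :
    (starInv ℍ[ℝ]).toLinearMap (a * quatConjJ (x * b)) = tildeInv.toLinearMap b *
      quatConjJ ((starInv ℍ[ℝ]).toLinearMap x * tildeInv.toLinearMap a) := by
  simpa using starInv_neg_conjJ a x b

theorem tildeInv_conjJ (a x b : ℍ[ℝ]) :
    tildeInv.toLinearMap (a * quatConjJ (x * b)) = (starInv ℍ[ℝ]).toLinearMap b *
      quatConjJ (tildeInv.toLinearMap x * (starInv ℍ[ℝ]).toLinearMap a) := by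
  simpa using tildeInv_neg_conjJ a x b

theorem involution_neg_id {R : Type*} [Ring R] [Algebra ℝ R] (δ : RealInvolution R) (a x b : R) :
    δ.toLinearMap (a * (-LinearMap.id : R →ₗ[ℝ] R) (x * b)) = δ.toLinearMap b *
      (-LinearMap.id : R →ₗ[ℝ] R) (δ.toLinearMap x * δ.toLinearMap a) := by
  have h : ∀ x y, δ.toLinearMap (x * y) = δ.toLinearMap y * δ.toLinearMap x := δ.map_mul'
  simp only [LinearMap.neg_apply, LinearMap.id_apply, mul_neg, map_neg, h, mul_assoc]

variable {m n : Type*} [Fintype m] [Fintype n] [DecidableEq m] [DecidableEq n]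

theorem complexMat_eq_blockEquiv (X : Matrix m m ℍ[ℝ]) :
    complexMat X = blockEquiv m ℂ (X.map quaternionToMatrixLinear) := rfl

/-- The matrix `J` is `κ(j)`, so multiplying by `J` amounts to multiplying quaternionic entries by
`j`. -/
theorem matJ_eq_blockEquiv : matJ m =
    blockEquiv m ℂ ((1 : Matrix m m ℍ[ℝ]).map fun x => quaternionToMatrixLinear (x * qj)) := by
  rw [matJ, blockEquiv_apply, Matrix.fromBlocks_inj]
  refine ⟨?_, ?_, ?_, ?_⟩ <;> ext i j <;> rcases eq_or_ne i j with rfl | h <;>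
    simp [quaternionToMatrixLinear_apply, re_qj, imI_qj, imJ_qj, imK_qj, Complex.ext_iff, *]

theorem complexMat_mul_matJ (X : Matrix m m ℍ[ℝ]) : complexMat X * matJ m =
    blockEquiv m ℂ (X.map fun x => quaternionToMatrixLinear (x * qj)) := by
  rw [complexMat_eq_blockEquiv, matJ_eq_blockEquiv, ← blockEquiv_mul]
  congr 1
  ext1 i j
  simp [Matrix.mul_apply, Matrix.one_apply, ← quaternionToMatrixLinear_mul, ← map_sum]

theorem matJ_mul_complexMat (X : Matrix m m ℍ[ℝ]) : matJ m * complexMat X =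
    blockEquiv m ℂ (X.map fun x => quaternionToMatrixLinear (qj * x)) := by
  rw [complexMat_eq_blockEquiv, matJ_eq_blockEquiv, ← blockEquiv_mul]
  congr 1
  ext1 i j
  simp [Matrix.mul_apply, Matrix.one_apply, ← quaternionToMatrixLinear_mul, ← map_sum]

theorem I_smul_blockEquiv (X : Matrix m m (Matrix (Fin 2) (Fin 2) ℂ)) :
    Complex.I • blockEquiv m ℂ X = blockEquiv m ℂ (X.map fun x => Complex.I • x) := by
  rw [blockEquiv_apply, blockEquiv_apply, Matrix.fromBlocks_smul]
  rfl

theorem symmetricCase_top_complexMatrix (A : Matrix n m ℍ[ℝ]) :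
    SymmetricCase ⊤ ⊤ (fun X : Matrix m n ℍ[ℝ] => -(A * X * A))
      (⊤ : Subgroup (Gl (A.map quaternionToMatrix)))
      (fun h : Gl A => h.val.map quaternionToMatrix) :=
  symmetricCase_top_entrywise A (d := quaternionToMatrixLinear)
    isEigenDecomposition_quaternionToMatrix
    (fun x a y => by rw [quaternionToMatrixLinear_mul, quaternionToMatrixLinear_mul])
    (fun x a y => map_mul_mul_of_map_eq matrixConjJ_mul
      (isEigenDecomposition_quaternionToMatrix.map_left a) x y)
    (fun x a y b z => by
      simp only [quaternionToMatrixI_mul_linear, quaternionToMatrixI_mul_I,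
        quaternionToMatrixLinear_mul_I, LinearMap.neg_apply, LinearMap.id_apply]
      noncomm_ring)
    (neg_mul_mul_eq A)

variable {A : Matrix m m ℍ[ℝ]}

theorem symmetricCase_complexMat_starInv (hA : A ∈ (starInv ℍ[ℝ]).Herm m) :
    SymmetricCase ((starInv ℍ[ℝ]).Herm m) ((starInv ℍ[ℝ]).Herm m) (fun X => -(A * X * A))
      ((starInv ℂ).U (complexMat_mem_Herm_star hA))
      (fun h : (starInv ℍ[ℝ]).U hA => complexMat h.1.val) :=
  symmetricCase_unitary_block (d := quaternionToMatrixLinear) (h := id)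
    (complexMat_eq_blockEquiv _) (Matrix.map_id _).symm ((mem_Herm_iff _ _).1 hA) (mem_Herm_iff _)
    (isUnitaryGroup_U _ _) (isUnitaryGroup_U _ _) (fun _ => rfl) (neg_mul_mul_eq A)
    isEigenDecomposition_quaternionToMatrix
    (fun x a y => by simp only [id_eq, quaternionToMatrixLinear_mul])
    (fun x a y => map_mul_mul_of_map_eq matrixConjJ_mul
      (isEigenDecomposition_quaternionToMatrix.map_left _) x y)
    adjMap_starInv_quaternionToMatrixLinear adjMap_starInv_quaternionToMatrixI
    (fun x a y b z => by
      simp only [quaternionToMatrixI_mul_linear, quaternionToMatrixI_mul_I,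
        quaternionToMatrixLinear_mul_I, LinearMap.neg_apply, LinearMap.id_apply]
      noncomm_ring)
    (involution_neg_id _)

theorem symmetricCase_complexMat_tildeInv (hA : A ∈ tildeInv.Herm m) :
    SymmetricCase ((starInv ℍ[ℝ]).Herm m) ((starInv ℍ[ℝ]).Herm m)
      (fun X => A * (X * A).map conjJ)
      ((idInv ℂ).U (complexMat_mem_Herm_id hA))
      (fun h : tildeInv.U hA => complexMat h.1.val) :=
  symmetricCase_unitary_block (d := quaternionToMatrixLinear) (h := id) (c := quatConjJ)
    (complexMat_eq_blockEquiv _) (Matrix.map_id _).symm ((mem_Herm_iff _ _).1 hA) (mem_Herm_iff _)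
    (isUnitaryGroup_U _ _) (isUnitaryGroup_U _ _) (fun _ => rfl) (fun _ => rfl)
    (isEigenDecomposition_quaternionToMatrix.comp (g := LinearMap.id) Function.bijective_id
      bijective_qj_mul)
    (fun x a y => by
      simp only [id_eq, LinearMap.comp_apply, LinearMap.id_apply, quaternionToMatrixLinear_mul])
    (fun x a y => map_mul_mul_of_map_eq matrixConjJ_mul
      (isEigenDecomposition_quaternionToMatrix.map_left _) x y)
    adjMap_idInv_quaternionToMatrixLinear
    (fun x => by
      rw [LinearMap.comp_apply, LinearMap.comp_apply, adjMap_idInv_quaternionToMatrixI, ← map_neg,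
        tildeInv_quat_apply]
      congr 1
      ext <;> simp [starInv_apply, re_qj, imI_qj, imJ_qj, imK_qj])
    (fun x a y b z => by
      simp only [LinearMap.comp_apply, quaternionToMatrixI_mul_linear, quaternionToMatrixI_mul_I,
        quaternionToMatrixLinear_mul_I]
      congr 1
      -- Here `f(x) = i κ(j x)`: the sign from `i²` cancels the one in `-θ`.
      have h := qj_mul_mul x a y b z
      rw [LinearMap.neg_apply, mul_neg, neg_mul, map_neg, neg_eq_iff_eq_neg] at h
      rw [h]
      noncomm_ring)
    starInv_conjJ

/-- The parameter `i κ(j a)` lies in the `-1`-eigenspace of `matrixConjJ`, so the eigenspaces change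
roles: `e(x) = i κ(x j)` and `f(x) = κ(x j)`. -/
theorem symmetricCase_complexMat_mul_I_matJ (hA : A ∈ tildeInv.Herm m) :
    SymmetricCase (tildeInv.Herm m) (tildeInv.Herm m) (fun X => -(A * X * A))
      ((starInv ℂ).U (I_smul_J_mul_mem_Herm hA))
      (fun h : tildeInv.U hA => complexMat h.1.val * (Complex.I • matJ m)) :=
  symmetricCase_unitary_block (d := fun a => quaternionToMatrixI (qj * a)) (h := id)
    (by rw [matJ_mul_complexMat, I_smul_blockEquiv]; rfl)
    (Matrix.map_id _).symm ((mem_Herm_iff _ _).1 hA) (mem_Herm_iff _)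
    (isUnitaryGroup_U _ _) (isUnitaryGroup_U _ _)
    (fun x => by rw [mul_smul_comm, complexMat_mul_matJ, I_smul_blockEquiv]; rfl)
    (neg_mul_mul_eq A)
    (isEigenDecomposition_quaternionToMatrix.neg.comp bijective_mul_qj bijective_mul_qj)
    (fun x a y => by
      simp only [id_eq, LinearMap.comp_apply, LinearMap.mulRight_apply,
        quaternionToMatrixLinear_mul_I, quaternionToMatrixI_mul_I]
      congr 1
      rw [mul_qj_mul_qj_mul]
      noncomm_ring)
    (fun x a y => neg_map_mul_mul_of_map_eq_neg matrixConjJ_mul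
      (isEigenDecomposition_quaternionToMatrix.map_right _) x y)
    (fun x => by
      simp only [LinearMap.comp_apply, LinearMap.mulRight_apply,
        adjMap_starInv_quaternionToMatrixI, star_mul_qj, map_neg, neg_neg])
    (fun x => by
      simp only [LinearMap.comp_apply, LinearMap.mulRight_apply,
        adjMap_starInv_quaternionToMatrixLinear, star_mul_qj, map_neg])
    (fun x a y b z => by
      simp only [LinearMap.comp_apply, LinearMap.mulRight_apply, quaternionToMatrixLinear_mul_I,
        ← quaternionToMatrixLinear_mul, quaternionToMatrixI_mul_I, LinearMap.neg_apply,
        LinearMap.id_apply, mul_qj_mul_qj_mul]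
      congr 1
      noncomm_ring)
    (involution_neg_id _)

/-- The sign in `e(x) = -κ(x j)` compensates `j² = -1` in `x j (j a) y j`. In `f(x) = i κ(θ x)` the
map `θ` allows `j` to move across `x`, since `θ(x) j = j x`. -/
theorem symmetricCase_complexMat_mul_matJ (hA : A ∈ (starInv ℍ[ℝ]).Herm m) :
    SymmetricCase (tildeInv.Herm m) (tildeInv.Herm m) (fun X => A * (X * A).map conjJ)
      ((idInv ℂ).Sp (J_mul_mem_Aherm hA))
      (fun h : (starInv ℍ[ℝ]).U hA => -(complexMat h.1.val * matJ m)) :=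
  symmetricCase_unitary_block (d := fun a => quaternionToMatrixLinear (qj * a)) (h := id)
    (c := quatConjJ) (matJ_mul_complexMat _)
    (Matrix.map_id _).symm ((mem_Herm_iff _ _).1 hA) (mem_Herm_iff _)
    (isUnitaryGroup_Sp _ _) (isUnitaryGroup_U _ _)
    (fun x => by
      rw [complexMat_mul_matJ, ← map_neg]
      congr 1
      ext1 i j
      exact (map_neg quaternionToMatrixLinear _).symm)
    (fun _ => rfl)
    (isEigenDecomposition_quaternionToMatrix.comp bijective_neg_mul_qj bijective_quatConjJ)
    (fun x a y => by
      simp only [id_eq, LinearMap.comp_apply, LinearMap.neg_apply, LinearMap.mulRight_apply,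
        ← quaternionToMatrixLinear_mul, mul_qj_mul_qj_mul, neg_mul, neg_neg, mul_neg]
      rw [mul_assoc (x * a)])
    (fun x a y => map_mul_mul_of_map_eq matrixConjJ_mul
      (isEigenDecomposition_quaternionToMatrix.map_left _) x y)
    (fun x => by
      simp only [LinearMap.comp_apply, LinearMap.neg_apply, LinearMap.mulRight_apply, adjMap_neg,
        map_neg, adjMap_idInv_quaternionToMatrixLinear, tildeInv_mul_qj, starInv_apply, neg_neg])
    (fun x => by
      rw [LinearMap.comp_apply, LinearMap.comp_apply, adjMap_neg,
        adjMap_idInv_quaternionToMatrixI]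
      change -quaternionToMatrixI (conjJ (star (conjJ x))) =
        -quaternionToMatrixI (conjJ (conjJ (star x)))
      rw [star_conjJ])
    (fun x a y b z => by
      have h : ∀ x : ℍ[ℝ], quatConjJ x = -(qj * x * qj) := fun x => by
        rw [← neg_conjJ, neg_neg]
        rfl
      have h' : ∀ x : ℍ[ℝ], qj * (qj * x) = -x := fun x => by
        rw [← mul_assoc, qj_mul_qj, neg_one_mul]
      simp only [LinearMap.comp_apply, quaternionToMatrixI_mul_linear, quaternionToMatrixI_mul_I,
        quaternionToMatrixLinear_mul_I, h]
      simp only [mul_neg, neg_mul, neg_neg, mul_assoc, h'])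
    tildeInv_conjJ

end ComplexMatrices

end Homotope
end

noncomputable section

namespace Homotope

set_option linter.unusedSectionVars false

/-! ### General linear groups modulo unitary groups -/

namespace RealInvolution

variable {m R : Type*} [Fintype m] [DecidableEq m] [NormedRing R] [NormedAlgebra ℝ R]
  [FiniteDimensional ℝ R] (δ : RealInvolution R) {A : Matrix m m R}

theorem map_mul_mul (a x b : R) : δ.toLinearMap (a * (x * b)) =
    δ.toLinearMap b * (δ.toLinearMap x * δ.toLinearMap a) := by
  have h : ∀ x y, δ.toLinearMap (x * y) = δ.toLinearMap y * δ.toLinearMap x := δ.map_mul'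
  rw [h, h, mul_assoc]

theorem symmetricCase_top_U (hA : A ∈ δ.Herm m) :
    SymmetricCase (δ.Herm m) (δ.Herm m) (fun X => A * X * A) (⊤ : Subgroup (Gl A))
      (fun h : δ.U hA => h.1.val) :=
  symmetricCase_top_of_unitary_entrywise ((mem_Herm_iff _ _).1 hA) (mem_Herm_iff _)
    (isUnitaryGroup_U _ hA) (fun _ => rfl) δ.map_mul_mul

theorem symmetricCase_top_Sp (hA : A ∈ δ.Aherm m) :
    SymmetricCase (δ.Aherm m) (δ.Aherm m) (fun X => A * X * A) (⊤ : Subgroup (Gl A))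
      (fun h : δ.Sp hA => h.1.val) :=
  symmetricCase_top_of_unitary_entrywise ((mem_Aherm_iff _ _).1 hA) (mem_Aherm_iff _)
    (isUnitaryGroup_Sp _ hA) (fun _ => rfl) (fun a x b => by
      simp only [LinearMap.neg_apply, δ.map_mul_mul, neg_mul, mul_neg, neg_neg])

end RealInvolution

/-! ### Unitary groups over `𝕜[i]` modulo unitary groups over `𝕜` -/

namespace AdjI

open RealInvolution

variable {m 𝕜 : Type*} [Fintype m] [DecidableEq m] [RCLike 𝕜] {A : Matrix m m 𝕜}

theorem starInv_mulI (x : 𝕜) : (starInv (AdjI 𝕜)).toLinearMap (mulI 𝕜 x) = -mulI 𝕜 x :=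
  isEigenDecomposition.map_right x

/-- The four cases of this section differ by the signs of `t` on `𝕜` and on `𝕜 i`. The first is that
of `tK` in the subgroup; the second, negated, is `tV` and decides between symmetric and
skew-symmetric `V⁺`. -/
theorem symmetricCase_starInv_U (hA : A ∈ (idInv 𝕜).Herm m) :
    SymmetricCase ((idInv 𝕜).Herm m) ((idInv 𝕜).Herm m) (fun X => -(A * X * A))
      ((starInv (AdjI 𝕜)).U (map_mem_Herm starInv_algebraMap hA))
      (fun h : (idInv 𝕜).U hA => h.1.val.map (algebraMap 𝕜 (AdjI 𝕜))) :=
  symmetricCase_unitary ((mem_Herm_iff _ _).1 hA) (mem_Herm_iff _)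
    (isUnitaryGroup_U _ _) (isUnitaryGroup_U _ hA) (Or.inl fun _ => rfl) (Or.inl fun _ => rfl)
    starInv_algebraMap starInv_mulI

theorem symmetricCase_idInv_Sp (hA : A ∈ (idInv 𝕜).Aherm m) :
    SymmetricCase ((idInv 𝕜).Herm m) ((idInv 𝕜).Herm m) (fun X => -(A * X * A))
      ((idInv (AdjI 𝕜)).Sp (map_mem_Aherm idInv_algebraMap (map_neg _) hA))
      (fun h : (idInv 𝕜).Sp hA => h.1.val.map (algebraMap 𝕜 (AdjI 𝕜))) :=
  symmetricCase_unitary ((mem_Aherm_iff _ _).1 hA) (mem_Herm_iff _)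
    (isUnitaryGroup_Sp _ _) (isUnitaryGroup_Sp _ hA) (Or.inl fun _ => rfl) (Or.inr fun _ => rfl)
    (fun x => (map_neg (ofBase 𝕜) x).symm) (fun _ => rfl)

theorem symmetricCase_starInv_Sp (hA : A ∈ (idInv 𝕜).Aherm m) :
    SymmetricCase ((idInv 𝕜).Aherm m) ((idInv 𝕜).Aherm m) (fun X => -(A * X * A))
      ((starInv (AdjI 𝕜)).Sp (map_mem_Aherm starInv_algebraMap (map_neg _) hA))
      (fun h : (idInv 𝕜).Sp hA => h.1.val.map (algebraMap 𝕜 (AdjI 𝕜))) :=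
  symmetricCase_unitary ((mem_Aherm_iff _ _).1 hA) (mem_Aherm_iff _)
    (isUnitaryGroup_Sp _ _) (isUnitaryGroup_Sp _ hA) (Or.inr fun _ => rfl) (Or.inr fun _ => rfl)
    (fun x => (congrArg Neg.neg (starInv_algebraMap x)).trans (map_neg (ofBase 𝕜) x).symm)
    (fun x => by
      rw [LinearMap.neg_apply, LinearMap.neg_apply, starInv_mulI, map_neg]
      rfl)

theorem symmetricCase_idInv_U (hA : A ∈ (idInv 𝕜).Herm m) :
    SymmetricCase ((idInv 𝕜).Aherm m) ((idInv 𝕜).Aherm m) (fun X => -(A * X * A))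
      ((idInv (AdjI 𝕜)).U (map_mem_Herm idInv_algebraMap hA))
      (fun h : (idInv 𝕜).U hA => h.1.val.map (algebraMap 𝕜 (AdjI 𝕜))) :=
  symmetricCase_unitary ((mem_Herm_iff _ _).1 hA) (mem_Aherm_iff _)
    (isUnitaryGroup_U _ _) (isUnitaryGroup_U _ hA) (Or.inr fun _ => rfl) (Or.inl fun _ => rfl)
    idInv_algebraMap (fun x => by
      rw [LinearMap.neg_apply, map_neg, neg_neg]
      rfl)

end AdjI

end Homotope
end

/-! ### The classification. -/

theorem mainTheorem6 {𝕜 : Type*} [RCLike 𝕜] (p q n : ℕ) :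
    -- 1.a
    (∀ A : Matrix (Fin q) (Fin p) 𝕜,
      GroupCase ⊤ ⊤ (fun X : Matrix (Fin p) (Fin q) 𝕜 => A * X * A) (⊤ : Subgroup (Gl A))) ∧
    -- 1.a'
    (∀ A : Matrix (Fin q) (Fin p) 𝕜,
      SymmetricCase ⊤ ⊤ (fun X : Matrix (Fin p) (Fin q) 𝕜 => -(A * X * A))
        (⊤ : Subgroup (Gl (A.map (algebraMap 𝕜 (AdjI 𝕜)))))
        (fun h : Gl A => h.val.map (algebraMap 𝕜 (AdjI 𝕜)))) ∧
    -- 1.b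
    (∀ (A : Matrix (Fin p) (Fin p) 𝕜) (B : Matrix (Fin q) (Fin q) 𝕜)
      (hA : A ∈ (idInv 𝕜).Herm (Fin p)) (hB : B ∈ (idInv 𝕜).Herm (Fin q)),
      SymmetricCase ⊤ ⊤ (fun X : Matrix (Fin p) (Fin q) 𝕜 => -(B * (idInv 𝕜).adj X * A))
        ((idInv 𝕜).U (fromBlocks_mem_Herm hA hB))
        (fun h : (idInv 𝕜).U hA × (idInv 𝕜).U hB =>
          Matrix.fromBlocks h.1.1.val 0 0 h.2.1.val)) ∧
    -- 1.c
    (∀ (A : Matrix (Fin p) (Fin p) 𝕜) (B : Matrix (Fin q) (Fin q) 𝕜)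
      (hA : A ∈ (idInv 𝕜).Aherm (Fin p)) (hB : B ∈ (idInv 𝕜).Aherm (Fin q)),
      SymmetricCase ⊤ ⊤ (fun X : Matrix (Fin p) (Fin q) 𝕜 => B * (idInv 𝕜).adj X * A)
        ((idInv 𝕜).Sp (fromBlocks_mem_Aherm hA hB))
        (fun h : (idInv 𝕜).Sp hA × (idInv 𝕜).Sp hB =>
          Matrix.fromBlocks h.1.1.val 0 0 h.2.1.val)) ∧
    -- 1.A
    (∀ A : Matrix (Fin q) (Fin p) ℂ,
      SymmetricCase ⊤ ⊤ (fun X : Matrix (Fin p) (Fin q) ℂ => A * (X * A).map star)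
        (⊤ : Subgroup (Gl (A.map complexToMatrix)))
        (fun h : Gl A => h.val.map complexToMatrix)) ∧
    -- 1.A'
    (∀ A : Matrix (Fin q) (Fin p) ℂ,
      SymmetricCase ⊤ ⊤ (fun X : Matrix (Fin p) (Fin q) ℂ => -(A * (X * A).map star))
        (⊤ : Subgroup (Gl (A.map (fun z => (z : ℍ[ℝ])))))
        (fun h : Gl A => h.val.map (fun z => (z : ℍ[ℝ])))) ∧
    -- 1.B
    (∀ (A : Matrix (Fin p) (Fin p) ℂ) (B : Matrix (Fin q) (Fin q) ℂ)
      (hA : A ∈ (starInv ℂ).Herm (Fin p)) (hB : B ∈ (starInv ℂ).Herm (Fin q)),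
      SymmetricCase ⊤ ⊤ (fun X : Matrix (Fin p) (Fin q) ℂ => -(B * (starInv ℂ).adj X * A))
        ((starInv ℂ).U (fromBlocks_mem_Herm hA hB))
        (fun h : (starInv ℂ).U hA × (starInv ℂ).U hB =>
          Matrix.fromBlocks h.1.1.val 0 0 h.2.1.val)) ∧
    -- 1.3.a
    (∀ A : Matrix (Fin q) (Fin p) ℍ[ℝ],
      GroupCase ⊤ ⊤ (fun X : Matrix (Fin p) (Fin q) ℍ[ℝ] => A * X * A) (⊤ : Subgroup (Gl A))) ∧
    -- 1.3.a'
    (∀ A : Matrix (Fin q) (Fin p) ℍ[ℝ],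
      SymmetricCase ⊤ ⊤ (fun X : Matrix (Fin p) (Fin q) ℍ[ℝ] => -(A * X * A))
        (⊤ : Subgroup (Gl (A.map quaternionToMatrix)))
        (fun h : Gl A => h.val.map quaternionToMatrix)) ∧
    -- 1.3.b
    (∀ (A : Matrix (Fin p) (Fin p) ℍ[ℝ]) (B : Matrix (Fin q) (Fin q) ℍ[ℝ])
      (hA : A ∈ (starInv ℍ[ℝ]).Herm (Fin p)) (hB : B ∈ (starInv ℍ[ℝ]).Herm (Fin q)),
      SymmetricCase ⊤ ⊤ (fun X : Matrix (Fin p) (Fin q) ℍ[ℝ] => -(B * (starInv ℍ[ℝ]).adj X * A))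
        ((starInv ℍ[ℝ]).U (fromBlocks_mem_Herm hA hB))
        (fun h : (starInv ℍ[ℝ]).U hA × (starInv ℍ[ℝ]).U hB =>
          Matrix.fromBlocks h.1.1.val 0 0 h.2.1.val)) ∧
    -- 1.3.c
    (∀ (A : Matrix (Fin p) (Fin p) ℍ[ℝ]) (B : Matrix (Fin q) (Fin q) ℍ[ℝ])
      (hA : A ∈ tildeInv.Herm (Fin p)) (hB : B ∈ tildeInv.Herm (Fin q)),
      SymmetricCase ⊤ ⊤ (fun X : Matrix (Fin p) (Fin q) ℍ[ℝ] => -(B * tildeInv.adj X * A))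
        (tildeInv.U (fromBlocks_mem_Herm hA hB))
        (fun h : tildeInv.U hA × tildeInv.U hB =>
          Matrix.fromBlocks h.1.1.val 0 0 h.2.1.val)) ∧
    -- 2.a
    (∀ (A : Matrix (Fin n) (Fin n) 𝕜) (hA : A ∈ (idInv 𝕜).Herm (Fin n)),
      SymmetricCase ((idInv 𝕜).Herm (Fin n)) ((idInv 𝕜).Herm (Fin n)) (fun X => A * X * A)
        (⊤ : Subgroup (Gl A)) (fun h : (idInv 𝕜).U hA => h.1.val)) ∧
    -- 2.a'
    (∀ (A : Matrix (Fin n) (Fin n) 𝕜) (hA : A ∈ (idInv 𝕜).Herm (Fin n)),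
      SymmetricCase ((idInv 𝕜).Herm (Fin n)) ((idInv 𝕜).Herm (Fin n)) (fun X => -(A * X * A))
        ((starInv (AdjI 𝕜)).U (map_mem_Herm starInv_algebraMap hA))
        (fun h : (idInv 𝕜).U hA => h.1.val.map (algebraMap 𝕜 (AdjI 𝕜)))) ∧
    -- 2.b
    (∀ (A : Matrix (Fin n) (Fin n) 𝕜) (hA : A ∈ (idInv 𝕜).Aherm (Fin n)),
      GroupCase ((idInv 𝕜).Herm (Fin n)) ((idInv 𝕜).Herm (Fin n)) (fun X => A * X * A)
        ((idInv 𝕜).Sp hA)) ∧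
    -- 2.b'
    (∀ (A : Matrix (Fin n) (Fin n) 𝕜) (hA : A ∈ (idInv 𝕜).Aherm (Fin n)),
      SymmetricCase ((idInv 𝕜).Herm (Fin n)) ((idInv 𝕜).Herm (Fin n)) (fun X => -(A * X * A))
        ((idInv (AdjI 𝕜)).Sp (map_mem_Aherm idInv_algebraMap (map_neg _) hA))
        (fun h : (idInv 𝕜).Sp hA => h.1.val.map (algebraMap 𝕜 (AdjI 𝕜)))) ∧
    -- 2.A
    (∀ (A : Matrix (Fin n) (Fin n) ℂ) (hA : A ∈ (starInv ℂ).Herm (Fin n)),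
      SymmetricCase ((idInv ℂ).Herm (Fin n)) ((idInv ℂ).Herm (Fin n))
        (fun X => -(A * (X * A).map star))
        ((starInv ℍ[ℝ]).U (map_mem_Herm starInv_coeComplex hA))
        (fun h : (starInv ℂ).U hA => h.1.val.map (fun z => (z : ℍ[ℝ])))) ∧
    -- 2.A'
    (∀ (A : Matrix (Fin n) (Fin n) ℂ) (hA : A ∈ (starInv ℂ).Herm (Fin n)),
      SymmetricCase ((idInv ℂ).Herm (Fin n)) ((idInv ℂ).Herm (Fin n))
        (fun X => A * (X * A).map star)
        ((idInv ℝ).Sp (realMat_mem_Aherm (I_smul_conj_mem_Aherm hA)))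
        (fun h : (starInv ℂ).Sp (I_smul_conj_mem_Aherm hA) => realMat h.1.val)) ∧
    -- 3.a
    (∀ (A : Matrix (Fin n) (Fin n) 𝕜) (hA : A ∈ (idInv 𝕜).Aherm (Fin n)),
      SymmetricCase ((idInv 𝕜).Aherm (Fin n)) ((idInv 𝕜).Aherm (Fin n)) (fun X => A * X * A)
        (⊤ : Subgroup (Gl A)) (fun h : (idInv 𝕜).Sp hA => h.1.val)) ∧
    -- 3.a'
    (∀ (A : Matrix (Fin n) (Fin n) 𝕜) (hA : A ∈ (idInv 𝕜).Aherm (Fin n)),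
      SymmetricCase ((idInv 𝕜).Aherm (Fin n)) ((idInv 𝕜).Aherm (Fin n)) (fun X => -(A * X * A))
        ((starInv (AdjI 𝕜)).Sp (map_mem_Aherm starInv_algebraMap (map_neg _) hA))
        (fun h : (idInv 𝕜).Sp hA => h.1.val.map (algebraMap 𝕜 (AdjI 𝕜)))) ∧
    -- 3.b
    (∀ (A : Matrix (Fin n) (Fin n) 𝕜) (hA : A ∈ (idInv 𝕜).Herm (Fin n)),
      GroupCase ((idInv 𝕜).Aherm (Fin n)) ((idInv 𝕜).Aherm (Fin n)) (fun X => A * X * A)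
        ((idInv 𝕜).U hA)) ∧
    -- 3.b'
    (∀ (A : Matrix (Fin n) (Fin n) 𝕜) (hA : A ∈ (idInv 𝕜).Herm (Fin n)),
      SymmetricCase ((idInv 𝕜).Aherm (Fin n)) ((idInv 𝕜).Aherm (Fin n)) (fun X => -(A * X * A))
        ((idInv (AdjI 𝕜)).U (map_mem_Herm idInv_algebraMap hA))
        (fun h : (idInv 𝕜).U hA => h.1.val.map (algebraMap 𝕜 (AdjI 𝕜)))) ∧
    -- 3.A
    (∀ (A : Matrix (Fin n) (Fin n) ℂ) (hA : A ∈ (starInv ℂ).Herm (Fin n)),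
      SymmetricCase ((idInv ℂ).Aherm (Fin n)) ((idInv ℂ).Aherm (Fin n))
        (fun X => -(A * (X * A).map star))
        (tildeInv.U (map_mem_Herm tildeInv_complexJ hA))
        (fun h : (starInv ℂ).U hA => h.1.val.map complexJ)) ∧
    -- 3.A'
    (∀ (A : Matrix (Fin n) (Fin n) ℂ) (hA : A ∈ (starInv ℂ).Herm (Fin n)),
      SymmetricCase ((idInv ℂ).Aherm (Fin n)) ((idInv ℂ).Aherm (Fin n))
        (fun X => A * (X * A).map star)
        ((idInv ℝ).U (realMat_mem_Herm hA))
        (fun h : (starInv ℂ).U hA => realMat h.1.val)) ∧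
    -- 1.1.a
    (∀ (A : Matrix (Fin n) (Fin n) ℂ) (hA : A ∈ (starInv ℂ).Herm (Fin n)),
      SymmetricCase ((starInv ℂ).Herm (Fin n)) ((starInv ℂ).Herm (Fin n)) (fun X => A * X * A)
        (⊤ : Subgroup (Gl A)) (fun h : (starInv ℂ).U hA => h.1.val)) ∧
    -- 1.1.a'
    (∀ (A : Matrix (Fin n) (Fin n) ℂ) (hA : A ∈ (starInv ℂ).Herm (Fin n)),
      GroupCase ((starInv ℂ).Herm (Fin n)) ((starInv ℂ).Herm (Fin n)) (fun X => -(A * X * A))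
        ((starInv ℂ).U hA)) ∧
    -- 1.1.b
    (∀ (A : Matrix (Fin n) (Fin n) ℂ) (hA : A ∈ (idInv ℂ).Herm (Fin n)),
      SymmetricCase ((starInv ℂ).Herm (Fin n)) ((starInv ℂ).Herm (Fin n))
        (fun X => -(A * (X * A).map star))
        (tildeInv.U (map_mem_Herm tildeInv_coeComplex hA))
        (fun h : (idInv ℂ).U hA => h.1.val.map (fun z => (z : ℍ[ℝ])))) ∧
    -- 1.1.b'
    (∀ (A : Matrix (Fin n) (Fin n) ℂ) (hA : A ∈ (idInv ℂ).Herm (Fin n)),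
      SymmetricCase ((starInv ℂ).Herm (Fin n)) ((starInv ℂ).Herm (Fin n))
        (fun X => A * (X * A).map star)
        ((idInv ℝ).U (realMat'_mem_Herm hA))
        (fun h : (idInv ℂ).U hA => realMat' (h.1.val.map star))) ∧
    -- 1.1.c
    (∀ (A : Matrix (Fin n) (Fin n) ℂ) (hA : A ∈ (idInv ℂ).Aherm (Fin n)),
      SymmetricCase ((starInv ℂ).Herm (Fin n)) ((starInv ℂ).Herm (Fin n))
        (fun X => A * (X * A).map star)
        ((idInv ℝ).Sp (realMat'_mem_Aherm hA))
        (fun h : (idInv ℂ).Sp hA => realMat' (h.1.val.map star))) ∧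
    -- 1.1.c'
    (∀ (A : Matrix (Fin n) (Fin n) ℂ) (hA : A ∈ (idInv ℂ).Aherm (Fin n)),
      SymmetricCase ((starInv ℂ).Herm (Fin n)) ((starInv ℂ).Herm (Fin n))
        (fun X => -(A * (X * A).map star))
        ((starInv ℍ[ℝ]).U (qj_smul_mem_Herm hA))
        (fun h : (idInv ℂ).Sp hA => h.1.val.map (fun z => -((z : ℍ[ℝ]) * qj)))) ∧
    -- 3.1.a
    (∀ (A : Matrix (Fin n) (Fin n) ℍ[ℝ]) (hA : A ∈ (starInv ℍ[ℝ]).Herm (Fin n)),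
      SymmetricCase ((starInv ℍ[ℝ]).Herm (Fin n)) ((starInv ℍ[ℝ]).Herm (Fin n))
        (fun X => A * X * A)
        (⊤ : Subgroup (Gl A)) (fun h : (starInv ℍ[ℝ]).U hA => h.1.val)) ∧
    -- 3.1.a'
    (∀ (A : Matrix (Fin n) (Fin n) ℍ[ℝ]) (hA : A ∈ (starInv ℍ[ℝ]).Herm (Fin n)),
      SymmetricCase ((starInv ℍ[ℝ]).Herm (Fin n)) ((starInv ℍ[ℝ]).Herm (Fin n))
        (fun X => -(A * X * A))
        ((starInv ℂ).U (complexMat_mem_Herm_star hA))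
        (fun h : (starInv ℍ[ℝ]).U hA => complexMat h.1.val)) ∧
    -- 3.1.b
    (∀ (A : Matrix (Fin n) (Fin n) ℍ[ℝ]) (hA : A ∈ tildeInv.Herm (Fin n)),
      GroupCase ((starInv ℍ[ℝ]).Herm (Fin n)) ((starInv ℍ[ℝ]).Herm (Fin n))
        (fun X => -(A * (X * A).map conjJ)) (tildeInv.U hA)) ∧
    -- 3.1.b'
    (∀ (A : Matrix (Fin n) (Fin n) ℍ[ℝ]) (hA : A ∈ tildeInv.Herm (Fin n)),
      SymmetricCase ((starInv ℍ[ℝ]).Herm (Fin n)) ((starInv ℍ[ℝ]).Herm (Fin n))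
        (fun X => A * (X * A).map conjJ)
        ((idInv ℂ).U (complexMat_mem_Herm_id hA))
        (fun h : tildeInv.U hA => complexMat h.1.val)) ∧
    -- 2.2.a
    (∀ (A : Matrix (Fin n) (Fin n) ℍ[ℝ]) (hA : A ∈ tildeInv.Herm (Fin n)),
      SymmetricCase (tildeInv.Herm (Fin n)) (tildeInv.Herm (Fin n)) (fun X => A * X * A)
        (⊤ : Subgroup (Gl A)) (fun h : tildeInv.U hA => h.1.val)) ∧
    -- 2.2.a'
    (∀ (A : Matrix (Fin n) (Fin n) ℍ[ℝ]) (hA : A ∈ tildeInv.Herm (Fin n)),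
      SymmetricCase (tildeInv.Herm (Fin n)) (tildeInv.Herm (Fin n)) (fun X => -(A * X * A))
        ((starInv ℂ).U (I_smul_J_mul_mem_Herm hA))
        (fun h : tildeInv.U hA => complexMat h.1.val * (Complex.I • matJ (Fin n)))) ∧
    -- 2.2.b
    (∀ (A : Matrix (Fin n) (Fin n) ℍ[ℝ]) (hA : A ∈ (starInv ℍ[ℝ]).Herm (Fin n)),
      GroupCase (tildeInv.Herm (Fin n)) (tildeInv.Herm (Fin n))
        (fun X => -(A * (X * A).map conjJ)) ((starInv ℍ[ℝ]).U hA)) ∧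
    -- 2.2.b'
    (∀ (A : Matrix (Fin n) (Fin n) ℍ[ℝ]) (hA : A ∈ (starInv ℍ[ℝ]).Herm (Fin n)),
      SymmetricCase (tildeInv.Herm (Fin n)) (tildeInv.Herm (Fin n))
        (fun X => A * (X * A).map conjJ)
        ((idInv ℂ).Sp (J_mul_mem_Aherm hA))
        (fun h : (starInv ℍ[ℝ]).U hA => -(complexMat h.1.val * matJ (Fin n)))) := by
  exact ⟨groupCase_top_entrywise, AdjI.symmetricCase_top, fun _ _ => symmetricCase_grassmannian_U
    _, fun _ _ => symmetricCase_grassmannian_Sp _, symmetricCase_top_matrix,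
    symmetricCase_top_quaternion, fun _ _ => symmetricCase_grassmannian_U _,
    groupCase_top_entrywise, symmetricCase_top_complexMatrix, fun _ _ =>
    symmetricCase_grassmannian_U _, fun _ _ => symmetricCase_grassmannian_U _, fun _ =>
    RealInvolution.symmetricCase_top_U _, fun _ => AdjI.symmetricCase_starInv_U, fun _ =>
    groupCase_symplectic, fun _ => AdjI.symmetricCase_idInv_Sp, fun _ =>
    symmetricCase_starInv_quaternion, fun _ => symmetricCase_realMat_Sp, fun _ =>
    RealInvolution.symmetricCase_top_Sp _, fun _ => AdjI.symmetricCase_starInv_Sp, fun _ =>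
    groupCase_orthogonal, fun _ => AdjI.symmetricCase_idInv_U, fun _ =>
    symmetricCase_tildeInv_complexJ, fun _ => symmetricCase_realMat_U, fun _ =>
    RealInvolution.symmetricCase_top_U _, fun _ => groupCase_unitary_complex, fun _ =>
    symmetricCase_tildeInv_quaternion, fun _ => symmetricCase_realMat'_U, fun _ =>
    symmetricCase_realMat'_Sp, fun _ => symmetricCase_starInv_qj, fun _ =>
    RealInvolution.symmetricCase_top_U _, fun _ => symmetricCase_complexMat_starInv, fun _ =>
    groupCase_tildeInv, fun _ => symmetricCase_complexMat_tildeInv, fun _ =>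
    RealInvolution.symmetricCase_top_U _, fun _ => symmetricCase_complexMat_mul_I_matJ, fun _ =>
    groupCase_starInv, fun _ => symmetricCase_complexMat_mul_matJ⟩
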